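/- Let $(\mathcal V,\otimes,I)$ be a bicomplete symmetric monoidal closed category. For a set $S$, a $\mathcal V$-quiver on $S$ is a family $Q=(Q(a,b))_{a,b\in S}$ of objects of $\mathcal V$; $\mathcal V$-quivers on $S$ form a monoidal category with $(Q\otimes P)(a,b)=\coprod_{c\in S}Q(a,c)\otimes P(c,b)$, whose unit is $I$ on the diagonal and $0$ (initial) elsewhere. Let $\mathbf{\Delta}_f$ be the category of the ordered sets $[n]=\{0<\dots<n\}$, $n\ge 0$, and the order morphisms that preserve both endpoints, monoidal by $[m]+[n]=[m+n]$ (identify the last element of $[m]$ with the first of $[n]$). A *templicial object* $(X,S)$ in $\mathcal V$ is a set $S$ with a colax monoidal functor $X$ from $\mathbf{\Delta}_f^{op}$ to $\mathcal V$-quivers on $S$, $[n]\mapsto X_n$, whose counit from $X_0$ to the unit quiver is an isomorphism. A morphism $(X,S)\to(Y,T)$ is a map $f:S\to T$ with morphisms $X_n(a,b)\to Y_n(f(a),f(b))$ that are natural in $[n]$ and compatible with the comultiplications and counits (equivalently, a monoidal natural transformation $f_!X\to Y$). For a simplicial set $K$, the templicial object $\tilde F(K)$ has vertex set $K_0$,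 and $\tilde F(K)_n(a,b)$ is the coproduct of copies of $I$ indexed by the $n$-simplices of $K$ with first vertex $a$ and last vertex $b$; the structure is induced by that of $K$, the comultiplication $\tilde F(K)_{m+n}\to\tilde F(K)_m\otimes\tilde F(K)_n$ sending a simplex to the pair of its restrictions to $\{0,\dots,m\}$ and $\{m,\dots,m+n\}$. The *underlying simplicial set* $\tilde U(X)$ of $X$ is given by $\tilde U(X)_n=\mathrm{Hom}(\tilde F(\Delta^n),X)$. Let $\mathrm{nec}$ be the category with objects the pairs $(T,p)$, $p\ge 0$, $\{0,p\}\subseteq T\subseteq[p]$, and morphisms $(T,p)\to(U,q)$ the morphisms $f:[p]\to[q]$ of $\mathbf{\Delta}_f$ with $U\subseteq f(T)$. A templicial object $X$ with $a,b\in S$ yields a functor $X_\bullet(a,b):\mathrm{nec}^{op}\to\mathcal V$, functorial in $X$, with value $(X_{t_1}\otimes X_{t_2-t_1}\otimes\dots\otimes X_{p-t_{k-1}})(a,b)$ at $(\{0<t_1<\dots<t_{k-1}<p\},p)$ and $X_0(a,b)$ at $(\{0\},0)$; it acts on morphisms through the comultiplications, the counit isomorphism and the values of $X$ on morphisms of $\mathbf{\Delta}_f$.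 The templicial object $X$ is a *quasi-category in $\mathcal V$* if for all $a,b\in S$ and all $0<j<n$, every morphism $\tilde F(\Lambda^n_j)_\bullet(0,n)\to X_\bullet(a,b)$ in $\mathcal V^{\mathrm{nec}^{op}}$ extends along the morphism $\tilde F(\Lambda^n_j)_\bullet(0,n)\to\tilde F(\Delta^n)_\bullet(0,n)$ induced by the inclusion $\Lambda^n_j\subseteq\Delta^n$. **Statement.** For every bicomplete symmetric monoidal closed category $\mathcal V$ and every quasi-category $X$ in $\mathcal V$, the simplicial set $\tilde U(X)$ is a quasi-category. The converse fails in general: there are a bicomplete symmetric monoidal closed category $\mathcal V$ and a templicial object $X$ in $\mathcal V$ such that $\tilde U(X)$ is a quasi-category but $X$ is not a quasi-category in $\mathcal V$. -/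

import Mathlib

universe u w

open CategoryTheory MonoidalCategory Limits Opposite

set_option linter.unusedSectionVars false

noncomputable section

namespace Templ

section Quivers

variable {V : Type w} [Category.{u} V] [MonoidalCategory V] [SymmetricCategory V]
  [MonoidalClosed V] [HasColimits V]

/-- `V`-enriched quivers with vertex set `S`. -/
structure VQuiv (V : Type w) (S : Type u) : Type max w u where
  /-- The object of edges between two vertices. -/
  obj : S → S → V

instance (S : Type u) : CoeFun (VQuiv V S) (fun _ => S → S → V) := ⟨VQuiv.obj⟩

variable {S : Type u}

/-- Morphisms of quivers with the same vertices. -/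
structure VQuiv.Hom (Q P : VQuiv V S) : Type u where
  /-- The morphism between objects of edges. -/
  app : ∀ a b, Q a b ⟶ P a b

instance : Category.{u} (VQuiv V S) where
  Hom := VQuiv.Hom
  id Q := ⟨fun a b => 𝟙 (Q a b)⟩
  comp f g := ⟨fun a b => f.app a b ≫ g.app a b⟩

@[ext] lemma VQuiv.hom_ext {Q P : VQuiv V S} {f g : Q ⟶ P} (h : ∀ a b, f.app a b = g.app a b) :
    f = g := by
  obtain ⟨f⟩ := f
  obtain ⟨g⟩ := g
  congr
  exact funext fun a => funext fun b => h a b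

@[simp] lemma VQuiv.id_app (Q : VQuiv V S) (a b : S) :
    VQuiv.Hom.app (𝟙 Q) a b = 𝟙 (Q a b) := rfl

@[simp] lemma VQuiv.comp_app {Q P R : VQuiv V S} (f : Q ⟶ P) (g : P ⟶ R) (a b : S) :
    VQuiv.Hom.app (f ≫ g) a b = f.app a b ≫ g.app a b := rfl

/-- Maps out of `(∐ A) ⊗ B`; tensoring preserves coproducts as `V` is closed. -/
def descR {J : Type u} {A : J → V} {B C : V} (φ : ∀ j, A j ⊗ B ⟶ C) : (∐ A) ⊗ B ⟶ C :=
  inv (sigmaComparison (tensorRight B) A) ≫ Limits.Sigma.desc φ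

lemma ι_descR {J : Type u} {A : J → V} {B C : V}
    (φ : ∀ j, A j ⊗ B ⟶ C) (j : J) : Sigma.ι A j ▷ B ≫ descR φ = φ j := by
  have := ι_comp_sigmaComparison (tensorRight B) A j
  dsimp at this
  simp [descR, ← this]

lemma hom_extR {J : Type u} {A : J → V} {B C : V} {f g : (∐ A) ⊗ B ⟶ C}
    (h : ∀ j, Sigma.ι A j ▷ B ≫ f = Sigma.ι A j ▷ B ≫ g) : f = g := by
  rw [← cancel_epi (sigmaComparison (tensorRight B) A)]
  refine Sigma.hom_ext _ _ fun j => ?_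
  have := ι_comp_sigmaComparison (tensorRight B) A j
  dsimp at this ⊢
  rw [reassoc_of% this, reassoc_of% this, h]

/-- Maps out of `B ⊗ (∐ A)`. -/
def descL {J : Type u} {A : J → V} {B C : V} (φ : ∀ j, B ⊗ A j ⟶ C) : B ⊗ (∐ A) ⟶ C :=
  inv (sigmaComparison (tensorLeft B) A) ≫ Limits.Sigma.desc φ

lemma ι_descL {J : Type u} {A : J → V} {B C : V}
    (φ : ∀ j, B ⊗ A j ⟶ C) (j : J) : B ◁ Sigma.ι A j ≫ descL φ = φ j := by
  have := ι_comp_sigmaComparison (tensorLeft B) A j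
  dsimp at this
  simp [descL, ← this]

lemma hom_extL {J : Type u} {A : J → V} {B C : V} {f g : B ⊗ (∐ A) ⟶ C}
    (h : ∀ j, B ◁ Sigma.ι A j ≫ f = B ◁ Sigma.ι A j ≫ g) : f = g := by
  rw [← cancel_epi (sigmaComparison (tensorLeft B) A)]
  refine Sigma.hom_ext _ _ fun j => ?_
  have := ι_comp_sigmaComparison (tensorLeft B) A j
  dsimp at this ⊢
  rw [reassoc_of% this, reassoc_of% this, h]

namespace VQuiv

/-- `(Q ⊗ P)(a, b) = ∐ c, Q(a, c) ⊗ P(c, b)`. -/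
def tensor (Q P : VQuiv V S) : VQuiv V S :=
  ⟨fun a b => ∐ fun c : S => Q a c ⊗ P c b⟩

/-- The unit quiver: the tensor unit on the diagonal and an initial object off the diagonal, written
as the coproduct of copies of the tensor unit indexed by the proofs of `a = b`. -/
def unit : VQuiv V S :=
  ⟨fun a b => ∐ fun _ : ULift.{u} (PLift (a = b)) => 𝟙_ V⟩

/-- The inclusion of the summand of index `c`. -/
def inc (Q P : VQuiv V S) (a b c : S) : Q a c ⊗ P c b ⟶ (tensor Q P).obj a b :=
  Sigma.ι (fun c : S => Q a c ⊗ P c b) c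

/-- Maps out of a tensor product of quivers. -/
def desc {Q P : VQuiv V S} {a b : S} {Z : V} (φ : ∀ c, Q a c ⊗ P c b ⟶ Z) : (tensor Q P).obj a b ⟶ Z :=
  Limits.Sigma.desc φ

@[simp] lemma inc_desc {Q P : VQuiv V S} {a b : S} {Z : V} (φ : ∀ c, Q a c ⊗ P c b ⟶ Z) (c : S) :
    inc Q P a b c ≫ desc φ = φ c :=
  Limits.Sigma.ι_desc _ _

lemma tensor_ext {Q P : VQuiv V S} {a b : S} {Z : V} {f g : (tensor Q P).obj a b ⟶ Z}
    (h : ∀ c, inc Q P a b c ≫ f = inc Q P a b c ≫ g) : f = g :=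
  Sigma.hom_ext _ _ h

lemma tensor_extR {Q P : VQuiv V S} {a b : S} {Y Z : V} {f g : (tensor Q P).obj a b ⊗ Y ⟶ Z}
    (h : ∀ c, inc Q P a b c ▷ Y ≫ f = inc Q P a b c ▷ Y ≫ g) : f = g :=
  hom_extR h

lemma tensor_extL {Q P : VQuiv V S} {a b : S} {Y Z : V} {f g : Y ⊗ (tensor Q P).obj a b ⟶ Z}
    (h : ∀ c, Y ◁ inc Q P a b c ≫ f = Y ◁ inc Q P a b c ≫ g) : f = g :=
  hom_extL h

/-- The inclusion of the tensor unit in the unit quiver at `(a, b)` given by a proof of `a = b`. -/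
def unitInc {a b : S} (e : a = b) : 𝟙_ V ⟶ unit.obj a b :=
  Sigma.ι (fun _ : ULift.{u} (PLift (a = b)) => 𝟙_ V) ⟨⟨e⟩⟩

lemma unit_ext {a b : S} {Z : V} {f g : unit.obj a b ⟶ Z}
    (h : ∀ e : a = b, unitInc e ≫ f = unitInc e ≫ g) : f = g :=
  Sigma.hom_ext _ _ fun j => h j.down.down

lemma unit_extR {a b : S} {Y Z : V} {f g : unit.obj a b ⊗ Y ⟶ Z}
    (h : ∀ e : a = b, unitInc e ▷ Y ≫ f = unitInc e ▷ Y ≫ g) : f = g :=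
  hom_extR fun j => h j.down.down

lemma unit_extL {a b : S} {Y Z : V} {f g : Y ⊗ unit.obj a b ⟶ Z}
    (h : ∀ e : a = b, Y ◁ unitInc e ≫ f = Y ◁ unitInc e ≫ g) : f = g :=
  hom_extL fun j => h j.down.down

lemma tensor_extRR {Q P : VQuiv V S} {a b : S} {Y Y' Z : V}
    {f g : ((tensor Q P).obj a b ⊗ Y) ⊗ Y' ⟶ Z}
    (h : ∀ c, inc Q P a b c ▷ Y ▷ Y' ≫ f = inc Q P a b c ▷ Y ▷ Y' ≫ g) : f = g := by
  rw [← cancel_epi (α_ _ _ _).inv]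
  refine tensor_extR fun c => ?_
  have := h c
  rw [← cancel_epi (α_ _ _ _).inv] at this
  simpa using this

lemma unit_extLR {a b : S} {Y Y' Z : V} {f g : (Y ⊗ unit.obj a b) ⊗ Y' ⟶ Z}
    (h : ∀ e : a = b, (Y ◁ unitInc e) ▷ Y' ≫ f = (Y ◁ unitInc e) ▷ Y' ≫ g) : f = g := by
  rw [← cancel_epi ((α_ _ _ _).inv ≫ (β_ _ _).hom ▷ Y')]
  refine unit_extR fun e => ?_
  simp only [Category.assoc, associator_inv_naturality_left_assoc]
  simp only [← comp_whiskerRight_assoc, BraidedCategory.braiding_naturality_left]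
  simp only [comp_whiskerRight, Category.assoc, h e]

/-- Maps out of `(Q ⊗ P)(a, b) ⊗ Y`. -/
def tensorDescR {Q P : VQuiv V S} {a b : S} {Y Z : V} (φ : ∀ c, (Q a c ⊗ P c b) ⊗ Y ⟶ Z) :
    (tensor Q P).obj a b ⊗ Y ⟶ Z :=
  descR φ

/-- Maps out of `Y ⊗ (Q ⊗ P)(a, b)`. -/
def tensorDescL {Q P : VQuiv V S} {a b : S} {Y Z : V} (φ : ∀ c, Y ⊗ (Q a c ⊗ P c b) ⟶ Z) :
    Y ⊗ (tensor Q P).obj a b ⟶ Z :=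
  descL φ

@[simp] lemma inc_tensorDescR {Q P : VQuiv V S} {a b : S} {Y Z : V}
    (φ : ∀ c, (Q a c ⊗ P c b) ⊗ Y ⟶ Z) (c : S) :
    inc Q P a b c ▷ Y ≫ tensorDescR φ = φ c := ι_descR _ _

@[simp] lemma inc_tensorDescL {Q P : VQuiv V S} {a b : S} {Y Z : V}
    (φ : ∀ c, Y ⊗ (Q a c ⊗ P c b) ⟶ Z) (c : S) :
    Y ◁ inc Q P a b c ≫ tensorDescL φ = φ c := ι_descL _ _

/-- Maps out of the unit quiver tensored on the right. -/
def unitDescR {a b : S} {Y Z : V} (φ : ∀ _ : a = b, Y ⟶ Z) : unit.obj a b ⊗ Y ⟶ Z :=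
  descR fun j => (λ_ Y).hom ≫ φ j.down.down

/-- Maps out of the unit quiver tensored on the left. -/
def unitDescL {a b : S} {Y Z : V} (φ : ∀ _ : a = b, Y ⟶ Z) : Y ⊗ unit.obj a b ⟶ Z :=
  descL fun j => (ρ_ Y).hom ≫ φ j.down.down

@[simp] lemma unitInc_unitDescR {a b : S} {Y Z : V} (φ : ∀ _ : a = b, Y ⟶ Z) (e : a = b) :
    unitInc e ▷ Y ≫ unitDescR φ = (λ_ Y).hom ≫ φ e := ι_descR _ _

@[simp] lemma unitInc_unitDescL {a b : S} {Y Z : V} (φ : ∀ _ : a = b, Y ⟶ Z) (e : a = b) :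
    Y ◁ unitInc e ≫ unitDescL φ = (ρ_ Y).hom ≫ φ e := ι_descL _ _

/-- The tensor product of quiver morphisms. -/
def tmap {Q Q' P P' : VQuiv V S} (f : Q ⟶ Q') (g : P ⟶ P') : tensor Q P ⟶ tensor Q' P' :=
  ⟨fun a b => desc fun c => (f.app a c ⊗ₘ g.app c b) ≫ inc Q' P' a b c⟩

@[simp] lemma inc_tmap {Q Q' P P' : VQuiv V S} (f : Q ⟶ Q') (g : P ⟶ P')
    (a b c : S) : inc Q P a b c ≫ (tmap f g).app a b = (f.app a c ⊗ₘ g.app c b) ≫ inc Q' P' a b c := by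
  simp [tmap]

@[simp] lemma inc_tmap_assoc {Q Q' P P' : VQuiv V S} (f : Q ⟶ Q') (g : P ⟶ P')
    (a b c : S) {Z : V} (k : (tensor Q' P').obj a b ⟶ Z) :
    inc Q P a b c ≫ (tmap f g).app a b ≫ k = (f.app a c ⊗ₘ g.app c b) ≫ inc Q' P' a b c ≫ k := by
  rw [← Category.assoc, inc_tmap, Category.assoc]

/-- The associator, forwards. -/
def assocHom (Q P R : VQuiv V S) : tensor (tensor Q P) R ⟶ tensor Q (tensor P R) :=
  ⟨fun a b => desc fun d => tensorDescR fun c =>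
    (α_ _ _ _).hom ≫ Q a c ◁ inc P R c b d ≫ inc Q (tensor P R) a b c⟩

/-- The associator, backwards. -/
def assocInv (Q P R : VQuiv V S) : tensor Q (tensor P R) ⟶ tensor (tensor Q P) R :=
  ⟨fun a b => desc fun c => tensorDescL fun d =>
    (α_ _ _ _).inv ≫ inc Q P a d c ▷ R d b ≫ inc (tensor Q P) R a b d⟩

@[simp] lemma inc_assocHom (Q P R : VQuiv V S) (a b c d : S) :
    inc Q P a d c ▷ R d b ≫ inc (tensor Q P) R a b d ≫ (assocHom Q P R).app a b =
      (α_ _ _ _).hom ≫ Q a c ◁ inc P R c b d ≫ inc Q (tensor P R) a b c := by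
  simp [assocHom]

@[simp] lemma inc_assocHom_assoc (Q P R : VQuiv V S) (a b c d : S) {Z : V}
    (k : (tensor Q (tensor P R)).obj a b ⟶ Z) :
    inc Q P a d c ▷ R d b ≫ inc (tensor Q P) R a b d ≫ (assocHom Q P R).app a b ≫ k =
      (α_ _ _ _).hom ≫ Q a c ◁ inc P R c b d ≫ inc Q (tensor P R) a b c ≫ k := by
  have := inc_assocHom Q P R a b c d
  simp only [← Category.assoc] at this ⊢
  rw [this]

@[simp] lemma inc_assocInv (Q P R : VQuiv V S) (a b c d : S) :
    Q a c ◁ inc P R c b d ≫ inc Q (tensor P R) a b c ≫ (assocInv Q P R).app a b =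
      (α_ _ _ _).inv ≫ inc Q P a d c ▷ R d b ≫ inc (tensor Q P) R a b d := by
  simp [assocInv]

@[simp] lemma inc_assocInv_assoc (Q P R : VQuiv V S) (a b c d : S) {Z : V}
    (k : (tensor (tensor Q P) R).obj a b ⟶ Z) :
    Q a c ◁ inc P R c b d ≫ inc Q (tensor P R) a b c ≫ (assocInv Q P R).app a b ≫ k =
      (α_ _ _ _).inv ≫ inc Q P a d c ▷ R d b ≫ inc (tensor Q P) R a b d ≫ k := by
  have := inc_assocInv Q P R a b c d
  simp only [← Category.assoc] at this ⊢
  rw [this]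

/-- The left unitor, forwards. -/
def leftHom (Q : VQuiv V S) : tensor unit Q ⟶ Q :=
  ⟨fun a b => desc fun c => unitDescR fun h => eqToHom (by rw [h])⟩

/-- The left unitor, backwards. -/
def leftInv (Q : VQuiv V S) : Q ⟶ tensor unit Q :=
  ⟨fun a b => (λ_ _).inv ≫ unitInc (rfl : a = a) ▷ Q a b ≫ inc unit Q a b a⟩

/-- The right unitor, forwards. -/
def rightHom (Q : VQuiv V S) : tensor Q unit ⟶ Q :=
  ⟨fun a b => desc fun c => unitDescL fun h => eqToHom (by rw [h])⟩

/-- The right unitor, backwards. -/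
def rightInv (Q : VQuiv V S) : Q ⟶ tensor Q unit :=
  ⟨fun a b => (ρ_ _).inv ≫ Q a b ◁ unitInc (rfl : b = b) ≫ inc Q unit a b b⟩

@[simp] lemma unitInc_leftHom (Q : VQuiv V S) (a b : S) (e : a = a) :
    unitInc e ▷ Q a b ≫ inc unit Q a b a ≫ (leftHom Q).app a b = (λ_ _).hom := by
  simp [leftHom]

@[simp] lemma unitInc_leftHom_assoc (Q : VQuiv V S) (a b : S) (e : a = a) {Z : V}
    (k : Q a b ⟶ Z) :
    unitInc e ▷ Q a b ≫ inc unit Q a b a ≫ (leftHom Q).app a b ≫ k = (λ_ _).hom ≫ k := by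
  rw [← unitInc_leftHom Q a b e]
  simp only [Category.assoc]

@[simp] lemma unitInc_rightHom (Q : VQuiv V S) (a b : S) (e : b = b) :
    Q a b ◁ unitInc e ≫ inc Q unit a b b ≫ (rightHom Q).app a b = (ρ_ _).hom := by
  simp [rightHom]

@[simp] lemma unitInc_rightHom_assoc (Q : VQuiv V S) (a b : S) (e : b = b) {Z : V}
    (k : Q a b ⟶ Z) :
    Q a b ◁ unitInc e ≫ inc Q unit a b b ≫ (rightHom Q).app a b ≫ k = (ρ_ _).hom ≫ k := by
  rw [← unitInc_rightHom Q a b e]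
  simp only [Category.assoc]

/-- The associator. -/
@[simps] def assocIso (Q P R : VQuiv V S) : tensor (tensor Q P) R ≅ tensor Q (tensor P R) where
  hom := assocHom Q P R
  inv := assocInv Q P R
  hom_inv_id := by
    ext a b
    refine tensor_ext fun d => tensor_extR fun c => ?_
    simp
  inv_hom_id := by
    ext a b
    refine tensor_ext fun c => tensor_extL fun d => ?_
    simp

/-- The left unitor. -/
@[simps] def leftIso (Q : VQuiv V S) : tensor unit Q ≅ Q where
  hom := leftHom Q
  inv := leftInv Q
  hom_inv_id := by
    ext a b
    refine tensor_ext fun d => unit_extR fun e => ?_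
    cases e
    simp [leftInv]
  inv_hom_id := by
    ext a b
    simp [leftInv]

/-- The right unitor. -/
@[simps] def rightIso (Q : VQuiv V S) : tensor Q unit ≅ Q where
  hom := rightHom Q
  inv := rightInv Q
  hom_inv_id := by
    ext a b
    refine tensor_ext fun d => unit_extL fun e => ?_
    cases e
    simp [rightInv]
  inv_hom_id := by
    ext a b
    simp [rightInv]

/-- The monoidal structure on quivers. -/
instance : MonoidalCategory (VQuiv V S) where
  tensorObj := tensor
  tensorUnit := unit
  tensorHom := tmap
  whiskerLeft Q _ _ f := tmap (𝟙 Q) f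
  whiskerRight f P := tmap f (𝟙 P)
  associator := assocIso
  leftUnitor := leftIso
  rightUnitor := rightIso
  tensorHom_def f g := by
    ext a b
    exact tensor_ext fun c => by simp [MonoidalCategory.tensorHom_def]
  id_tensorHom_id Q P := by
    ext a b
    exact tensor_ext fun c => by simp
  tensorHom_comp_tensorHom f₁ f₂ g₁ g₂ := by
    ext a b
    exact tensor_ext fun c => by simp
  whiskerLeft_id Q P := by
    ext a b
    exact tensor_ext fun c => by simp
  id_whiskerRight Q P := by
    ext a b
    exact tensor_ext fun c => by simp
  associator_naturality {Q₁ Q₂ Q₃ P₁ P₂ P₃} f₁ f₂ f₃ := by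
    ext a b
    refine tensor_ext fun d => tensor_extR fun c => ?_
    simp only [comp_app, inc_tmap_assoc, assocIso_hom, inc_assocHom_assoc, inc_tmap,
      MonoidalCategory.tensorHom_def, Category.assoc]
    rw [← comp_whiskerRight_assoc, inc_tmap, whisker_exchange_assoc,
      ← MonoidalCategory.whiskerLeft_comp_assoc (Y := (tensor Q₂ Q₃).obj c b), inc_tmap]
    simp only [comp_whiskerRight, MonoidalCategory.whiskerLeft_comp, Category.assoc,
      MonoidalCategory.tensorHom_def, ← whisker_exchange_assoc, inc_assocHom]
    rw [whisker_exchange_assoc (f₁.app a c) (inc P₂ P₃ c b d)]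
    monoidal
  leftUnitor_naturality f := by
    ext a b
    refine tensor_ext fun d => unit_extR fun e => ?_
    cases e
    simp [← whisker_exchange_assoc]
  rightUnitor_naturality f := by
    ext a b
    refine tensor_ext fun d => unit_extL fun e => ?_
    cases e
    simp [whisker_exchange_assoc]
  pentagon Q P R T := by
    ext a b
    refine tensor_ext fun e => tensor_extR fun d => tensor_extRR fun c => ?_
    simp only [comp_app, inc_tmap_assoc, assocIso_hom, inc_tmap, id_app,
      MonoidalCategory.tensorHom_id, MonoidalCategory.id_tensorHom, inc_assocHom_assoc,
      inc_assocHom]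
    have h1 := congrArg (fun k => k ▷ T e b) (inc_assocHom Q P R a e c d)
    have h2 := congrArg (fun k => Q a c ◁ k) (inc_assocHom P R T c b d e)
    simp only [comp_whiskerRight, MonoidalCategory.whiskerLeft_comp] at h1 h2
    rw [reassoc_of% h1, associator_naturality_left_assoc, ← whisker_exchange_assoc]
    simp only [inc_assocHom, inc_assocHom_assoc, inc_tmap, id_app, MonoidalCategory.id_tensorHom]
    simp only [whisker_assoc, Category.assoc, Iso.inv_hom_id_assoc]
    rw [reassoc_of% h2]
    monoidal
  triangle Q P := by
    ext a b
    refine tensor_ext fun d => tensor_extR fun c => unit_extLR fun e => ?_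
    cases e
    simp only [comp_app, inc_tmap_assoc, assocIso_hom, inc_tmap, id_app, leftIso_hom, rightIso_hom,
      MonoidalCategory.tensorHom_id, MonoidalCategory.id_tensorHom, inc_assocHom_assoc,
      inc_assocHom]
    have h1 := congrArg (fun k => k ▷ P d b) (unitInc_rightHom Q a d rfl)
    have h2 := congrArg (fun k => Q a d ◁ k) (unitInc_leftHom P d b rfl)
    simp only [comp_whiskerRight, MonoidalCategory.whiskerLeft_comp] at h1 h2
    rw [reassoc_of% h1]
    simp only [whisker_assoc, Category.assoc, Iso.inv_hom_id_assoc]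
    rw [reassoc_of% h2]
    monoidal

end VQuiv
end Quivers

section Intervals

/-- The objects `[n] = {0, ..., n}` of the category of finite intervals. -/
structure FinInt : Type where
  /-- The last element of the interval. -/
  len : ℕ

namespace FinInt

/-- Morphisms of finite intervals: order morphisms preserving the endpoints. -/
structure Hom (m n : FinInt) : Type where
  /-- The underlying order morphism. -/
  toOrderHom : Fin (m.len + 1) →o Fin (n.len + 1)
  map_zero : toOrderHom 0 = 0
  map_last : toOrderHom (Fin.last m.len) = Fin.last n.len

instance : Category FinInt where
  Hom := Hom
  id m := ⟨OrderHom.id, rfl, rfl⟩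
  comp f g := ⟨g.toOrderHom.comp f.toOrderHom,
    by simp [f.map_zero, g.map_zero], by simp [f.map_last, g.map_last]⟩

/-- The extension of a morphism to a function on natural numbers, constant after the endpoint. -/
def nat {m n : FinInt} (f : m ⟶ n) (i : ℕ) : ℕ :=
  Hom.toOrderHom f ⟨min i m.len, by omega⟩

/-- Construct a morphism from a function on natural numbers. -/
def ofNat {m n : FinInt} (g : ℕ → ℕ) (hg : ∀ i j, i ≤ j → j ≤ m.len → g i ≤ g j)
    (h0 : g 0 = 0) (h1 : g m.len = n.len) : m ⟶ n :=
  show Hom m n from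
  { toOrderHom :=
      { toFun := fun i => ⟨g i, by have := hg i m.len (by omega) le_rfl; omega⟩
        monotone' := fun i j h => by
          have := hg i j h (by omega)
          simpa using this }
    map_zero := Fin.ext h0
    map_last := Fin.ext h1 }

lemma nat_ofNat {m n : FinInt} {g : ℕ → ℕ} {hg : ∀ i j, i ≤ j → j ≤ m.len → g i ≤ g j}
    {h0 : g 0 = 0} {h1 : g m.len = n.len} {i : ℕ} (hi : i ≤ m.len) :
    nat (ofNat (m := m) (n := n) g hg h0 h1) i = g i := by
  show g (min i m.len) = g i
  rw [min_eq_left hi]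

lemma hom_ext {m n : FinInt} {f g : m ⟶ n} (h : ∀ i, i ≤ m.len → nat f i = nat g i) : f = g := by
  obtain ⟨f, _, _⟩ := f
  obtain ⟨g, _, _⟩ := g
  congr
  ext i
  have := h i (by omega)
  have e : (⟨min (i : ℕ) m.len, by omega⟩ : Fin (m.len + 1)) = i := by ext; simp; omega
  simpa [nat, e] using this

@[simp] lemma nat_zero {m n : FinInt} (f : m ⟶ n) : nat f 0 = 0 := by
  have := f.map_zero
  simp only [nat, Nat.zero_min]
  exact congrArg Fin.val this

lemma nat_last {m n : FinInt} (f : m ⟶ n) {i : ℕ} (hi : i = m.len) : nat f i = n.len := by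
  subst hi
  have := f.map_last
  simp only [nat, min_self]
  exact congrArg Fin.val this

lemma nat_mono {m n : FinInt} (f : m ⟶ n) {i j : ℕ} (h : i ≤ j) : nat f i ≤ nat f j :=
  (Hom.toOrderHom f).monotone (by
    rw [Fin.mk_le_mk]
    exact min_le_min_right _ h)

lemma nat_le {m n : FinInt} (f : m ⟶ n) (i : ℕ) : nat f i ≤ n.len := by
  have := (Hom.toOrderHom f ⟨min i m.len, by omega⟩).isLt
  exact Nat.lt_succ_iff.mp this

lemma nat_id {m : FinInt} {i : ℕ} (hi : i ≤ m.len) : nat (𝟙 m) i = i := by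
  show min i m.len = i
  omega

lemma nat_comp {m n k : FinInt} (f : m ⟶ n) (g : n ⟶ k) (i : ℕ) :
    nat (f ≫ g) i = nat g (nat f i) := by
  have h := nat_le f i
  show ((Hom.toOrderHom g (Hom.toOrderHom f _) : Fin _) : ℕ) = _
  unfold nat at h ⊢
  congr 2
  ext
  simp only
  omega

/-- The identity function as an isomorphism between propositionally equal intervals. -/
def castIso {m n : FinInt} (h : m.len = n.len) : m ≅ n where
  hom := ofNat id (fun _ _ h _ => h) rfl h
  inv := ofNat id (fun _ _ h _ => h) rfl h.symm
  hom_inv_id := hom_ext fun i hi => by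
    rw [nat_comp, nat_ofNat hi, nat_ofNat (by simp; omega), nat_id hi]; rfl
  inv_hom_id := hom_ext fun i hi => by
    rw [nat_comp, nat_ofNat hi, nat_ofNat (by simp; omega), nat_id hi]; rfl

lemma nat_castIso_hom {m n : FinInt} {h : m.len = n.len} {i : ℕ} (hi : i ≤ m.len) :
    nat (castIso h).hom i = i := by
  simp only [castIso]
  rw [nat_ofNat hi, id]

lemma nat_castIso_inv {m n : FinInt} {h : m.len = n.len} {i : ℕ} (hi : i ≤ n.len) :
    nat (castIso h).inv i = i := by
  simp only [castIso]
  rw [nat_ofNat hi, id]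

/-- `[m] + [n] = [m + n]`, identifying the last element of `[m]` with the first of `[n]`. -/
def add (m n : FinInt) : FinInt := ⟨m.len + n.len⟩

@[simp] lemma add_len (m n : FinInt) : (add m n).len = m.len + n.len := rfl

/-- The sum of two morphisms. -/
def addHom {m m' n n' : FinInt} (f : m ⟶ m') (g : n ⟶ n') : add m n ⟶ add m' n' :=
  ofNat (fun i => if i ≤ m.len then nat f i else m'.len + nat g (i - m.len))
    (fun i j h hj => by
      rw [add_len] at hj
      try simp only
      split_ifs with h1 h2 h2
      · exact nat_mono f h
      · have := nat_le f i; omega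
      · omega
      · have := nat_mono g (show i - m.len ≤ j - m.len by omega); omega)
    (by simp)
    (by
      rw [add_len, add_len]
      split_ifs with h
      · have h0 : n.len = 0 := by omega
        have h1 := nat_last g (i := 0) h0.symm
        rw [nat_zero] at h1
        rw [nat_last f (by omega)]
        omega
      · rw [nat_last g (by omega)])

lemma nat_addHom {m m' n n' : FinInt} (f : m ⟶ m') (g : n ⟶ n') {i : ℕ}
    (hi : i ≤ m.len + n.len) :
    nat (addHom f g) i = if i ≤ m.len then nat f i else m'.len + nat g (i - m.len) :=
  nat_ofNat hi

lemma nat_addHom_left {m m' n n' : FinInt} (f : m ⟶ m') (g : n ⟶ n') {i : ℕ} (hi : i ≤ m.len) :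
    nat (addHom f g) i = nat f i := by
  rw [nat_addHom f g (by omega), if_pos hi]

lemma nat_addHom_right {m m' n n' : FinInt} (f : m ⟶ m') (g : n ⟶ n') {i : ℕ}
    (hi : m.len ≤ i) (hi' : i ≤ m.len + n.len) :
    nat (addHom f g) i = m'.len + nat g (i - m.len) := by
  rw [nat_addHom f g hi']
  split_ifs with h
  · rw [nat_last f (by omega), show i - m.len = 0 by omega, nat_zero, Nat.add_zero]
  · rfl

/-- The unit interval `[0]`. -/
def zero : FinInt := ⟨0⟩

@[simp] lemma zero_len : zero.len = 0 := rfl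

lemma assoc_len (m n k : FinInt) : (add (add m n) k).len = (add m (add n k)).len :=
  Nat.add_assoc _ _ _

lemma zero_add_len (m : FinInt) : (add zero m).len = m.len := Nat.zero_add _

lemma add_zero_len (m : FinInt) : (add m zero).len = m.len := Nat.add_zero _

instance : MonoidalCategory FinInt where
  tensorObj := add
  tensorUnit := zero
  tensorHom := addHom
  whiskerLeft m _ _ f := addHom (𝟙 m) f
  whiskerRight f n := addHom f (𝟙 n)
  associator m n k := castIso (assoc_len m n k)
  leftUnitor m := castIso (zero_add_len m)
  rightUnitor m := castIso (add_zero_len m)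
  tensorHom_def {m m' n n'} f g := hom_ext fun i hi => by
    rw [add_len] at hi
    rw [nat_comp]
    rcases le_total i m.len with h | h
    · rw [nat_addHom_left f g h, nat_addHom_left f _ h, nat_addHom_left _ _ (nat_le f i),
        nat_id (nat_le f i)]
    · rw [nat_addHom_right f g h hi, nat_addHom_right f _ h hi, nat_id (by omega),
        nat_addHom_right _ _ (by omega) (by omega), Nat.add_sub_cancel_left]
  id_tensorHom_id m n := hom_ext fun i hi => by
    rw [add_len] at hi
    rw [nat_id (by simpa using hi)]
    rcases le_total i m.len with h | h
    · rw [nat_addHom_left _ _ h, nat_id h]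
    · rw [nat_addHom_right _ _ h hi, nat_id (by omega)]
      omega
  tensorHom_comp_tensorHom {m₁ m₂ m₃ n₁ n₂ n₃} f₁ f₂ g₁ g₂ := hom_ext fun i hi => by
    rw [add_len] at hi
    rw [nat_comp]
    rcases le_total i m₁.len with h | h
    · rw [nat_addHom_left _ _ h, nat_addHom_left _ _ (nat_le _ _), nat_addHom_left _ _ h, nat_comp]
    · have := nat_le f₂ (i - m₁.len)
      rw [nat_addHom_right _ _ h hi, nat_addHom_right _ _ (by omega) (by omega),
        nat_addHom_right _ _ h hi, Nat.add_sub_cancel_left, nat_comp]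
  whiskerLeft_id m n := hom_ext fun i hi => by
    rw [add_len] at hi
    rw [nat_id (by simpa using hi)]
    rcases le_total i m.len with h | h
    · rw [nat_addHom_left _ _ h, nat_id h]
    · rw [nat_addHom_right _ _ h hi, nat_id (by omega)]
      omega
  id_whiskerRight m n := hom_ext fun i hi => by
    rw [add_len] at hi
    rw [nat_id (by simpa using hi)]
    rcases le_total i m.len with h | h
    · rw [nat_addHom_left _ _ h, nat_id h]
    · rw [nat_addHom_right _ _ h hi, nat_id (by omega)]
      omega
  associator_naturality {m n k m' n' k'} f₁ f₂ f₃ := hom_ext fun i hi => by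
    rw [add_len, add_len] at hi
    have hl := nat_le (addHom (addHom f₁ f₂) f₃) i
    rw [nat_comp, nat_comp, nat_castIso_hom hl, nat_castIso_hom (by simpa using hi)]
    rcases le_total i m.len with h | h
    · rw [nat_addHom_left _ _ (by simp; omega), nat_addHom_left _ _ h, nat_addHom_left _ _ h]
    · rcases le_total i (m.len + n.len) with h' | h'
      · rw [nat_addHom_left _ _ (by simpa using h'), nat_addHom_right _ _ h h',
          nat_addHom_right _ _ h (by simp; omega), nat_addHom_left _ _ (by omega)]
      · rw [nat_addHom_right _ _ (by simpa using h') (by simpa using hi),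
          nat_addHom_right _ _ h (by simp; omega), nat_addHom_right _ _ (by omega) (by omega),
          add_len, add_len, Nat.add_assoc, Nat.sub_sub]
  leftUnitor_naturality {m n} f := hom_ext fun i hi => by
    rw [zero_add_len] at hi
    have h1 := nat_le f i
    have h2 : nat (addHom (𝟙 zero) f) i = nat f i := by
      rw [nat_addHom_right _ _ (show zero.len ≤ i from Nat.zero_le _) (by simpa using hi)]
      simp
    rw [nat_comp, nat_comp, h2, nat_castIso_hom (by simpa using h1),
      nat_castIso_hom (by simpa using hi)]
  rightUnitor_naturality {m n} f := hom_ext fun i hi => by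
    rw [add_zero_len] at hi
    rw [nat_comp, nat_comp, nat_addHom_left _ _ hi, nat_castIso_hom (by simpa using nat_le f i),
      nat_castIso_hom (by simpa using hi)]
  pentagon m n k l := hom_ext fun i hi => by
    simp only [add_len] at hi
    rw [nat_comp, nat_comp, nat_comp]
    have h1 : nat (addHom (castIso (assoc_len m n k)).hom (𝟙 l)) i = i := by
      rcases le_total i (m.len + n.len + k.len) with h | h
      · rw [nat_addHom_left _ _ (by simpa using h), nat_castIso_hom (by simpa using h)]
      · rw [nat_addHom_right _ _ (by simpa using h) (by simpa using hi), nat_id (by simp; omega)]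
        simp; omega
    have h2 : nat (addHom (𝟙 m) (castIso (assoc_len n k l)).hom) i = i := by
      rcases le_total i m.len with h | h
      · rw [nat_addHom_left _ _ h, nat_id h]
      · rw [nat_addHom_right _ _ h (by simp; omega), nat_castIso_hom (by simp; omega)]
        omega
    rw [h1, nat_castIso_hom (i := i) (by simp; omega), h2,
      nat_castIso_hom (h := assoc_len (add m n) k l) (i := i) (by simp; omega),
      nat_castIso_hom (i := i) (by simp; omega)]
  triangle m n := hom_ext fun i hi => by
    simp only [add_len] at hi
    simp only [zero_len] at hi
    rw [nat_comp, nat_castIso_hom (by simp; omega)]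
    rcases le_total i m.len with h | h
    · rw [nat_addHom_left _ _ h, nat_addHom_left _ _ (by simpa using h), nat_id h,
        nat_castIso_hom (by simpa using h)]
    · rw [nat_addHom_right _ _ h (by simp; omega),
        nat_addHom_right _ _ (by simpa using h) (by simp; omega), nat_id (by simp; omega),
        nat_castIso_hom (by simp; omega)]
      simp

end FinInt
end Intervals

section Templicial

variable {V : Type w} [Category.{u} V] [MonoidalCategory V] [SymmetricCategory V]
  [MonoidalClosed V] [HasColimits V]

namespace VQuiv

variable {S T R : Type u}

/-- Morphisms from a quiver `Q` on `S` to a quiver `P` on `T` over a map `f : S → T`, i.e. quiver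
morphisms from `Q` to the restriction `f^* P`, or equivalently from `f_! Q` to `P`. -/
structure HomOver (f : S → T) (Q : VQuiv V S) (P : VQuiv V T) : Type u where
  /-- The morphism between objects of edges. -/
  app : ∀ a b, Q a b ⟶ P (f a) (f b)

namespace HomOver

@[ext] lemma ext' {f : S → T} {Q : VQuiv V S} {P : VQuiv V T} {α β : HomOver f Q P}
    (h : ∀ a b, α.app a b = β.app a b) : α = β := by
  obtain ⟨α⟩ := α
  obtain ⟨β⟩ := β
  congr
  exact funext fun a => funext fun b => h a b

/-- The identity as a morphism over the identity map. -/
@[simps] def id (Q : VQuiv V S) : HomOver _root_.id Q Q where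
  app a b := 𝟙 (Q a b)

/-- Composition. -/
@[simps] def comp {f : S → T} {g : T → R} {Q : VQuiv V S} {P : VQuiv V T} {M : VQuiv V R}
    (α : HomOver f Q P) (β : HomOver g P M) : HomOver (g ∘ f) Q M where
  app a b := α.app a b ≫ β.app (f a) (f b)

/-- Precomposition with a quiver morphism. -/
@[simps] def pre {f : S → T} {Q Q' : VQuiv V S} {P : VQuiv V T} (g : Q' ⟶ Q)
    (α : HomOver f Q P) : HomOver f Q' P where
  app a b := g.app a b ≫ α.app a b

/-- Postcomposition with a quiver morphism. -/
@[simps] def post {f : S → T} {Q : VQuiv V S} {P P' : VQuiv V T} (α : HomOver f Q P)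
    (g : P ⟶ P') : HomOver f Q P' where
  app a b := α.app a b ≫ g.app (f a) (f b)

/-- The tensor product of morphisms over `f`: the summand of index `c` goes to that of
index `f c`. -/
def tensor {f : S → T} {Q Q' : VQuiv V S} {P P' : VQuiv V T} (α : HomOver f Q P)
    (β : HomOver f Q' P') : HomOver f (VQuiv.tensor Q Q') (VQuiv.tensor P P') where
  app a b := desc fun c => (α.app a c ⊗ₘ β.app c b) ≫ inc P P' (f a) (f b) (f c)

@[simp] lemma inc_tensor {f : S → T} {Q Q' : VQuiv V S} {P P' : VQuiv V T} (α : HomOver f Q P)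
    (β : HomOver f Q' P') (a b c : S) :
    inc Q Q' a b c ≫ (tensor α β).app a b =
      (α.app a c ⊗ₘ β.app c b) ≫ inc P P' (f a) (f b) (f c) := by
  simp [tensor]

@[simp] lemma inc_tensor_assoc {f : S → T} {Q Q' : VQuiv V S} {P P' : VQuiv V T}
    (α : HomOver f Q P) (β : HomOver f Q' P') (a b c : S) {Z : V}
    (k : (VQuiv.tensor P P').obj (f a) (f b) ⟶ Z) :
    inc Q Q' a b c ≫ (tensor α β).app a b ≫ k =
      (α.app a c ⊗ₘ β.app c b) ≫ inc P P' (f a) (f b) (f c) ≫ k := by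
  rw [← Category.assoc, inc_tensor, Category.assoc]

/-- Maps out of the unit quiver. -/
def unitDesc {a b : S} {Z : V} (φ : ∀ _ : a = b, 𝟙_ V ⟶ Z) : unit.obj a b ⟶ Z :=
  Limits.Sigma.desc fun j => φ j.down.down

@[simp] lemma unitInc_unitDesc {a b : S} {Z : V} (φ : ∀ _ : a = b, 𝟙_ V ⟶ Z) (e : a = b) :
    unitInc e ≫ unitDesc φ = φ e := Limits.Sigma.ι_desc _ _

/-- The canonical morphism over `f` between unit quivers. -/
def unit (f : S → T) : HomOver f (VQuiv.unit : VQuiv V S) (VQuiv.unit : VQuiv V T) where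
  app a b := unitDesc fun e : a = b => unitInc (congrArg f e)

@[simp] lemma unitInc_unit (f : S → T) {a b : S} (e : a = b) :
    unitInc e ≫ (unit (V := V) f).app a b = unitInc (congrArg f e) := by
  simp [unit]

@[simp] lemma unitInc_unit_assoc (f : S → T) {a b : S} (e : a = b) {Z : V}
    (k : VQuiv.unit.obj (f a) (f b) ⟶ Z) :
    unitInc e ≫ (unit (V := V) f).app a b ≫ k = unitInc (congrArg f e) ≫ k := by
  rw [← Category.assoc, unitInc_unit]

lemma pre_tensor {f : S → T} {Q Q' Q₁ Q₁' : VQuiv V S} {P P' : VQuiv V T} (g : Q₁ ⟶ Q)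
    (g' : Q₁' ⟶ Q') (α : HomOver f Q P) (β : HomOver f Q' P') :
    tensor (α.pre g) (β.pre g') = (tensor α β).pre (tmap g g') := by
  ext a b
  exact tensor_ext fun c => by simp

lemma post_tensor {f : S → T} {Q Q' : VQuiv V S} {P P' P₁ P₁' : VQuiv V T} (g : P ⟶ P₁)
    (g' : P' ⟶ P₁') (α : HomOver f Q P) (β : HomOver f Q' P') :
    tensor (α.post g) (β.post g') = (tensor α β).post (tmap g g') := by
  ext a b
  exact tensor_ext fun c => by simp

lemma comp_tensor {f : S → T} {g : T → R} {Q Q' : VQuiv V S} {P P' : VQuiv V T} {M M' : VQuiv V R}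
    (α : HomOver f Q P) (α' : HomOver f Q' P') (β : HomOver g P M) (β' : HomOver g P' M') :
    tensor (α.comp β) (α'.comp β') = (tensor α α').comp (tensor β β') := by
  ext a b
  exact tensor_ext fun c => by simp

lemma assoc_tensor {f : S → T} {Q₁ Q₂ Q₃ : VQuiv V S} {P₁ P₂ P₃ : VQuiv V T}
    (α₁ : HomOver f Q₁ P₁) (α₂ : HomOver f Q₂ P₂) (α₃ : HomOver f Q₃ P₃) :
    (tensor (tensor α₁ α₂) α₃).post (assocHom P₁ P₂ P₃) =
      (tensor α₁ (tensor α₂ α₃)).pre (assocHom Q₁ Q₂ Q₃) := by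
  ext a b
  refine tensor_ext fun d => tensor_extR fun c => ?_
  simp only [post_app, pre_app, inc_tensor_assoc, inc_assocHom_assoc, inc_tensor,
    MonoidalCategory.tensorHom_def, Category.assoc]
  rw [← comp_whiskerRight_assoc, inc_tensor, whisker_exchange_assoc,
    ← MonoidalCategory.whiskerLeft_comp_assoc (Y := (VQuiv.tensor Q₂ Q₃).obj c b), inc_tensor]
  simp only [comp_whiskerRight, MonoidalCategory.whiskerLeft_comp, Category.assoc,
    MonoidalCategory.tensorHom_def, ← whisker_exchange_assoc, inc_assocHom]
  rw [whisker_exchange_assoc (α₁.app a c) (inc P₂ P₃ (f c) (f b) (f d))]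
  monoidal

end HomOver

end VQuiv

open Functor.OplaxMonoidal VQuiv

/-- Templicial objects in `V`: a set of vertices `S` and a strongly unital colax monoidal functor
from the opposite of the category of finite intervals to the category of `V`-enriched quivers with
vertex set `S`. -/
structure TempObj (V : Type w) [Category.{u} V] [MonoidalCategory V] [SymmetricCategory V]
    [MonoidalClosed V] [HasColimits V] : Type max w (u + 1) where
  /-- The set of vertices. -/
  S : Type u
  /-- The underlying functor. -/
  X : FinIntᵒᵖ ⥤ VQuiv V S
  [oplax : X.OplaxMonoidal]
  [unital : IsIso (η X)]

namespace TempObj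

attribute [instance] TempObj.oplax TempObj.unital

/-- Templicial morphisms: a map `f` of vertices and a monoidal natural transformation `f_! X ⟶ Y`.
The latter is given here by morphisms `X_n(a, b) ⟶ Y_n(f a, f b)`, through the universal property
of the coproducts `(f_! X_n)(x, y) = ∐ X_n(a, b)` over the `a`, `b` with `f a = x` and `f b = y`. -/
structure Hom (X Y : TempObj V) : Type u where
  /-- The map of vertices. -/
  base : X.S → Y.S
  /-- The morphisms `X_n(a, b) ⟶ Y_n(f a, f b)`. -/
  app (n : FinIntᵒᵖ) : HomOver base (X.X.obj n) (Y.X.obj n)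
  naturality {m n : FinIntᵒᵖ} (g : m ⟶ n) :
    (app n).pre (X.X.map g) = (app m).post (Y.X.map g)
  comult (m n : FinIntᵒᵖ) :
    (app (m ⊗ n)).post (δ Y.X m n) = ((app m).tensor (app n)).pre (δ X.X m n)
  counit : (app (𝟙_ FinIntᵒᵖ)).post (η Y.X) = (HomOver.unit base).pre (η X.X)

lemma Hom.ext' {X Y : TempObj V} {b : X.S → Y.S} {α β : ∀ n, HomOver b (X.X.obj n) (Y.X.obj n)}
    (h : ∀ n, α n = β n) {p₁ p₂ p₃ q₁ q₂ q₃} :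
    (⟨b, α, p₁, p₂, p₃⟩ : Hom X Y) = ⟨b, β, q₁, q₂, q₃⟩ := by
  obtain rfl : α = β := funext h
  rfl

/-- The identity templicial morphism. -/
def Hom.id (X : TempObj V) : Hom X X where
  base := _root_.id
  app n := HomOver.id (X.X.obj n)
  naturality g := by
    ext a b
    simp
  comult m n := by
    ext a b
    have h : ((HomOver.id (X.X.obj m)).tensor (HomOver.id (X.X.obj n))).app a b = 𝟙 _ :=
      tensor_ext fun c => by simp
    simp only [HomOver.post_app, HomOver.pre_app, HomOver.id_app, h]
    exact (Category.id_comp _).trans (Category.comp_id _).symm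
  counit := by
    ext a b
    have h : (HomOver.unit (V := V) (_root_.id : X.S → X.S)).app a b = 𝟙 _ :=
      unit_ext fun e => by simp
    simp only [HomOver.post_app, HomOver.pre_app, HomOver.id_app, h]
    exact (Category.id_comp _).trans (Category.comp_id _).symm

/-- Composition of templicial morphisms. -/
def Hom.comp {X Y Z : TempObj V} (f : Hom X Y) (g : Hom Y Z) : Hom X Z where
  base := g.base ∘ f.base
  app n := (f.app n).comp (g.app n)
  naturality {m n} h := by
    ext a b
    have h1 := congrArg (fun k => k.app a b) (f.naturality h)
    have h2 := congrArg (fun k => k.app (f.base a) (f.base b)) (g.naturality h)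
    simp only [HomOver.post_app, HomOver.pre_app, HomOver.comp_app, Category.assoc] at h1 h2 ⊢
    rw [reassoc_of% h1, h2]
    rfl
  comult m n := by
    ext a b
    have h1 := congrArg (fun k => k.app a b) (f.comult m n)
    have h2 := congrArg (fun k => k.app (f.base a) (f.base b)) (g.comult m n)
    rw [HomOver.comp_tensor]
    simp only [HomOver.post_app, HomOver.pre_app, HomOver.comp_app, Category.assoc] at h1 h2 ⊢
    refine (congrArg (fun k => (f.app (m ⊗ n)).app a b ≫ k) h2).trans ?_
    rw [reassoc_of% h1]
  counit := by
    ext a b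
    have h1 := congrArg (fun k => k.app a b) f.counit
    have h2 := congrArg (fun k => k.app (f.base a) (f.base b)) g.counit
    have h3 : (HomOver.unit (V := V) (g.base ∘ f.base)).app a b =
        (HomOver.unit (V := V) f.base).app a b ≫ (HomOver.unit g.base).app _ _ :=
      unit_ext fun e => by simp
    simp only [HomOver.post_app, HomOver.pre_app, HomOver.comp_app, Category.assoc] at h1 h2 ⊢
    rw [h3]
    refine (congrArg (fun k => (f.app _).app a b ≫ k) h2).trans ?_
    rw [reassoc_of% h1]

instance : Category.{u} (TempObj V) where
  Hom := Hom
  id := Hom.id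
  comp := Hom.comp
  id_comp f := Hom.ext' fun n => by
    ext a b
    exact Category.id_comp _
  comp_id f := Hom.ext' fun n => by
    ext a b
    exact Category.comp_id _
  assoc f g h := Hom.ext' fun n => by
    ext a b
    exact Category.assoc _ _ _

end TempObj

end Templicial

section Simplices

open Simplicial

/-- The underlying function of a morphism of the simplex category, extended to natural numbers. -/
def natΔ {m n : ℕ} (f : ⦋m⦌ ⟶ ⦋n⦌) (i : ℕ) : ℕ :=
  f.toOrderHom ⟨min i m, by simp⟩

/-- The morphism of the simplex category given by a function on natural numbers. -/
def mkΔ {m n : ℕ} (g : ℕ → ℕ) (hg : ∀ i j, i ≤ j → j ≤ m → g i ≤ g j) (h1 : g m ≤ n) :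
    ⦋m⦌ ⟶ ⦋n⦌ :=
  SimplexCategory.mkHom
    { toFun := fun i => ⟨g i, by have := hg i m (by omega) le_rfl; omega⟩
      monotone' := fun i j h => by
          have := hg i j h (by omega)
          simpa using this }

lemma natΔ_mkΔ {m n : ℕ} {g : ℕ → ℕ} {hg : ∀ i j, i ≤ j → j ≤ m → g i ≤ g j} {h1 : g m ≤ n}
    {i : ℕ} (hi : i ≤ m) : natΔ (mkΔ (n := n) g hg h1) i = g i := by
  show g (min i m) = g i
  rw [min_eq_left hi]

lemma natΔ_le {m n : ℕ} (f : ⦋m⦌ ⟶ ⦋n⦌) (i : ℕ) : natΔ f i ≤ n :=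
  Nat.lt_succ_iff.mp (f.toOrderHom ⟨min i m, by simp⟩).isLt

lemma natΔ_mono {m n : ℕ} (f : ⦋m⦌ ⟶ ⦋n⦌) {i j : ℕ} (h : i ≤ j) : natΔ f i ≤ natΔ f j :=
  f.toOrderHom.monotone (by
    rw [Fin.mk_le_mk]
    exact min_le_min_right _ h)

lemma homΔ_ext {m n : ℕ} {f g : ⦋m⦌ ⟶ ⦋n⦌} (h : ∀ i, i ≤ m → natΔ f i = natΔ g i) : f = g := by
  ext i
  have h1 := h i (Nat.lt_succ_iff.mp i.isLt)
  have e : (⟨min (i : ℕ) m, by simp⟩ : Fin (m + 1)) = i := by ext; simp; omega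
  simpa [natΔ, e] using h1

lemma natΔ_id {m : ℕ} {i : ℕ} (hi : i ≤ m) : natΔ (𝟙 ⦋m⦌) i = i := by
  show min i m = i
  omega

lemma natΔ_comp {m n k : ℕ} (f : ⦋m⦌ ⟶ ⦋n⦌) (g : ⦋n⦌ ⟶ ⦋k⦌) (i : ℕ) :
    natΔ (f ≫ g) i = natΔ g (natΔ f i) := by
  have h := natΔ_le f i
  show ((g.toOrderHom (f.toOrderHom _) : Fin _) : ℕ) = _
  unfold natΔ at h ⊢
  congr 2
  ext
  simp only
  omega

/-- The inclusion of the finite intervals in the simplex category. -/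
def toΔ {m n : FinInt} (f : m ⟶ n) : ⦋m.len⦌ ⟶ ⦋n.len⦌ :=
  SimplexCategory.mkHom f.toOrderHom

lemma natΔ_toΔ {m n : FinInt} (f : m ⟶ n) (i : ℕ) : natΔ (toΔ f) i = FinInt.nat f i := rfl

lemma toΔ_id (m : FinInt) : toΔ (𝟙 m) = 𝟙 _ := rfl

lemma toΔ_comp {m n k : FinInt} (f : m ⟶ n) (g : n ⟶ k) : toΔ (f ≫ g) = toΔ f ≫ toΔ g := rfl

lemma tensor_len (m n : FinInt) : (m ⊗ n).len = m.len + n.len := rfl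

/-- The face of `⦋m + n⦌` on the vertices `0, ..., m`. -/
def frontΔ (m n : FinInt) : ⦋m.len⦌ ⟶ ⦋(m ⊗ n).len⦌ :=
  mkΔ id (fun _ _ h _ => h) (Nat.le_add_right m.len n.len)

/-- The face of `⦋m + n⦌` on the vertices `m, ..., m + n`. -/
def backΔ (m n : FinInt) : ⦋n.len⦌ ⟶ ⦋(m ⊗ n).len⦌ :=
  mkΔ (fun i => m.len + i) (fun _ _ h _ => Nat.add_le_add_left h m.len) le_rfl

/-- The inclusion of the vertex `i`. -/
def vertexΔ (n i : ℕ) : ⦋0⦌ ⟶ ⦋n⦌ := mkΔ (fun _ => min i n) (fun _ _ _ _ => le_rfl) (min_le_right _ _)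

lemma natΔ_frontΔ {m n : FinInt} {i : ℕ} (hi : i ≤ m.len) : natΔ (frontΔ m n) i = i := natΔ_mkΔ hi

lemma natΔ_backΔ {m n : FinInt} {i : ℕ} (hi : i ≤ n.len) : natΔ (backΔ m n) i = m.len + i := natΔ_mkΔ hi

lemma natΔ_vertexΔ (n i : ℕ) : natΔ (vertexΔ n i) 0 = min i n := natΔ_mkΔ le_rfl

lemma vertexΔ_comp {m n : ℕ} (f : ⦋m⦌ ⟶ ⦋n⦌) (i : ℕ) :
    vertexΔ m i ≫ f = vertexΔ n (natΔ f i) := homΔ_ext fun j hj => by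
  obtain rfl : j = 0 := by omega
  have := natΔ_le f i
  rw [natΔ_comp, natΔ_vertexΔ, natΔ_vertexΔ, min_eq_left this]
  simp [natΔ]

/-- The restriction of a simplex along a morphism of the simplex category. -/
def res (K : SSet.{u}) {m n : ℕ} (f : ⦋m⦌ ⟶ ⦋n⦌) (σ : K _⦋n⦌) : K _⦋m⦌ := K.map f.op σ

/-- The vertex `i` of a simplex. -/
def vtx (K : SSet.{u}) {n : ℕ} (σ : K _⦋n⦌) (i : ℕ) : K _⦋0⦌ := res K (vertexΔ n i) σ

lemma res_id (K : SSet.{u}) {n : ℕ} (σ : K _⦋n⦌) : res K (𝟙 _) σ = σ := by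
  simp [res]

lemma res_res (K : SSet.{u}) {m n k : ℕ} (f : ⦋m⦌ ⟶ ⦋n⦌) (g : ⦋n⦌ ⟶ ⦋k⦌) (σ : K _⦋k⦌) :
    res K f (res K g σ) = res K (f ≫ g) σ := by
  simp [res]

lemma vtx_res (K : SSet.{u}) {m n : ℕ} (f : ⦋m⦌ ⟶ ⦋n⦌) (σ : K _⦋n⦌) (i : ℕ) :
    vtx K (res K f σ) i = vtx K σ (natΔ f i) := by
  rw [vtx, res_res, vertexΔ_comp, vtx]

lemma vtx_zero (K : SSet.{u}) (σ : K _⦋0⦌) (i : ℕ) : vtx K σ i = σ := by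
  have : vertexΔ 0 i = 𝟙 _ := homΔ_ext fun j hj => by
    obtain rfl : j = 0 := by omega
    rw [natΔ_vertexΔ, natΔ_id le_rfl]
    simp
  rw [vtx, this, res_id]

lemma res_app {K L : SSet.{u}} (φ : K ⟶ L) {m n : ℕ} (f : ⦋m⦌ ⟶ ⦋n⦌) (σ : K _⦋n⦌) :
    φ.app _ (res K f σ) = res L f (φ.app _ σ) :=
  NatTrans.naturality_apply φ f.op σ

lemma vtx_app {K L : SSet.{u}} (φ : K ⟶ L) {n : ℕ} (σ : K _⦋n⦌) (i : ℕ) :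
    φ.app _ (vtx K σ i) = vtx L (φ.app _ σ) i :=
  res_app φ _ σ

end Simplices

section Free

open Simplicial

variable {V : Type w} [Category.{u} V] [MonoidalCategory V] [SymmetricCategory V]
  [MonoidalClosed V] [HasColimits V]

open VQuiv

namespace VQuiv

variable {S T : Type u}

/-- The element of a tensor product of quivers given by a pair of elements. -/
def pairEl {Q P : VQuiv V S} {a b c : S} (x : 𝟙_ V ⟶ Q a c) (y : 𝟙_ V ⟶ P c b) :
    𝟙_ V ⟶ (tensor Q P).obj a b :=
  (λ_ (𝟙_ V)).inv ≫ (x ⊗ₘ y) ≫ inc Q P a b c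

lemma pairEl_tmap {Q P Q' P' : VQuiv V S} {a b c : S} (x : 𝟙_ V ⟶ Q a c) (y : 𝟙_ V ⟶ P c b)
    (f : Q ⟶ Q') (g : P ⟶ P') :
    pairEl x y ≫ (tmap f g).app a b = pairEl (x ≫ f.app a c) (y ≫ g.app c b) := by
  simp [pairEl]

lemma pairEl_assocHom {Q P R : VQuiv V S} {a b c d : S} (x : 𝟙_ V ⟶ Q a c) (y : 𝟙_ V ⟶ P c d)
    (z : 𝟙_ V ⟶ R d b) :
    pairEl (pairEl x y) z ≫ (assocHom Q P R).app a b = pairEl x (pairEl y z) := by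
  simp only [pairEl, MonoidalCategory.tensorHom_def, comp_whiskerRight,
    MonoidalCategory.whiskerLeft_comp, Category.assoc]
  rw [← whisker_exchange_assoc (inc Q P a d c), inc_assocHom]
  monoidal

lemma leftInv_el {Q : VQuiv V S} {a b : S} (x : 𝟙_ V ⟶ Q a b) :
    x ≫ (leftInv Q).app a b = pairEl (unitInc (rfl : a = a)) x := by
  simp [leftInv, pairEl, MonoidalCategory.tensorHom_def']

lemma rightInv_el {Q : VQuiv V S} {a b : S} (x : 𝟙_ V ⟶ Q a b) :
    x ≫ (rightInv Q).app a b = pairEl x (unitInc (rfl : b = b)) := by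
  simp [rightInv, pairEl, MonoidalCategory.tensorHom_def, unitors_inv_equal]

lemma pairEl_tensor {f : S → T} {Q P : VQuiv V S} {Q' P' : VQuiv V T} {a b c : S}
    (x : 𝟙_ V ⟶ Q a c) (y : 𝟙_ V ⟶ P c b) (α : HomOver f Q Q') (β : HomOver f P P') :
    pairEl x y ≫ (HomOver.tensor α β).app a b = pairEl (x ≫ α.app a c) (y ≫ β.app c b) := by
  simp [pairEl]

end VQuiv

variable (V) in
/-- The quiver of `n`-simplices of a simplicial set: at `(a, b)` it is the coproduct of copies of
the tensor unit indexed by the `n`-simplices with first vertex `a` and last vertex `b`. -/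
def freeQ (K : SSet.{u}) (n : FinInt) : VQuiv V (K _⦋0⦌) :=
  ⟨fun a b => ∐ fun _ : {σ : K _⦋n.len⦌ // vtx K σ 0 = a ∧ vtx K σ n.len = b} => 𝟙_ V⟩

/-- The element given by a simplex. -/
def el {K : SSet.{u}} {n : FinInt} (σ : K _⦋n.len⦌) {a b : K _⦋0⦌} (ha : vtx K σ 0 = a)
    (hb : vtx K σ n.len = b) : 𝟙_ V ⟶ freeQ V K n a b :=
  Sigma.ι (fun _ : {σ : K _⦋n.len⦌ // vtx K σ 0 = a ∧ vtx K σ n.len = b} => 𝟙_ V) ⟨σ, ha, hb⟩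

/-- Maps out of the quiver of simplices. -/
def freeDesc {K : SSet.{u}} {n : FinInt} {a b : K _⦋0⦌} {Z : V}
    (φ : ∀ σ : K _⦋n.len⦌, vtx K σ 0 = a → vtx K σ n.len = b → (𝟙_ V ⟶ Z)) : freeQ V K n a b ⟶ Z :=
  Limits.Sigma.desc fun σ => φ σ.1 σ.2.1 σ.2.2

@[simp] lemma el_freeDesc {K : SSet.{u}} {n : FinInt} {a b : K _⦋0⦌} {Z : V}
    (φ : ∀ σ : K _⦋n.len⦌, vtx K σ 0 = a → vtx K σ n.len = b → (𝟙_ V ⟶ Z)) (σ : K _⦋n.len⦌)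
    (ha : vtx K σ 0 = a) (hb : vtx K σ n.len = b) : el σ ha hb ≫ freeDesc φ = φ σ ha hb :=
  Limits.Sigma.ι_desc _ _

lemma free_ext {K : SSet.{u}} {n : FinInt} {a b : K _⦋0⦌} {Z : V} {f g : freeQ V K n a b ⟶ Z}
    (h : ∀ (σ : K _⦋n.len⦌) (ha : vtx K σ 0 = a) (hb : vtx K σ n.len = b),
      el σ ha hb ≫ f = el σ ha hb ≫ g) : f = g :=
  Sigma.hom_ext _ _ fun σ => h σ.1 σ.2.1 σ.2.2

lemma el_congr {K : SSet.{u}} {n : FinInt} {σ τ : K _⦋n.len⦌} (h : σ = τ) {a b : K _⦋0⦌}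
    (ha : vtx K σ 0 = a) (hb : vtx K σ n.len = b) :
    el (V := V) σ ha hb = el τ (h ▸ ha) (h ▸ hb) := by
  subst h
  rfl

lemma pairEl_congr {K : SSet.{u}} {m n : FinInt} {σ σ' : K _⦋m.len⦌} {τ τ' : K _⦋n.len⦌} {a b c c' : K _⦋0⦌}
    (h1 : σ = σ') (h2 : τ = τ') {ha : vtx K σ 0 = a} {hc : vtx K σ m.len = c}
    {hc' : vtx K τ 0 = c} {hb : vtx K τ n.len = b} {ha' : vtx K σ' 0 = a} {hd : vtx K σ' m.len = c'}
    {hd' : vtx K τ' 0 = c'} {hb' : vtx K τ' n.len = b} :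
    pairEl (el (V := V) σ ha hc) (el τ hc' hb) = pairEl (el σ' ha' hd) (el τ' hd' hb') := by
  subst h1 h2 hc hd
  rfl

lemma pairEl_congr₃ {K : SSet.{u}} {m n k : FinInt} {σ σ' : K _⦋m.len⦌} {τ τ' : K _⦋n.len⦌}
    {υ υ' : K _⦋k.len⦌} {a b c c' d d' : K _⦋0⦌} (h1 : σ = σ') (h2 : τ = τ') (h3 : υ = υ')
    {ha : vtx K σ 0 = a} {hc : vtx K σ m.len = c} {hc' : vtx K τ 0 = c} {hd : vtx K τ n.len = d}
    {hd' : vtx K υ 0 = d} {hb : vtx K υ k.len = b} {ha₁ : vtx K σ' 0 = a}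
    {hc₁ : vtx K σ' m.len = c'} {hc₁' : vtx K τ' 0 = c'} {hd₁ : vtx K τ' n.len = d'}
    {hd₁' : vtx K υ' 0 = d'} {hb₁ : vtx K υ' k.len = b} :
    pairEl (el (V := V) σ ha hc) (pairEl (el τ hc' hd) (el υ hd' hb)) =
      pairEl (el σ' ha₁ hc₁) (pairEl (el τ' hc₁' hd₁) (el υ' hd₁' hb₁)) := by
  subst h1 h2 h3 hc hd hc₁ hd₁
  rfl

lemma pairEl_unit_left {K : SSet.{u}} {n : FinInt} {τ τ' : K _⦋n.len⦌} {a b c : K _⦋0⦌}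
    (h : τ = τ') (hc : c = a) {e : a = a} {e' : a = c} {ha : vtx K τ 0 = a}
    {hb : vtx K τ n.len = b} {ha' : vtx K τ' 0 = c} {hb' : vtx K τ' n.len = b} :
    pairEl (unitInc (V := V) e) (el τ ha hb) = pairEl (unitInc e') (el τ' ha' hb') := by
  subst h hc
  rfl

lemma pairEl_unit_right {K : SSet.{u}} {n : FinInt} {τ τ' : K _⦋n.len⦌} {a b c : K _⦋0⦌}
    (h : τ = τ') (hc : c = b) {e : b = b} {e' : c = b} {ha : vtx K τ 0 = a}
    {hb : vtx K τ n.len = b} {ha' : vtx K τ' 0 = a} {hb' : vtx K τ' n.len = c} :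
    pairEl (el τ ha hb) (unitInc (V := V) e) = pairEl (el τ' ha' hb') (unitInc e') := by
  subst h hc
  rfl

/-- The action of a simplicial map on simplices. -/
def freeOver {K L : SSet.{u}} (φ : K ⟶ L) (n : FinInt) :
    HomOver (fun a : K _⦋0⦌ => φ.app _ a) (freeQ V K n) (freeQ V L n) where
  app _ _ := freeDesc fun σ ha hb => el (φ.app _ σ) (by rw [← vtx_app, ha]) (by rw [← vtx_app, hb])

lemma el_freeOver {K L : SSet.{u}} (φ : K ⟶ L) (n : FinInt) {a b : K _⦋0⦌} (σ : K _⦋n.len⦌)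
    (ha : vtx K σ 0 = a) (hb : vtx K σ n.len = b) :
    el (V := V) σ ha hb ≫ (freeOver φ n).app a b =
      el (φ.app _ σ) (by rw [← vtx_app, ha]) (by rw [← vtx_app, hb]) := by
  simp only [freeOver, el_freeDesc]

/-- The restriction of simplices along a morphism of finite intervals. -/
def freeMap (K : SSet.{u}) {m n : FinInt} (f : m ⟶ n) : freeQ V K n ⟶ freeQ V K m :=
  ⟨fun _ _ => freeDesc fun σ ha hb => el (res K (toΔ f) σ)
    (by rw [vtx_res, natΔ_toΔ, FinInt.nat_zero, ha])
    (by rw [vtx_res, natΔ_toΔ, FinInt.nat_last f rfl, hb])⟩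

/-- The comultiplication: a simplex goes to the pair of its front face and its back face. -/
def freeComul (K : SSet.{u}) (m n : FinInt) : freeQ V K (m ⊗ n) ⟶ tensor (freeQ V K m) (freeQ V K n) :=
  ⟨fun _ _ => freeDesc fun σ ha hb =>
    pairEl (c := vtx K σ m.len)
      (el (res K (frontΔ m n) σ) (by rw [vtx_res, natΔ_frontΔ (Nat.zero_le _), ha])
        (by rw [vtx_res, natΔ_frontΔ le_rfl]))
      (el (res K (backΔ m n) σ) (by rw [vtx_res, natΔ_backΔ (Nat.zero_le _), Nat.add_zero])
        (by rw [vtx_res, natΔ_backΔ le_rfl, ← tensor_len, hb]))⟩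

/-- The counit. -/
def freeCounit (K : SSet.{u}) : freeQ V K (𝟙_ FinInt) ⟶ (VQuiv.unit : VQuiv V (K _⦋0⦌)) :=
  ⟨fun _ _ => freeDesc fun _ ha hb => unitInc (ha.symm.trans hb)⟩

/-- A vertex as an element of `K _⦋(𝟙_ FinInt).len⦌`. -/
def vert {K : SSet.{u}} (a : K _⦋0⦌) : K _⦋(𝟙_ FinInt).len⦌ := a

lemma vtx_vert {K : SSet.{u}} (a : K _⦋0⦌) (i : ℕ) : vtx K (vert a) i = a := vtx_zero K a i

/-- The inverse of the counit. -/
def freeUnit (K : SSet.{u}) : (VQuiv.unit : VQuiv V (K _⦋0⦌)) ⟶ freeQ V K (𝟙_ FinInt) :=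
  ⟨fun a _ => HomOver.unitDesc fun e => el (vert a) (vtx_vert a _) ((vtx_vert a _).trans e)⟩

lemma el_freeMap {K : SSet.{u}} {m n : FinInt} (f : m ⟶ n) {a b : K _⦋0⦌} (σ : K _⦋n.len⦌)
    (ha : vtx K σ 0 = a) (hb : vtx K σ n.len = b) :
    el (V := V) σ ha hb ≫ (freeMap K f).app a b = el (res K (toΔ f) σ)
      (by rw [vtx_res, natΔ_toΔ, FinInt.nat_zero, ha])
      (by rw [vtx_res, natΔ_toΔ, FinInt.nat_last f rfl, hb]) :=
  by simp only [freeMap, el_freeDesc]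

lemma el_freeComul {K : SSet.{u}} {m n : FinInt} {a b : K _⦋0⦌} (σ : K _⦋(m ⊗ n).len⦌)
    (ha : vtx K σ 0 = a) (hb : vtx K σ (m ⊗ n).len = b) :
    el (V := V) σ ha hb ≫ (freeComul K m n).app a b =
      pairEl (c := vtx K σ m.len)
        (el (res K (frontΔ m n) σ) (by rw [vtx_res, natΔ_frontΔ (Nat.zero_le _), ha])
          (by rw [vtx_res, natΔ_frontΔ le_rfl]))
        (el (res K (backΔ m n) σ) (by rw [vtx_res, natΔ_backΔ (Nat.zero_le _), Nat.add_zero])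
          (by rw [vtx_res, natΔ_backΔ le_rfl, ← tensor_len, hb])) :=
  by simp only [freeComul, el_freeDesc]

lemma el_freeCounit {K : SSet.{u}} {a b : K _⦋0⦌} (σ : K _⦋(𝟙_ FinInt).len⦌)
    (ha : vtx K σ 0 = a) (hb : vtx K σ (𝟙_ FinInt).len = b) :
    el (V := V) σ ha hb ≫ (freeCounit K).app a b = unitInc (ha.symm.trans hb) :=
  by simp only [freeCounit, el_freeDesc]

lemma el_freeMap_assoc {K : SSet.{u}} {m n : FinInt} (f : m ⟶ n) {a b : K _⦋0⦌} (σ : K _⦋n.len⦌)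
    (ha : vtx K σ 0 = a) (hb : vtx K σ n.len = b) {Z : V} (k : freeQ V K m a b ⟶ Z) :
    el (V := V) σ ha hb ≫ (freeMap K f).app a b ≫ k = el (res K (toΔ f) σ)
      (by rw [vtx_res, natΔ_toΔ, FinInt.nat_zero, ha])
      (by rw [vtx_res, natΔ_toΔ, FinInt.nat_last f rfl, hb]) ≫ k := by
  rw [← Category.assoc, el_freeMap]

lemma el_freeComul_assoc {K : SSet.{u}} {m n : FinInt} {a b : K _⦋0⦌} (σ : K _⦋(m ⊗ n).len⦌)
    (ha : vtx K σ 0 = a) (hb : vtx K σ (m ⊗ n).len = b) {Z : V}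
    (k : (tensor (freeQ V K m) (freeQ V K n)).obj a b ⟶ Z) :
    el (V := V) σ ha hb ≫ (freeComul K m n).app a b ≫ k =
      pairEl (c := vtx K σ m.len)
        (el (res K (frontΔ m n) σ) (by rw [vtx_res, natΔ_frontΔ (Nat.zero_le _), ha])
          (by rw [vtx_res, natΔ_frontΔ le_rfl]))
        (el (res K (backΔ m n) σ) (by rw [vtx_res, natΔ_backΔ (Nat.zero_le _), Nat.add_zero])
          (by rw [vtx_res, natΔ_backΔ le_rfl, ← tensor_len, hb])) ≫ k := by
  rw [← Category.assoc, el_freeComul]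

lemma free_map_id (K : SSet.{u}) (n : FinInt) : freeMap (V := V) K (𝟙 n) = 𝟙 _ := by
  ext a b
  refine free_ext fun σ ha hb => ?_
  rw [el_freeMap, id_app, Category.comp_id]
  exact el_congr (by rw [toΔ_id, res_id]) _ _

lemma free_map_comp (K : SSet.{u}) {m n k : FinInt} (f : m ⟶ n) (g : n ⟶ k) :
    freeMap (V := V) K (f ≫ g) = freeMap K g ≫ freeMap K f := by
  ext a b
  refine free_ext fun σ ha hb => ?_
  rw [el_freeMap, comp_app, ← Category.assoc, el_freeMap, el_freeMap]
  exact el_congr (by rw [toΔ_comp, res_res]) _ _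

lemma free_comul_natural (K : SSet.{u}) {m m' n n' : FinInt} (f : m' ⟶ m) (g : n' ⟶ n) :
    freeComul (V := V) K m n ≫ tmap (freeMap K f) (freeMap K g) =
      freeMap K (f ⊗ₘ g) ≫ freeComul K m' n' := by
  ext a b
  refine free_ext fun σ ha hb => ?_
  rw [comp_app, comp_app, el_freeComul_assoc, el_freeMap_assoc, el_freeComul, pairEl_tmap,
    el_freeMap, el_freeMap]
  refine pairEl_congr ?_ ?_
  · rw [res_res, res_res]
    refine congrArg (fun k => res K k σ) (homΔ_ext fun i hi => ?_)
    rw [natΔ_comp, natΔ_comp, natΔ_toΔ, natΔ_frontΔ (FinInt.nat_le f i), natΔ_frontΔ hi, natΔ_toΔ]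
    exact (FinInt.nat_addHom_left f g hi).symm
  · rw [res_res, res_res]
    refine congrArg (fun k => res K k σ) (homΔ_ext fun i hi => ?_)
    rw [natΔ_comp, natΔ_comp, natΔ_toΔ, natΔ_backΔ (FinInt.nat_le g i), natΔ_backΔ hi, natΔ_toΔ]
    refine Eq.trans ?_ (FinInt.nat_addHom_right f g (by omega) (by omega)).symm
    rw [Nat.add_sub_cancel_left]

lemma free_comul_assoc (K : SSet.{u}) (m n k : FinInt) :
    freeComul (V := V) K (m ⊗ n) k ≫ tmap (freeComul K m n) (𝟙 _) ≫ assocHom _ _ _ =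
      freeMap K (α_ m n k).inv ≫ freeComul K m (n ⊗ k) ≫ tmap (𝟙 _) (freeComul K n k) := by
  ext a b
  refine free_ext fun σ ha hb => ?_
  have h0 : ∀ i, i ≤ m.len + (n.len + k.len) → FinInt.nat (α_ m n k).inv i = i :=
    fun i hi => FinInt.nat_castIso_inv (h := FinInt.assoc_len m n k) hi
  rw [comp_app, comp_app, comp_app, comp_app, el_freeComul_assoc, el_freeMap_assoc,
    el_freeComul_assoc, pairEl_tmap, ← Category.assoc (pairEl _ _), pairEl_tmap, el_freeComul,
    el_freeComul, id_app, id_app, Category.comp_id, Category.comp_id, pairEl_assocHom]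
  refine pairEl_congr₃ ?_ ?_ ?_
  · rw [res_res, res_res]
    refine congrArg (fun k => res K k σ) (homΔ_ext fun i hi => ?_)
    rw [natΔ_comp, natΔ_comp, natΔ_frontΔ hi, natΔ_frontΔ (by rw [tensor_len]; omega),
      natΔ_frontΔ hi, natΔ_toΔ, h0 i (by omega)]
  · rw [res_res, res_res, res_res]
    refine congrArg (fun k => res K k σ) (homΔ_ext fun i hi => ?_)
    rw [natΔ_comp, natΔ_comp, natΔ_comp, natΔ_frontΔ hi,
      natΔ_backΔ hi, natΔ_frontΔ (by rw [tensor_len]; omega),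
      natΔ_backΔ (by rw [tensor_len]; omega), natΔ_toΔ, h0 _ (by omega)]
  · rw [res_res, res_res]
    refine congrArg (fun k => res K k σ) (homΔ_ext fun i hi => ?_)
    rw [natΔ_comp, natΔ_comp, natΔ_backΔ hi, natΔ_backΔ hi,
      natΔ_backΔ (by rw [tensor_len]; omega), natΔ_toΔ, h0 _ (by omega), tensor_len, Nat.add_assoc]

lemma free_comul_left (K : SSet.{u}) (m : FinInt) :
    leftInv (freeQ V K m) =
      freeMap K (λ_ m).hom ≫ freeComul K (𝟙_ FinInt) m ≫ tmap (freeCounit K) (𝟙 _) := by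
  ext a b
  refine free_ext fun σ ha hb => ?_
  have h0 : ∀ i, i ≤ m.len → FinInt.nat (λ_ m).hom i = i :=
    fun i hi => FinInt.nat_castIso_hom (h := FinInt.zero_add_len m) (by simpa using hi)
  have h1 : (𝟙_ FinInt).len = 0 := rfl
  rw [comp_app, comp_app, leftInv_el, el_freeMap_assoc, el_freeComul_assoc, pairEl_tmap,
    el_freeCounit, id_app, Category.comp_id]
  refine pairEl_unit_left ?_ ?_
  · rw [res_res]
    refine Eq.trans (res_id K σ).symm (congrArg (fun k => res K k σ) (homΔ_ext fun i hi => ?_))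
    rw [natΔ_comp, natΔ_backΔ hi, natΔ_toΔ, natΔ_id hi, h1, Nat.zero_add, h0 i hi]
  · rw [vtx_res, h1, natΔ_toΔ, h0 0 (Nat.zero_le _), ha]

lemma free_comul_right (K : SSet.{u}) (m : FinInt) :
    rightInv (freeQ V K m) =
      freeMap K (ρ_ m).hom ≫ freeComul K m (𝟙_ FinInt) ≫ tmap (𝟙 _) (freeCounit K) := by
  ext a b
  refine free_ext fun σ ha hb => ?_
  have h0 : ∀ i, i ≤ m.len → FinInt.nat (ρ_ m).hom i = i :=
    fun i hi => FinInt.nat_castIso_hom (h := FinInt.add_zero_len m) (by simpa using hi)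
  rw [comp_app, comp_app, rightInv_el, el_freeMap_assoc, el_freeComul_assoc, pairEl_tmap,
    el_freeCounit, id_app, Category.comp_id]
  refine pairEl_unit_right ?_ ?_
  · rw [res_res]
    refine Eq.trans (res_id K σ).symm (congrArg (fun k => res K k σ) (homΔ_ext fun i hi => ?_))
    rw [natΔ_comp, natΔ_frontΔ hi, natΔ_toΔ, natΔ_id hi, h0 i hi]
  · rw [vtx_res, natΔ_toΔ, h0 _ le_rfl, hb]

lemma unitInc_freeUnit (K : SSet.{u}) {a b : K _⦋0⦌} (e : a = b) :
    unitInc e ≫ (freeUnit (V := V) K).app a b =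
      el (vert a) (vtx_vert a _) ((vtx_vert a _).trans e) := by
  simp only [freeUnit, HomOver.unitInc_unitDesc]

lemma freeCounit_freeUnit (K : SSet.{u}) : freeCounit (V := V) K ≫ freeUnit K = 𝟙 _ := by
  ext a b
  refine free_ext fun σ ha hb => ?_
  rw [comp_app, ← Category.assoc, el_freeCounit, id_app, Category.comp_id, unitInc_freeUnit]
  exact el_congr (n := 𝟙_ FinInt) (ha.symm.trans (vtx_zero K σ 0)) _ _

lemma freeUnit_freeCounit (K : SSet.{u}) : freeUnit (V := V) K ≫ freeCounit K = 𝟙 _ := by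
  ext a b
  refine unit_ext fun e => ?_
  rw [comp_app, ← Category.assoc, id_app, Category.comp_id, unitInc_freeUnit, el_freeCounit]

lemma freeOver_natural {K L : SSet.{u}} (φ : K ⟶ L) {m n : FinInt} (f : m ⟶ n) :
    (freeOver (V := V) φ m).pre (freeMap K f) = (freeOver φ n).post (freeMap L f) := by
  ext a b
  refine free_ext fun σ ha hb => ?_
  rw [HomOver.pre_app, HomOver.post_app, el_freeMap_assoc, el_freeOver, ← Category.assoc,
    el_freeOver, el_freeMap]
  exact el_congr (res_app φ _ σ) _ _

lemma freeOver_comul {K L : SSet.{u}} (φ : K ⟶ L) (m n : FinInt) :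
    (freeOver (V := V) φ (m ⊗ n)).post (freeComul L m n) =
      ((freeOver φ m).tensor (freeOver φ n)).pre (freeComul K m n) := by
  ext a b
  refine free_ext fun σ ha hb => ?_
  rw [HomOver.pre_app, HomOver.post_app, el_freeComul_assoc, pairEl_tensor, ← Category.assoc,
    el_freeOver, el_freeOver, el_freeOver, el_freeComul]
  exact pairEl_congr (res_app φ _ σ).symm (res_app φ _ σ).symm

lemma freeOver_counit {K L : SSet.{u}} (φ : K ⟶ L) :
    (freeOver (V := V) φ (𝟙_ FinInt)).post (freeCounit L) =
      (HomOver.unit fun a : K _⦋0⦌ => φ.app _ a).pre (freeCounit K) := by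
  ext a b
  refine free_ext fun σ ha hb => ?_
  rw [HomOver.pre_app, HomOver.post_app, ← Category.assoc, el_freeOver, ← Category.assoc,
    el_freeCounit, el_freeCounit, HomOver.unitInc_unit]

lemma freeOver_id (K : SSet.{u}) (n : FinInt) {a b : K _⦋0⦌} :
    (freeOver (V := V) (𝟙 K) n).app a b = 𝟙 (freeQ V K n a b) := by
  refine free_ext fun σ ha hb => ?_
  rw [el_freeOver]
  exact (Category.comp_id _).symm

lemma freeOver_comp {K L M : SSet.{u}} (φ : K ⟶ L) (ψ : L ⟶ M) (n : FinInt) {a b : K _⦋0⦌} :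
    (freeOver (V := V) (φ ≫ ψ) n).app a b =
      (freeOver φ n).app a b ≫ (freeOver ψ n).app (φ.app _ a) (φ.app _ b) := by
  refine free_ext fun σ ha hb => ?_
  rw [el_freeOver]
  exact ((Category.assoc _ _ _).symm.trans ((congrArg (fun k => k ≫ _)
    (el_freeOver φ n σ ha hb)).trans (el_freeOver ψ n (φ.app _ σ) _ _))).symm

/-- The free templicial object on a simplicial set. -/
def free (K : SSet.{u}) : TempObj V where
  S := K _⦋0⦌
  X :=
    { obj := fun n => freeQ V K n.unop
      map := fun f => freeMap K f.unop
      map_id := fun n => free_map_id K n.unop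
      map_comp := fun f g => free_map_comp K g.unop f.unop }
  oplax :=
    { η := freeCounit K
      δ := fun m n => freeComul K m.unop n.unop
      δ_natural_left := fun {m m'} f n => by
        have := free_comul_natural (V := V) K f.unop (𝟙 n.unop)
        rw [free_map_id, MonoidalCategory.tensorHom_id] at this
        exact this
      δ_natural_right := fun {m m'} n f => by
        have := free_comul_natural (V := V) K (𝟙 n.unop) f.unop
        rw [free_map_id, MonoidalCategory.id_tensorHom] at this
        exact this
      oplax_associativity := fun m n k => free_comul_assoc K m.unop n.unop k.unop
      oplax_left_unitality := fun m => free_comul_left K m.unop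
      oplax_right_unitality := fun m => free_comul_right K m.unop }
  unital := ⟨freeUnit K, freeCounit_freeUnit K, freeUnit_freeCounit K⟩

variable (V) in
/-- The free templicial object functor, left adjoint to the underlying simplicial set functor. -/
def freeFunctor : SSet.{u} ⥤ TempObj V where
  obj := free
  map {K L} φ :=
    show TempObj.Hom (free K) (free L) from
    { base := fun a => φ.app _ a
      app := fun n => freeOver φ n.unop
      naturality := fun f => freeOver_natural φ f.unop
      comult := fun m n => freeOver_comul φ m.unop n.unop
      counit := freeOver_counit φ }
  map_id K := TempObj.Hom.ext' fun n => by
    ext a b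
    exact freeOver_id K n.unop
  map_comp φ ψ := TempObj.Hom.ext' fun n => by
    ext a b
    exact freeOver_comp φ ψ n.unop

/-- The underlying simplicial set of a templicial object: its `n`-simplices are the templicial
morphisms to it from the free templicial object on the standard `n`-simplex. -/
def TempObj.underlying (X : TempObj V) : SSet.{u} :=
  (SSet.stdSimplex ⋙ freeFunctor V).op ⋙ yoneda.obj X

end Free

section Necklaces

open Functor.OplaxMonoidal

/-- The interval `[j - i]`, thought of as the set of the integers from `i` to `j`. -/
def sg (i j : ℕ) : FinInt := ⟨j - i⟩

lemma sg_len (i j : ℕ) : (sg i j).len = j - i := rfl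

lemma cut_len {i k j : ℕ} (h : i ≤ k) (h' : k ≤ j) : (sg i k ⊗ sg k j).len = (sg i j).len := by
  rw [tensor_len, sg_len, sg_len, sg_len]
  omega

/-- The morphism from `{i, ..., j}` to `{f i, ..., f j}` given by a monotone function `f`. -/
def segHom {f : ℕ → ℕ} (hf : Monotone f) {i j i' j' : ℕ} (hi : i' = f i) (hj : j' = f j) :
    sg i j ⟶ sg i' j' :=
  FinInt.ofNat (fun x => f (i + x) - f i) (fun x y h _ => Nat.sub_le_sub_right (hf (by omega)) _)
    (by simp) (by
      rw [sg_len, sg_len, hi, hj]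
      rcases le_total i j with h | h
      · rw [Nat.add_sub_cancel' h]
      · have := hf h
        rw [show j - i = 0 by omega, Nat.add_zero]
        omega)

lemma nat_segHom {f : ℕ → ℕ} (hf : Monotone f) {i j i' j' : ℕ} (hi : i' = f i) (hj : j' = f j)
    {x : ℕ} (hx : x ≤ j - i) : FinInt.nat (segHom hf hi hj) x = f (i + x) - f i :=
  FinInt.nat_ofNat (by rwa [sg_len])

lemma nat_tensorHom_left {m m' n n' : FinInt} (f : m ⟶ m') (g : n ⟶ n') {i : ℕ} (hi : i ≤ m.len) :
    FinInt.nat (f ⊗ₘ g) i = FinInt.nat f i :=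
  FinInt.nat_addHom_left f g hi

lemma nat_tensorHom_right {m m' n n' : FinInt} (f : m ⟶ m') (g : n ⟶ n') {i : ℕ}
    (hi : m.len ≤ i) (hi' : i ≤ m.len + n.len) :
    FinInt.nat (f ⊗ₘ g) i = m'.len + FinInt.nat g (i - m.len) :=
  FinInt.nat_addHom_right f g hi hi'

lemma nat_associator_inv {m n k : FinInt} {i : ℕ} (hi : i ≤ m.len + (n.len + k.len)) :
    FinInt.nat (α_ m n k).inv i = i :=
  FinInt.nat_castIso_inv (h := FinInt.assoc_len m n k) hi

variable {D : Type w} [Category.{u} D] [MonoidalCategory D] (C : FinIntᵒᵖ ⥤ D) [C.OplaxMonoidal]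

/-- The value of `C` at `{i, ..., j}`. -/
abbrev Xs (i j : ℕ) : D := C.obj (op (sg i j))

/-- The identification of `{i, ..., j}` with the sum of `{i, ..., k}` and `{k, ..., j}`. -/
def cutOp {i k j : ℕ} (h : i ≤ k) (h' : k ≤ j) : op (sg i j) ⟶ op (sg i k) ⊗ op (sg k j) :=
  (FinInt.castIso (cut_len h h')).hom.op

lemma cutOp_natural {f : ℕ → ℕ} (hf : Monotone f) {i k j i' k' j' : ℕ} (hi : i' = f i)
    (hk : k' = f k) (hj : j' = f j) (h₁ : i ≤ k) (h₂ : k ≤ j) (h₁' : i' ≤ k') (h₂' : k' ≤ j') :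
    (segHom hf hi hj).op ≫ cutOp h₁ h₂ =
      cutOp h₁' h₂' ≫ ((segHom hf hi hk).op ⊗ₘ (segHom hf hk hj).op) := by
  refine Quiver.Hom.unop_inj ?_
  show (FinInt.castIso (cut_len h₁ h₂)).hom ≫ segHom hf hi hj =
    (segHom hf hi hk ⊗ₘ segHom hf hk hj) ≫ (FinInt.castIso (cut_len h₁' h₂')).hom
  refine FinInt.hom_ext fun x hx => ?_
  have hx' : x ≤ (sg i k).len + (sg k j).len := hx
  rw [FinInt.nat_comp, FinInt.nat_comp, FinInt.nat_castIso_hom hx,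
    FinInt.nat_castIso_hom (FinInt.nat_le _ x), nat_segHom hf hi hj (by rw [sg_len, sg_len] at hx'; omega)]
  rcases le_total x (sg i k).len with h | h
  · rw [nat_tensorHom_left _ _ h, nat_segHom hf hi hk h]
  · rw [nat_tensorHom_right _ _ h hx', nat_segHom hf hk hj (by rw [sg_len] at *; rw [sg_len] at hx'; omega), sg_len,
      sg_len, hk, hi, show k + (x - (k - i)) = i + x by rw [sg_len] at h; omega]
    have h1 := hf h₁
    have h2 := hf (show k ≤ i + x by rw [sg_len] at h; omega)
    omega

lemma cutOp_coassoc {i k k' j : ℕ} (h : i ≤ k) (h' : k ≤ k') (h'' : k' ≤ j) :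
    cutOp h (h'.trans h'') ≫ op (sg i k) ◁ cutOp h' h'' =
      cutOp (h.trans h') h'' ≫ cutOp h h' ▷ op (sg k' j) ≫ (α_ _ _ _).hom := by
  refine Quiver.Hom.unop_inj ?_
  show (𝟙 (sg i k) ⊗ₘ (FinInt.castIso (cut_len h' h'')).hom) ≫
      (FinInt.castIso (cut_len h (h'.trans h''))).hom =
    ((α_ _ _ _).inv ≫ ((FinInt.castIso (cut_len h h')).hom ⊗ₘ 𝟙 (sg k' j))) ≫
        (FinInt.castIso (cut_len (h.trans h') h'')).hom
  refine FinInt.hom_ext fun x hx => ?_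
  have hx' : x ≤ (sg i k).len + ((sg k k').len + (sg k' j).len) := hx
  rw [FinInt.nat_comp, FinInt.nat_comp, FinInt.nat_comp, FinInt.nat_castIso_hom (FinInt.nat_le _ _),
    FinInt.nat_castIso_hom (FinInt.nat_le _ _), nat_associator_inv hx']
  rcases le_total x (sg i k).len with h1 | h1
  · have h2 : x ≤ (sg i k ⊗ sg k k').len := by rw [tensor_len]; omega
    rw [nat_tensorHom_left _ _ h1, nat_tensorHom_left _ _ h2, FinInt.nat_id h1,
      FinInt.nat_castIso_hom h2]
  · have h3 : x - (sg i k).len ≤ (sg k k' ⊗ sg k' j).len := by rw [tensor_len]; omega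
    rw [nat_tensorHom_right _ _ h1 (by rw [tensor_len]; omega), FinInt.nat_castIso_hom h3]
    rcases le_total x (sg i k ⊗ sg k k').len with h2 | h2
    · rw [nat_tensorHom_left _ _ h2, FinInt.nat_castIso_hom h2]
      omega
    · have h4 : x ≤ (sg i k ⊗ sg k k').len + (sg k' j).len := by rw [tensor_len]; omega
      rw [nat_tensorHom_right _ _ h2 h4, FinInt.nat_id (by omega), tensor_len, sg_len, sg_len,
        sg_len] at *
      omega

/-- The comultiplication `X_{j - i} ⟶ X_{k - i} ⊗ X_{j - k}`. -/
def mu {i k j : ℕ} (h : i ≤ k) (h' : k ≤ j) : Xs C i j ⟶ Xs C i k ⊗ Xs C k j :=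
  C.map (cutOp h h') ≫ δ C (op (sg i k)) (op (sg k j))

/-- The action of `C` on the morphism given by a monotone function. -/
def Xmap {f : ℕ → ℕ} (hf : Monotone f) {i j i' j' : ℕ} (hi : i' = f i) (hj : j' = f j) :
    Xs C i' j' ⟶ Xs C i j :=
  C.map (segHom hf hi hj).op

lemma mu_natural {f : ℕ → ℕ} (hf : Monotone f) {i k j i' k' j' : ℕ} (hi : i' = f i) (hk : k' = f k)
    (hj : j' = f j) (h₁ : i ≤ k) (h₂ : k ≤ j) (h₁' : i' ≤ k') (h₂' : k' ≤ j') :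
    Xmap C hf hi hj ≫ mu C h₁ h₂ =
      mu C h₁' h₂' ≫ (Xmap C hf hi hk ⊗ₘ Xmap C hf hk hj) := by
  simp only [Xmap, mu, Category.assoc]
  rw [δ_natural, ← Functor.map_comp_assoc, ← Functor.map_comp_assoc,
    cutOp_natural hf hi hk hj h₁ h₂ h₁' h₂']

lemma mu_coassoc {i k k' j : ℕ} (h : i ≤ k) (h' : k ≤ k') (h'' : k' ≤ j) :
    mu C h (h'.trans h'') ≫ Xs C i k ◁ mu C h' h'' =
      mu C (h.trans h') h'' ≫ mu C h h' ▷ Xs C k' j ≫ (α_ _ _ _).hom := by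
  simp only [mu, MonoidalCategory.whiskerLeft_comp, comp_whiskerRight, Category.assoc]
  rw [δ_natural_right_assoc, δ_natural_left_assoc, oplax_associativity,
    ← Functor.map_comp_assoc, ← Functor.map_comp_assoc, ← Functor.map_comp_assoc,
    cutOp_coassoc h h' h'', Category.assoc]

lemma eps_len (k : ℕ) : (𝟙_ FinInt).len = (sg k k).len := (Nat.sub_self k).symm

/-- The counit `X_{k - k} ⟶ 𝟙_`. -/
def eps (k : ℕ) : Xs C k k ⟶ 𝟙_ D :=
  C.map (FinInt.castIso (eps_len k)).hom.op ≫ η C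

lemma mu_eps_left {k j : ℕ} (h : k ≤ j) :
    mu C le_rfl h ≫ eps C k ▷ Xs C k j = (λ_ _).inv := by
  have key : cutOp le_rfl h ≫ (FinInt.castIso (eps_len k)).hom.op ▷ op (sg k j) =
      (λ_ (op (sg k j))).inv := by
    refine Quiver.Hom.unop_inj ?_
    show ((FinInt.castIso (eps_len k)).hom ⊗ₘ 𝟙 (sg k j)) ≫
      (FinInt.castIso (cut_len le_rfl h)).hom = (FinInt.castIso (FinInt.zero_add_len _)).hom
    refine FinInt.hom_ext fun x hx => ?_
    have hx' : x ≤ (𝟙_ FinInt).len + (sg k j).len := hx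
    have h0 : (𝟙_ FinInt).len = 0 := rfl
    rw [FinInt.nat_comp, FinInt.nat_castIso_hom (FinInt.nat_le _ _),
      nat_tensorHom_right _ _ (show (𝟙_ FinInt).len ≤ x from Nat.zero_le _) hx',
      FinInt.nat_id (by omega), h0]
    refine Eq.trans ?_ (FinInt.nat_castIso_hom (h := FinInt.zero_add_len _) hx).symm
    rw [sg_len]
    omega
  rw [oplax_left_unitality, ← key]
  simp only [mu, eps, comp_whiskerRight, Category.assoc, Functor.map_comp]
  rw [δ_natural_left_assoc]
  rfl

lemma mu_eps_right {i k : ℕ} (h : i ≤ k) :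
    mu C h le_rfl ≫ Xs C i k ◁ eps C k = (ρ_ _).inv := by
  have key : cutOp h le_rfl ≫ op (sg i k) ◁ (FinInt.castIso (eps_len k)).hom.op =
      (ρ_ (op (sg i k))).inv := by
    refine Quiver.Hom.unop_inj ?_
    show (𝟙 (sg i k) ⊗ₘ (FinInt.castIso (eps_len k)).hom) ≫
      (FinInt.castIso (cut_len h le_rfl)).hom = (FinInt.castIso (FinInt.add_zero_len _)).hom
    refine FinInt.hom_ext fun x hx => ?_
    have hx' : x ≤ (sg i k).len := hx
    rw [FinInt.nat_comp, FinInt.nat_castIso_hom (FinInt.nat_le _ _),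
      nat_tensorHom_left _ _ hx', FinInt.nat_id hx']
    exact (FinInt.nat_castIso_hom (h := FinInt.add_zero_len _) hx).symm
  rw [oplax_right_unitality, ← key]
  simp only [mu, eps, MonoidalCategory.whiskerLeft_comp, Category.assoc, Functor.map_comp]
  rw [δ_natural_right_assoc]
  rfl

instance [IsIso (η C)] (k : ℕ) : IsIso (eps C k) := by
  unfold eps
  infer_instance

lemma mu_unit [IsIso (η C)] {i k j : ℕ} (h : i ≤ k) (h' : k ≤ j) :
    mu C h le_rfl ▷ Xs C k j ≫ (α_ _ _ _).hom = Xs C i k ◁ mu C le_rfl h' := by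
  rw [← cancel_mono (Xs C i k ◁ (eps C k ▷ Xs C k j)), ← MonoidalCategory.whiskerLeft_comp,
    mu_eps_left, Category.assoc, ← associator_naturality_middle, ← comp_whiskerRight_assoc,
    mu_eps_right]
  monoidal

/-- For a list `l = [t₁, ..., t_r]` of joints between `a` and `p`, the object
`X_{t₁ - a} ⊗ X_{t₂ - t₁} ⊗ ... ⊗ X_{p - t_r}`. -/
@[reducible] def Z : ℕ → List ℕ → ℕ → D
  | a, [], p => Xs C a p
  | a, j :: l, p => Xs C a j ⊗ Z j l p

/-- The list `a, t₁, ..., t_r, p` is weakly increasing. -/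
def Ok : ℕ → List ℕ → ℕ → Prop
  | a, [], p => a ≤ p
  | a, j :: l, p => a ≤ j ∧ Ok j l p

/-- Splitting off the part before `k` of the first factor of `Z a l p`. -/
def cut {a k : ℕ} (h : a ≤ k) : ∀ {l : List ℕ} {p : ℕ}, Ok k l p → (Z C a l p ⟶ Xs C a k ⊗ Z C k l p)
  | [], _, h' => mu C h h'
  | _ :: _, _, h' => mu C h h'.1 ▷ _ ≫ (α_ _ _ _).hom

lemma cut_nil {a k p : ℕ} (h : a ≤ k) (h' : Ok k [] p) : cut C h h' = mu C h h' := rfl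

lemma cut_cons {a k j p : ℕ} {l : List ℕ} (h : a ≤ k) (h' : Ok k (j :: l) p) :
    cut C h h' = mu C h h'.1 ▷ Z C j l p ≫ (α_ _ _ _).hom := rfl

lemma Ok.mono {a b : ℕ} {l : List ℕ} {p : ℕ} (h : Ok b l p) (hab : a ≤ b) : Ok a l p := by
  cases l with
  | nil => exact hab.trans h
  | cons j l => exact ⟨hab.trans h.1, h.2⟩

lemma Ok.of_sublist {l m : List ℕ} (h : l.Sublist m) {a p : ℕ} (hm : Ok a m p) : Ok a l p := by
  induction h generalizing a with
  | slnil => exact hm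
  | cons k h ih => exact (ih hm.2).mono hm.1
  | cons_cons k h ih => exact ⟨hm.1, ih hm.2⟩

lemma Ok.map {f : ℕ → ℕ} (hf : Monotone f) {a p : ℕ} {l : List ℕ} (h : Ok a l p) :
    Ok (f a) (l.map f) (f p) := by
  induction l generalizing a with
  | nil => exact hf h
  | cons j l ih => exact ⟨hf h.1, ih h.2⟩

/-- For weakly increasing lists of joints `l ⊆ m`, the refinement morphism from the tensor product
over `l` to the tensor product over `m`, given by the comultiplications. -/
def refineMap : ∀ {m l : List ℕ} {a p : ℕ}, l.Sublist m → Ok a m p → (Z C a l p ⟶ Z C a m p)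
  | [], [], _, _, _, _ => 𝟙 _
  | [], _ :: _, _, _, h, _ => absurd h (by simp)
  | k :: _, [], _, _, _, hm => cut C hm.1 (hm.2.of_sublist (List.nil_sublist _)) ≫
      _ ◁ refineMap (List.nil_sublist _) hm.2
  | k :: m, j :: l, a, p, h, hm =>
      if e : j = k then
        eqToHom (by rw [e, Z]) ≫ Xs C a k ◁ refineMap h.of_cons_cons hm.2
      else cut C hm.1 (hm.2.of_sublist (h.of_cons_of_ne e)) ≫ _ ◁ refineMap (h.of_cons_of_ne e) hm.2

lemma refine_self_cons {k : ℕ} {m l : List ℕ} {a p : ℕ} (h : (k :: l).Sublist (k :: m))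
    (hm : Ok a (k :: m) p) :
    refineMap C h hm = Xs C a k ◁ refineMap C h.of_cons_cons hm.2 := by
  rw [refineMap, dif_pos rfl]
  exact Category.id_comp _

/-- The first joint of `l`, if any, is not `k`. -/
def HeadNe (k : ℕ) : List ℕ → Prop
  | [] => True
  | j :: _ => j ≠ k

lemma HeadNe.sublist {k : ℕ} {l m : List ℕ} (h : HeadNe k l) (hs : l.Sublist (k :: m)) :
    l.Sublist m := by
  cases l with
  | nil => exact List.nil_sublist _
  | cons j l => exact hs.of_cons_of_ne h

lemma refine_of_ne {k : ℕ} {m l : List ℕ} {a p : ℕ} (hl : HeadNe k l) (h : l.Sublist (k :: m))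
    (hm : Ok a (k :: m) p) :
    refineMap C h hm = cut C hm.1 (hm.2.of_sublist (hl.sublist h)) ≫
      Xs C a k ◁ refineMap C (hl.sublist h) hm.2 := by
  cases l with
  | nil => rfl
  | cons j l =>
    rw [refineMap, dif_neg hl]

lemma refine_id {l : List ℕ} {a p : ℕ} (h : l.Sublist l) (hl : Ok a l p) :
    refineMap C h hl = 𝟙 (Z C a l p) := by
  induction l generalizing a with
  | nil => rfl
  | cons j l ih =>
    rw [refine_self_cons, ih]
    exact MonoidalCategory.whiskerLeft_id _ _

/-- The action of a monotone function on tensor products over lists of joints. -/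
def Zmap {f : ℕ → ℕ} (hf : Monotone f) : ∀ {l l' : List ℕ} {a a' p p' : ℕ}, a' = f a →
    l' = l.map f → p' = f p → (Z C a' l' p' ⟶ Z C a l p)
  | [], [], _, _, _, _, ha, _, hp => Xmap C hf ha hp
  | [], _ :: _, _, _, _, _, _, hl, _ => absurd hl (by simp)
  | _ :: _, [], _, _, _, _, _, hl, _ => absurd hl (by simp)
  | _ :: _, _ :: _, _, _, _, _, ha, hl, hp =>
    Xmap C hf ha (List.cons.inj hl).1 ⊗ₘ Zmap hf (List.cons.inj hl).1 (List.cons.inj hl).2 hp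

lemma Zmap_nil {f : ℕ → ℕ} (hf : Monotone f) {a a' p p' : ℕ} (ha : a' = f a)
    (hl : [] = [].map f) (hp : p' = f p) :
    Zmap C hf ha hl hp = Xmap C hf ha hp := rfl

lemma Zmap_cons {f : ℕ → ℕ} (hf : Monotone f) {j j' : ℕ} {l l' : List ℕ} {a a' p p' : ℕ}
    (ha : a' = f a) (hl : j' :: l' = (j :: l).map f) (hp : p' = f p) :
    Zmap C hf ha hl hp = Xmap C hf ha (List.cons.inj hl).1 ⊗ₘ
      Zmap C hf (List.cons.inj hl).1 (List.cons.inj hl).2 hp := rfl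

lemma aux_tail {A B E W W' : D} (m : A ⟶ B ⊗ E) (g : W ⟶ W') :
    (m ▷ W ≫ (α_ _ _ _).hom) ≫ B ◁ (E ◁ g) = A ◁ g ≫ m ▷ W' ≫ (α_ _ _ _).hom := by
  rw [Category.assoc, ← associator_naturality_right, whisker_exchange_assoc]

lemma aux_coassoc {A B E F G H W : D} (m₁ : A ⟶ B ⊗ E) (m₂ : E ⟶ F ⊗ G) (m₃ : A ⟶ H ⊗ G)
    (m₄ : H ⟶ B ⊗ F) (h : m₁ ≫ B ◁ m₂ = m₃ ≫ m₄ ▷ G ≫ (α_ _ _ _).hom) :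
    (m₁ ▷ W ≫ (α_ _ _ _).hom) ≫ B ◁ (m₂ ▷ W ≫ (α_ _ _ _).hom) =
      (m₃ ▷ W ≫ (α_ _ _ _).hom) ≫ m₄ ▷ (G ⊗ W) ≫ (α_ _ _ _).hom := by
  have h' := congrArg (fun k => k ▷ W) h
  simp only [comp_whiskerRight, whisker_assoc] at h'
  simp only [MonoidalCategory.whiskerLeft_comp, Category.assoc]
  rw [← cancel_mono (B ◁ (α_ F G W).inv), ← cancel_mono (α_ B (F ⊗ G) W).inv]
  simp only [Category.assoc, MonoidalCategory.whiskerLeft_hom_inv_assoc]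
  rw [h', ← associator_naturality_left_assoc]
  monoidal

lemma aux_unit {A B E W : D} (m : A ⟶ A ⊗ E) (n : B ⟶ E ⊗ B)
    (h : m ▷ B ≫ (α_ _ _ _).hom = A ◁ n) :
    m ▷ (B ⊗ W) ≫ (α_ _ _ _).hom = A ◁ (n ▷ W ≫ (α_ _ _ _).hom) := by
  have h' := congrArg (fun k => k ▷ W) h
  simp only [comp_whiskerRight, whisker_assoc] at h'
  rw [← cancel_epi (α_ A B W).hom, ← cancel_mono (A ◁ (α_ E B W).inv),
    ← cancel_mono (α_ A (E ⊗ B) W).inv]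
  simp only [MonoidalCategory.whiskerLeft_comp, Category.assoc,
    MonoidalCategory.whiskerLeft_hom_inv_assoc]
  rw [← h', ← associator_naturality_left_assoc]
  monoidal

/-- Naturality of `cut` in the tail of the list. -/
lemma cut_tail {a k j p : ℕ} {l m : List ℕ} (h : a ≤ k) (h' : Ok k (j :: l) p)
    (h'' : Ok k (j :: m) p) (g : Z C j l p ⟶ Z C j m p) :
    cut C h h' ≫ Xs C a k ◁ (Xs C k j ◁ g) = Xs C a j ◁ g ≫ cut C h h'' :=
  aux_tail _ _

lemma cut_coassoc {a k k' p : ℕ} {l : List ℕ} (h : a ≤ k) (h' : k ≤ k') (hl : Ok k' l p) :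
    cut C h (hl.mono h') ≫ Xs C a k ◁ cut C h' hl =
      cut C (h.trans h') hl ≫ cut C h (l := k' :: l) ⟨h', hl⟩ := by
  cases l with
  | nil => exact mu_coassoc C h h' hl
  | cons j l => exact aux_coassoc _ _ _ _ (mu_coassoc C h h' hl.1)

lemma cut_unit [IsIso (η C)] {a k p : ℕ} {l : List ℕ} (h : a ≤ k) (hl : Ok k l p) :
    cut C h (l := k :: l) ⟨le_rfl, hl⟩ = Xs C a k ◁ cut C le_rfl hl := by
  cases l with
  | nil => exact mu_unit C h hl
  | cons j l => exact aux_unit _ _ (mu_unit C h hl.1)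

lemma headNe_or (k : ℕ) (l : List ℕ) : HeadNe k l ∨ ∃ l', l = k :: l' := by
  cases l with
  | nil => exact Or.inl trivial
  | cons j l =>
    by_cases h : j = k
    · exact Or.inr ⟨l, by rw [h]⟩
    · exact Or.inl h

lemma refine_cut {k : ℕ} {l m : List ℕ} {a p : ℕ} (h : l.Sublist m) (hak : a ≤ k) (hm : Ok k m p) :
    refineMap C h (hm.mono hak) ≫ cut C hak hm =
      cut C hak (hm.of_sublist h) ≫ Xs C a k ◁ refineMap C h hm := by
  cases m with
  | nil =>
    obtain rfl := List.sublist_nil.mp h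
    exact (Category.id_comp _).trans (((congrArg (fun x => _ ≫ x)
      (MonoidalCategory.whiskerLeft_id _ _)).trans (Category.comp_id _)).symm)
  | cons j m =>
    rcases headNe_or j l with hl | ⟨l, rfl⟩
    · rw [refine_of_ne C hl h, refine_of_ne C hl h, Category.assoc,
        ← cut_tail C hak ⟨hm.1, hm.2.of_sublist (hl.sublist h)⟩ hm, ← Category.assoc,
        ← cut_coassoc C hak hm.1, Category.assoc, MonoidalCategory.whiskerLeft_comp]
    · rw [refine_self_cons, refine_self_cons, cut_tail]

lemma Ok.le_mem {a p x : ℕ} {l : List ℕ} (h : Ok a l p) (hx : x ∈ l) : a ≤ x := by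
  induction l generalizing a with
  | nil => simp at hx
  | cons j l ih =>
    rcases List.mem_cons.mp hx with rfl | hx
    · exact h.1
    · exact h.1.trans (ih h.2 hx)

/-- A sorted list that contains `k` and has all elements at least `k` starts with `k`. -/
lemma head_eq {k p : ℕ} {l m : List ℕ} (h : (k :: l).Sublist m) (hm : Ok k m p) :
    ∃ m', m = k :: m' := by
  cases m with
  | nil => simp at h
  | cons j m =>
    refine ⟨m, ?_⟩
    rcases List.mem_cons.mp (h.subset List.mem_cons_self) with h1 | h1
    · rw [h1]
    · rw [le_antisymm hm.1 (hm.2.le_mem h1)]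

lemma refine_trans {l m n : List ℕ} {a p : ℕ} (h : l.Sublist m) (h' : m.Sublist n)
    (hn : Ok a n p) :
    refineMap C h (hn.of_sublist h') ≫ refineMap C h' hn = refineMap C (h.trans h') hn := by
  induction n generalizing l m a with
  | nil =>
    obtain rfl := List.sublist_nil.mp h'
    obtain rfl := List.sublist_nil.mp h
    exact Category.id_comp _
  | cons k n ih =>
    rcases headNe_or k m with hm | ⟨m, rfl⟩
    · have hl : HeadNe k l := by
        rcases headNe_or k l with hl | ⟨l, rfl⟩
        · exact hl
        · obtain ⟨m', rfl⟩ := head_eq h (hn.2.of_sublist (hm.sublist h'))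
          exact absurd rfl hm
      rw [refine_of_ne C hm h', refine_of_ne C hl (h.trans h'), ← Category.assoc,
        refine_cut C h hn.1, Category.assoc, ← MonoidalCategory.whiskerLeft_comp, ih]
    · rcases headNe_or k l with hl | ⟨l, rfl⟩
      · rw [refine_of_ne C hl h, refine_of_ne C hl (h.trans h'), refine_self_cons, Category.assoc,
          ← MonoidalCategory.whiskerLeft_comp, ih]
      · rw [refine_self_cons, refine_self_cons, refine_self_cons,
          ← MonoidalCategory.whiskerLeft_comp, ih]

lemma cut_refine_unit [IsIso (η C)] {l m : List ℕ} {a k p : ℕ} (hak : a ≤ k)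
    (h : (k :: l).Sublist m) (hm : Ok k m p) (hl : Ok k (k :: l) p) :
    cut C hak hl ≫ Xs C a k ◁ refineMap C h hm =
      Xs C a k ◁ refineMap C ((List.sublist_cons_self k l).trans h) hm := by
  induction m generalizing l a with
  | nil => simp at h
  | cons j m ih =>
    obtain ⟨_, e⟩ := head_eq h hm
    obtain rfl := (List.cons.inj e).1
    clear e
    rw [cut_unit C hak hl.2, refine_self_cons, ← MonoidalCategory.whiskerLeft_comp]
    congr 1
    rcases headNe_or j l with hn | ⟨l, rfl⟩
    · rw [refine_of_ne C hn]
    · rw [refine_self_cons, ih]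

lemma aux_cut {A B E W A' B' E' W' : D} (m : A ⟶ B ⊗ E) (m' : A' ⟶ B' ⊗ E') (x : A' ⟶ A)
    (y : B' ⟶ B) (z : E' ⟶ E) (v : W' ⟶ W) (h : x ≫ m = m' ≫ (y ⊗ₘ z)) :
    (x ⊗ₘ v) ≫ m ▷ W ≫ (α_ _ _ _).hom = (m' ▷ W' ≫ (α_ _ _ _).hom) ≫ (y ⊗ₘ (z ⊗ₘ v)) := by
  rw [Category.assoc, ← associator_naturality, ← MonoidalCategory.tensorHom_id,
    ← MonoidalCategory.tensorHom_id, MonoidalCategory.tensorHom_comp_tensorHom_assoc,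
    MonoidalCategory.tensorHom_comp_tensorHom_assoc, h, Category.id_comp, Category.comp_id]

lemma Zmap_cut {f : ℕ → ℕ} (hf : Monotone f) {l l' : List ℕ} {a a' k k' p p' : ℕ} (ha : a' = f a)
    (hk : k' = f k) (hl : l' = l.map f) (hp : p' = f p) (h : a ≤ k) (h₁ : Ok k l p) (h' : a' ≤ k')
    (h₁' : Ok k' l' p') :
    Zmap C hf ha hl hp ≫ cut C h h₁ =
      cut C h' h₁' ≫ (Xmap C hf ha hk ⊗ₘ Zmap C hf hk hl hp) := by
  cases l with
  | nil =>
    obtain rfl : l' = [] := hl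
    exact mu_natural C hf ha hk hp h h₁ h' h₁'
  | cons j l =>
    cases l' with
    | nil => simp at hl
    | cons j' l' => exact aux_cut _ _ _ _ _ _ (mu_natural C hf ha hk _ h h₁.1 h' h₁'.1)

lemma refine_Zmap [IsIso (η C)] {f : ℕ → ℕ} (hf : Monotone f) {l l' m m' : List ℕ}
    {a a' p p' : ℕ} (ha : a' = f a) (hl : l' = l.map f) (hm : m' = m.map f) (hp : p' = f p)
    (h : l.Sublist m) (h' : l'.Sublist m') (ho : Ok a m p) (ho' : Ok a' m' p') :
    refineMap C h' ho' ≫ Zmap C hf ha hm hp = Zmap C hf ha hl hp ≫ refineMap C h ho := by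
  induction m generalizing l l' m' a a' with
  | nil =>
    obtain rfl := List.sublist_nil.mp h
    obtain rfl : m' = [] := hm
    obtain rfl : l' = [] := hl
    exact (Category.id_comp _).trans (Category.comp_id _).symm
  | cons k m ih =>
    cases m' with
    | nil => simp at hm
    | cons k' m' =>
      obtain ⟨hk, hm'⟩ := List.cons.inj hm
      rcases headNe_or k' l' with hn' | ⟨l', rfl⟩
      · have hn : HeadNe k l := by
          rcases headNe_or k l with hn | ⟨l, rfl⟩
          · exact hn
          · rw [hl, List.map_cons, ← hk] at hn'
            exact absurd rfl hn'
        rw [refine_of_ne C hn', refine_of_ne C hn, Zmap_cons, ← Category.assoc,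
          Zmap_cut C hf ha hk hl hp ho.1 _ ho'.1 (ho'.2.of_sublist (hn'.sublist h')), Category.assoc,
          Category.assoc, MonoidalCategory.whiskerLeft_comp_tensorHom, MonoidalCategory.tensorHom_comp_whiskerLeft, ih hk hl hm' (hn.sublist h) (hn'.sublist h') ho.2]
      · rcases headNe_or k l with hn | ⟨l, rfl⟩
        · cases l with
          | nil => simp at hl
          | cons j l =>
            have h₁ := hn.sublist h
            have h₁' : (k' :: l').Sublist m' := by
              rw [hl, hm']
              exact h₁.map f
            rw [refine_self_cons, refine_of_ne C hn, Zmap_cons, ← Category.assoc,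
              Zmap_cut C hf ha hk hl hp ho.1 _ ho'.1 (ho'.2.of_sublist h₁'), Category.assoc,
              MonoidalCategory.tensorHom_comp_whiskerLeft, ← ih hk hl hm' h₁ h₁' ho.2 ho'.2, ← MonoidalCategory.whiskerLeft_comp_tensorHom, ← Category.assoc,
              cut_refine_unit]
        · rw [refine_self_cons, refine_self_cons, Zmap_cons, Zmap_cons, MonoidalCategory.whiskerLeft_comp_tensorHom, MonoidalCategory.tensorHom_comp_whiskerLeft,
            ih hk (List.cons.inj hl).2 hm' h.of_cons_cons h'.of_cons_cons ho.2]

lemma Xmap_comp {f g : ℕ → ℕ} (hf : Monotone f) (hg : Monotone g) (hgf : Monotone (g ∘ f))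
    {i i' i'' j j' j'' : ℕ} (hi : i' = f i) (hj : j' = f j) (hi' : i'' = g i') (hj' : j'' = g j')
    (h₁ : i'' = (g ∘ f) i) (h₂ : j'' = (g ∘ f) j) :
    Xmap C hg hi' hj' ≫ Xmap C hf hi hj = Xmap C hgf h₁ h₂ := by
  rw [Xmap, Xmap, Xmap, ← Functor.map_comp, ← op_comp]
  congr 2
  refine FinInt.hom_ext fun x hx => ?_
  have h := hf (show i ≤ i + x by omega)
  have h1 : f (i + x) ≤ max (f i) (f j) := by
    rw [sg_len] at hx
    rcases le_total i j with h' | h'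
    · exact (hf (by omega)).trans (le_max_right _ _)
    · rw [show i + x = i by omega]
      exact le_max_left _ _
  rw [FinInt.nat_comp, nat_segHom hf hi hj hx, nat_segHom hgf h₁ h₂ hx, nat_segHom hg hi' hj',
    hi, Nat.add_sub_cancel' h]
  · rfl
  · rw [hi, hj]
    rcases le_total (f i) (f j) with h' | h'
    · rw [max_eq_right h'] at h1
      omega
    · rw [max_eq_left h'] at h1
      omega

lemma Zmap_comp {f g : ℕ → ℕ} (hf : Monotone f) (hg : Monotone g) (hgf : Monotone (g ∘ f))
    {l l' l'' : List ℕ} {a a' a'' p p' p'' : ℕ} (ha : a' = f a) (hl : l' = l.map f) (hp : p' = f p)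
    (ha' : a'' = g a') (hl' : l'' = l'.map g) (hp' : p'' = g p') (h₁ : a'' = (g ∘ f) a)
    (h₂ : l'' = l.map (g ∘ f)) (h₃ : p'' = (g ∘ f) p) :
    Zmap C hg ha' hl' hp' ≫ Zmap C hf ha hl hp = Zmap C hgf h₁ h₂ h₃ := by
  induction l generalizing l' l'' a a' a'' with
  | nil =>
    obtain rfl : l' = [] := hl
    obtain rfl : l'' = [] := hl'
    exact Xmap_comp C hf hg hgf ha hp ha' hp' h₁ h₃
  | cons j l ih =>
    cases l' with
    | nil => simp at hl
    | cons j' l' =>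
      cases l'' with
      | nil => simp at hl'
      | cons j'' l'' =>
        rw [Zmap_cons, Zmap_cons, Zmap_cons, MonoidalCategory.tensorHom_comp_tensorHom, ih,
          Xmap_comp]

lemma Xmap_id {f : ℕ → ℕ} (hf : Monotone f) {i j : ℕ} (h : i ≤ j) (hfi : ∀ x, x ≤ j → f x = x)
    (hi : i = f i) (hj : j = f j) :
    Xmap C hf hi hj = 𝟙 (Xs C i j) := by
  have : segHom hf hi hj = 𝟙 _ := FinInt.hom_ext fun x hx => by
    have hx' := hx
    rw [sg_len] at hx'
    rw [nat_segHom hf hi hj hx, FinInt.nat_id hx, hfi i h, hfi (i + x) (by omega)]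
    omega
  rw [Xmap, this, op_id]
  exact CategoryTheory.Functor.map_id _ _

lemma Ok.le {a p : ℕ} {l : List ℕ} (h : Ok a l p) : a ≤ p := by
  induction l generalizing a with
  | nil => exact h
  | cons j l ih => exact h.1.trans (ih h.2)

lemma Zmap_id {f : ℕ → ℕ} (hf : Monotone f) {l : List ℕ} {a p : ℕ} (hfi : ∀ i, i ≤ p → f i = i)
    (ho : Ok a l p) (ha : a = f a) (hl : l = l.map f) (hp : p = f p) :
    Zmap C hf ha hl hp = 𝟙 (Z C a l p) := by
  induction l generalizing a with
  | nil => exact Xmap_id C hf ho hfi _ _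
  | cons j l ih =>
    rw [Zmap_cons, ih ho.2, Xmap_id C hf ho.1 fun x hx => hfi x (hx.trans ho.2.le)]
    exact MonoidalCategory.id_tensorHom_id _ _

lemma Zmap_congr {f g : ℕ → ℕ} (hf : Monotone f) (hg : Monotone g) (h : f = g)
    {l l' : List ℕ} {a a' p p' : ℕ} (ha : a' = f a) (hl : l' = l.map f) (hp : p' = f p) :
    Zmap C hf ha hl hp = Zmap C hg (h ▸ ha) (h ▸ hl) (h ▸ hp) := by
  subst h
  rfl

end Necklaces

section NecklaceCategory

/-- Necklaces `(T, p)` with `{0, p} ⊆ T ⊆ [p]`. -/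
structure Nec : Type where
  /-- The last vertex. -/
  p : ℕ
  /-- The set of joints. -/
  T : Finset ℕ
  zero_mem : 0 ∈ T
  last_mem : p ∈ T
  le : ∀ t ∈ T, t ≤ p

namespace Nec

/-- Necklace maps `(T, p) ⟶ (U, q)`: morphisms of finite intervals `f : [p] ⟶ [q]` with
`U ⊆ f(T)`. -/
structure Hom (N M : Nec) : Type where
  /-- The underlying morphism of finite intervals. -/
  f : (⟨N.p⟩ : FinInt) ⟶ ⟨M.p⟩
  subset : M.T ⊆ N.T.image (FinInt.nat f)

instance : Category Nec where
  Hom := Hom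
  id N := ⟨𝟙 _, fun t ht => Finset.mem_image.mpr ⟨t, ht, FinInt.nat_id (N.le t ht)⟩⟩
  comp {N M K} f g := ⟨f.f ≫ g.f, fun t ht => by
    obtain ⟨s, hs, rfl⟩ := Finset.mem_image.mp (g.subset ht)
    obtain ⟨r, hr, rfl⟩ := Finset.mem_image.mp (f.subset hs)
    exact Finset.mem_image.mpr ⟨r, hr, FinInt.nat_comp _ _ _⟩⟩

/-- The underlying function of a necklace map, extended to natural numbers. -/
def fn {N M : Nec} (f : N ⟶ M) : ℕ → ℕ := FinInt.nat (Hom.f f)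

lemma fn_mono {N M : Nec} (f : N ⟶ M) : Monotone (fn f) := fun _ _ h => FinInt.nat_mono _ h

lemma fn_id (N : Nec) {i : ℕ} (h : i ≤ N.p) : fn (𝟙 N) i = i := FinInt.nat_id h

lemma fn_comp {N M K : Nec} (f : N ⟶ M) (g : M ⟶ K) : fn (f ≫ g) = fn g ∘ fn f :=
  funext fun _ => FinInt.nat_comp _ _ _

lemma fn_zero {N M : Nec} (f : N ⟶ M) : 0 = fn f 0 := (FinInt.nat_zero _).symm

lemma fn_last {N M : Nec} (f : N ⟶ M) : M.p = fn f N.p := (FinInt.nat_last (Hom.f f) rfl).symm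

/-- The increasing list of the joints other than `0` and `p`. -/
def joints (N : Nec) : List ℕ := ((N.T.erase 0).erase N.p).sort

lemma mem_joints {N : Nec} {t : ℕ} : t ∈ N.joints ↔ t ∈ N.T ∧ t ≠ 0 ∧ t ≠ N.p := by
  simp only [joints, Finset.mem_sort, Finset.mem_erase]
  tauto

lemma joints_ok (N : Nec) : Ok 0 N.joints N.p := by
  have h1 : N.joints.Pairwise (· ≤ ·) := Finset.pairwise_sort _ _
  have h2 : ∀ t ∈ N.joints, t ≤ N.p := fun t ht => N.le t (mem_joints.mp ht).1
  have h3 : ∀ t ∈ N.joints, 0 ≤ t := fun t _ => Nat.zero_le t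
  have h4 : 0 ≤ N.p := Nat.zero_le _
  generalize N.joints = l at h1 h2 h3
  generalize 0 = a at h3 h4
  induction l generalizing a with
  | nil => exact h4
  | cons j l ih =>
    rw [List.pairwise_cons] at h1
    exact ⟨h3 j List.mem_cons_self, ih h1.2 (fun t ht => h2 t (List.mem_cons_of_mem _ ht)) j h1.1
      (h2 j List.mem_cons_self)⟩

lemma joints_sublist {N M : Nec} (f : N ⟶ M) : M.joints.Sublist (N.joints.map (fn f)) := by
  refine List.sublist_of_subperm_of_pairwise (r := (· ≤ ·)) ?_ (Finset.pairwise_sort _ _) ?_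
  · refine List.Nodup.subperm (Finset.sort_nodup _ _) fun t ht => ?_
    obtain ⟨h1, h2, h3⟩ := mem_joints.mp ht
    obtain ⟨s, hs, rfl⟩ := Finset.mem_image.mp (Hom.subset f h1)
    refine List.mem_map.mpr ⟨s, mem_joints.mpr ⟨hs, ?_, ?_⟩, rfl⟩
    · rintro rfl
      exact h2 (fn_zero f).symm
    · rintro rfl
      exact h3 (fn_last f).symm
  · exact List.pairwise_map.mpr ((Finset.pairwise_sort _ _).imp fun h => fn_mono f h)

end Nec

variable {D : Type w} [Category.{u} D] [MonoidalCategory D] (C : FinIntᵒᵖ ⥤ D) [C.OplaxMonoidal]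
  [IsIso (Functor.OplaxMonoidal.η C)]

lemma joints_ok' {N M : Nec} (f : N ⟶ M) : Ok 0 (N.joints.map (Nec.fn f)) M.p := by
  have := N.joints_ok.map (Nec.fn_mono f)
  rwa [← Nec.fn_zero, ← Nec.fn_last] at this

/-- The action of a necklace map: comultiplications followed by the values of `C` at the
restrictions of the map to the beads. -/
def necMap {N M : Nec} (f : N ⟶ M) : Z C 0 M.joints M.p ⟶ Z C 0 N.joints N.p :=
  refineMap C (Nec.joints_sublist f) (joints_ok' f) ≫
    Zmap C (Nec.fn_mono f) (Nec.fn_zero f) rfl (Nec.fn_last f)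

lemma necMap_eq {N M : Nec} (f : N ⟶ M) {F : ℕ → ℕ} (hF : Nec.fn f = F) (hm : Monotone F)
    {m : List ℕ} (h : m = N.joints.map F) (hs : M.joints.Sublist m) (ho : Ok 0 m M.p)
    (h₀ : 0 = F 0) (h₁ : M.p = F N.p) :
    necMap C f = refineMap C hs ho ≫ Zmap C hm h₀ h h₁ := by
  subst hF h
  rfl

lemma necMap_id (N : Nec) : necMap C (𝟙 N) = 𝟙 (Z C 0 N.joints N.p) := by
  have h : N.joints = N.joints.map (Nec.fn (𝟙 N)) := by
    conv_lhs => rw [← List.map_id N.joints]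
    exact List.map_congr_left fun t ht => (Nec.fn_id N (N.le t (Nec.mem_joints.mp ht).1)).symm
  rw [necMap_eq C (𝟙 N) rfl (Nec.fn_mono _) h (List.Sublist.refl _) N.joints_ok
    (Nec.fn_zero _) (Nec.fn_last _), refine_id,
    Zmap_id C (Nec.fn_mono (𝟙 N)) (fun i hi => Nec.fn_id N hi) N.joints_ok, Category.comp_id]

lemma necMap_comp {N M K : Nec} (f : N ⟶ M) (g : M ⟶ K) :
    necMap C (f ≫ g) = necMap C g ≫ necMap C f := by
  have hs : (M.joints.map (Nec.fn g)).Sublist ((N.joints.map (Nec.fn f)).map (Nec.fn g)) :=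
    (Nec.joints_sublist f).map _
  have ho : Ok 0 ((N.joints.map (Nec.fn f)).map (Nec.fn g)) K.p := by
    have := (joints_ok' f).map (Nec.fn_mono g)
    rwa [← Nec.fn_zero, ← Nec.fn_last] at this
  have h0 : 0 = (Nec.fn g ∘ Nec.fn f) 0 := by
    rw [Function.comp_apply, ← Nec.fn_zero, ← Nec.fn_zero]
  have h1 : K.p = (Nec.fn g ∘ Nec.fn f) N.p := by
    rw [Function.comp_apply, ← Nec.fn_last, ← Nec.fn_last]
  have h2 : (N.joints.map (Nec.fn f)).map (Nec.fn g) = N.joints.map (Nec.fn g ∘ Nec.fn f) :=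
    List.map_map
  rw [necMap_eq C (f ≫ g) (Nec.fn_comp f g) ((Nec.fn_mono g).comp (Nec.fn_mono f)) h2
    ((Nec.joints_sublist g).trans hs) ho h0 h1]
  rw [necMap, necMap, Category.assoc, ← Category.assoc (Zmap _ _ _ _ _),
    ← refine_Zmap C (Nec.fn_mono g) (Nec.fn_zero g) rfl rfl (Nec.fn_last g) (Nec.joints_sublist f)
      hs (joints_ok' f) ho, Category.assoc, Zmap_comp C (Nec.fn_mono f) (Nec.fn_mono g) _ _ _ _ _ _ _ h0 h2 h1,
    ← Category.assoc, refine_trans]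

/-- The functor on the opposite of the category of necklaces given by
`(T, p) ↦ X_{t₁} ⊗ X_{t₂ - t₁} ⊗ ... ⊗ X_{p - t_{k-1}}` where `T = {0 < t₁ < ... < t_{k-1} < p}`. -/
def necFunctor : Necᵒᵖ ⥤ D where
  obj N := Z C 0 N.unop.joints N.unop.p
  map f := necMap C f.unop
  map_id N := necMap_id C N.unop
  map_comp f g := necMap_comp C g.unop f.unop

end NecklaceCategory

section TempNec

variable {V : Type w} [Category.{u} V] [MonoidalCategory V] [SymmetricCategory V]
  [MonoidalClosed V] [HasColimits V]

open VQuiv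

namespace VQuiv.HomOver

variable {S T : Type u} {f : S → T}

lemma post_comp {Q : VQuiv V S} {P P' P'' : VQuiv V T} (α : HomOver f Q P) (g : P ⟶ P')
    (h : P' ⟶ P'') : α.post (g ≫ h) = (α.post g).post h := by
  ext a b
  exact (Category.assoc _ _ _).symm

lemma pre_comp {Q Q' Q'' : VQuiv V S} {P : VQuiv V T} (α : HomOver f Q P) (g : Q' ⟶ Q)
    (h : Q'' ⟶ Q') : α.pre (h ≫ g) = (α.pre g).pre h := by
  ext a b
  exact Category.assoc _ _ _

lemma pre_post {Q Q' : VQuiv V S} {P P' : VQuiv V T} (α : HomOver f Q P) (g : Q' ⟶ Q)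
    (h : P ⟶ P') : (α.pre g).post h = (α.post h).pre g := by
  ext a b
  exact Category.assoc _ _ _

lemma post_id {Q : VQuiv V S} {P : VQuiv V T} (α : HomOver f Q P) : α.post (𝟙 P) = α := by
  ext a b
  exact Category.comp_id _

lemma pre_id {Q : VQuiv V S} {P : VQuiv V T} (α : HomOver f Q P) : α.pre (𝟙 Q) = α := by
  ext a b
  exact Category.id_comp _

lemma post_left {Q Q' : VQuiv V S} {P P' P₁ : VQuiv V T} (α : HomOver f Q P)
    (β : HomOver f Q' P') (g : P' ⟶ P₁) :
    (tensor α β).post (tmap (𝟙 P) g) = tensor α (β.post g) := by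
  rw [← post_tensor, post_id]

lemma pre_left {Q Q' Q₁ : VQuiv V S} {P P' : VQuiv V T} (α : HomOver f Q P)
    (β : HomOver f Q' P') (g : Q₁ ⟶ Q') :
    (tensor α β).pre (tmap (𝟙 Q) g) = tensor α (β.pre g) := by
  rw [← pre_tensor, pre_id]

lemma post_right {Q Q' : VQuiv V S} {P P' P₁ : VQuiv V T} (α : HomOver f Q P)
    (β : HomOver f Q' P') (g : P ⟶ P₁) :
    (tensor α β).post (tmap g (𝟙 P')) = tensor (α.post g) β := by
  rw [← post_tensor, post_id]

lemma pre_right {Q Q' Q₁ : VQuiv V S} {P P' : VQuiv V T} (α : HomOver f Q P)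
    (β : HomOver f Q' P') (g : Q₁ ⟶ Q) :
    (tensor α β).pre (tmap g (𝟙 Q')) = tensor (α.pre g) β := by
  rw [← pre_tensor, pre_id]

end VQuiv.HomOver

namespace TempObj

open HomOver

/-- The functor `X_•(a, b)` on the opposite of the category of necklaces. -/
def nec (X : TempObj V) (a b : X.S) : Necᵒᵖ ⥤ V where
  obj N := ((necFunctor X.X).obj N) a b
  map f := ((necFunctor X.X).map f).app a b
  map_id N := by
    rw [CategoryTheory.Functor.map_id]
    rfl
  map_comp f g := by
    rw [Functor.map_comp]
    rfl

variable {X Y : TempObj V} (φ : X ⟶ Y)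

/-- The map of vertices underlying a templicial morphism. -/
def vmap : X.S → Y.S := Hom.base φ

/-- The component of a templicial morphism at `{i, ..., j}`. -/
def segOver (i j : ℕ) : HomOver (vmap φ) (Xs X.X i j) (Xs Y.X i j) := Hom.app φ (op (sg i j))

/-- The tensor product of the components of a templicial morphism over a list of joints. -/
def Zover : ∀ (a : ℕ) (l : List ℕ) (p : ℕ), HomOver (vmap φ) (Z X.X a l p) (Z Y.X a l p)
  | a, [], p => segOver φ a p
  | a, j :: l, p => (segOver φ a j).tensor (Zover j l p)

lemma segOver_mu {i k j : ℕ} (h : i ≤ k) (h' : k ≤ j) :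
    (segOver φ i j).post (mu Y.X h h') = ((segOver φ i k).tensor (segOver φ k j)).pre (mu X.X h h') := by
  have h1 := Hom.naturality φ (cutOp h h')
  have h2 := Hom.comult φ (op (sg i k)) (op (sg k j))
  refine (post_comp _ _ _).trans ?_
  refine (congrArg (fun t => HomOver.post t
    (Functor.OplaxMonoidal.δ Y.X (op (sg i k)) (op (sg k j)))) h1.symm).trans ?_
  refine (pre_post _ _ _).trans ?_
  refine (congrArg (HomOver.pre (X.X.map (cutOp h h'))) h2).trans ?_
  exact (pre_comp _ _ _).symm

lemma segOver_Xmap {f : ℕ → ℕ} (hf : Monotone f) {i j i' j' : ℕ} (hi : i' = f i) (hj : j' = f j) :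
    (segOver φ i' j').post (Xmap Y.X hf hi hj) = (segOver φ i j).pre (Xmap X.X hf hi hj) :=
  (Hom.naturality φ _).symm

lemma Zover_cut {a k p : ℕ} {l : List ℕ} (h : a ≤ k) (hl : Ok k l p) :
    (Zover φ a l p).post (cut Y.X h hl) =
      ((segOver φ a k).tensor (Zover φ k l p)).pre (cut X.X h hl) := by
  cases l with
  | nil => exact segOver_mu φ h hl
  | cons j l =>
    refine (post_comp _ _ _).trans ?_
    refine (congrArg (fun t => HomOver.post t (assocHom _ _ _))
      (post_right (segOver φ a j) (Zover φ j l p) (mu Y.X h hl.1))).trans ?_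
    rw [segOver_mu φ h hl.1]
    refine (congrArg (fun t => HomOver.post t (assocHom _ _ _))
      (pre_right _ (Zover φ j l p) (mu X.X h hl.1)).symm).trans ?_
    refine (pre_post _ _ _).trans ?_
    refine (congrArg (HomOver.pre (tmap (mu X.X h hl.1) (𝟙 _))) (assoc_tensor _ _ _)).trans ?_
    exact (pre_comp _ _ _).symm

lemma Zover_refine {a p : ℕ} {l m : List ℕ} (h : l.Sublist m) (hm : Ok a m p) :
    (Zover φ a l p).post (refineMap Y.X h hm) = (Zover φ a m p).pre (refineMap X.X h hm) := by
  induction m generalizing l a with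
  | nil =>
    obtain rfl := List.sublist_nil.mp h
    exact (post_id _).trans (pre_id _).symm
  | cons k m ih =>
    rcases headNe_or k l with hl | ⟨l, rfl⟩
    · rw [refine_of_ne _ hl, refine_of_ne _ hl]
      refine (post_comp _ _ _).trans ?_
      rw [Zover_cut]
      refine (pre_post _ _ _).trans ?_
      refine (congrArg (HomOver.pre (cut X.X hm.1 _))
        (post_left (segOver φ a k) (Zover φ k l p) (refineMap Y.X (hl.sublist h) hm.2))).trans ?_
      rw [ih]
      refine (congrArg (HomOver.pre (cut X.X hm.1 _))
        (pre_left (segOver φ a k) (Zover φ k m p) (refineMap X.X (hl.sublist h) hm.2)).symm).trans ?_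
      exact (pre_comp _ _ _).symm
    · rw [refine_self_cons, refine_self_cons]
      refine (post_left (segOver φ a k) (Zover φ k l p) _).trans ?_
      rw [ih]
      exact (pre_left (segOver φ a k) (Zover φ k m p) _).symm

lemma Zover_Zmap {f : ℕ → ℕ} (hf : Monotone f) {l l' : List ℕ} {a a' p p' : ℕ}
    (ha : a' = f a) (hl : l' = l.map f) (hp : p' = f p) :
    (Zover φ a' l' p').post (Zmap Y.X hf ha hl hp) = (Zover φ a l p).pre (Zmap X.X hf ha hl hp) := by
  induction l generalizing l' a a' with
  | nil =>
    obtain rfl : l' = [] := hl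
    exact segOver_Xmap φ hf ha hp
  | cons j l ih =>
    cases l' with
    | nil => simp at hl
    | cons j' l' =>
      rw [Zmap_cons, Zmap_cons]
      refine (post_tensor _ _ (segOver φ a' j') (Zover φ j' l' p')).symm.trans ?_
      rw [segOver_Xmap, ih]
      exact pre_tensor _ _ (segOver φ a j) (Zover φ j l p)

lemma Zover_necMap {N M : Nec} (f : N ⟶ M) :
    (Zover φ 0 M.joints M.p).post (necMap Y.X f) = (Zover φ 0 N.joints N.p).pre (necMap X.X f) := by
  rw [necMap, necMap, post_comp, Zover_refine, pre_post, Zover_Zmap, pre_comp]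

/-- The natural transformation `X_•(a, b) ⟶ Y_•(φ a, φ b)` induced by a templicial morphism. -/
def necHom (a b : X.S) : X.nec a b ⟶ Y.nec (vmap φ a) (vmap φ b) where
  app N := (Zover φ 0 N.unop.joints N.unop.p).app a b
  naturality _ _ f := (congrArg (fun t => t.app a b) (Zover_necMap φ f.unop)).symm

end TempObj

end TempNec

section QuasiCategories

open Simplicial

variable {V : Type w} [Category.{u} V] [MonoidalCategory V] [SymmetricCategory V]
  [MonoidalClosed V] [HasColimits V]

variable (V) in
/-- The free templicial object on an inner horn. -/
def freeHorn (n : ℕ) (i : Fin (n + 3)) : TempObj V :=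
  (freeFunctor V).obj (Λ[n + 2, i] : SSet.{u})

variable (V) in
/-- The free templicial object on a standard simplex. -/
def freeSimplex (n : ℕ) : TempObj V := (freeFunctor V).obj (Δ[n + 2] : SSet.{u})

variable (V) in
/-- The templicial morphism induced by the inclusion of a horn. -/
def freeHornInclusion (n : ℕ) (i : Fin (n + 3)) : freeHorn V n i ⟶ freeSimplex V n :=
  (freeFunctor V).map Λ[n + 2, i].ι

variable (V) in
/-- The vertex `k` of the horn, as a vertex of the free templicial object. -/
def hornVertex (n : ℕ) (i k : Fin (n + 3)) : (freeHorn V n i).S :=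
  SSet.horn.const.{u} n i k (op ⦋0⦌)

/-- A functor on the opposite of the category of necklaces lifts inner horns if, for `0 < i < n`,
every morphism to it from the value at `(0, n)` of the free templicial object on the horn
`Λ[n, i]` extends to that on the simplex `Δ[n]`. -/
def LiftsInnerHorns (Y : Necᵒᵖ ⥤ V) : Prop :=
  ∀ ⦃n : ℕ⦄ ⦃i : Fin (n + 3)⦄, 0 < i → i < Fin.last (n + 2) →
    ∀ σ₀ : (freeHorn V n i).nec (hornVertex V n i 0) (hornVertex V n i (Fin.last (n + 2))) ⟶ Y,
      ∃ σ, σ₀ = TempObj.necHom (freeHornInclusion V n i) _ _ ≫ σ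

/-- Quasi-categories in `V`. -/
def TempObj.IsQuasicategory (X : TempObj V) : Prop :=
  ∀ a b : X.S, LiftsInnerHorns (X.nec a b)

end QuasiCategories

end Templ

end

/-! The implication. A map from a simplicial set to the underlying simplicial set of `X` transposes
to a templicial morphism out of the free object (`transpose`, `map_comp_transpose`), so an inner
horn is a morphism `φ` from the free object on Λ^N_i to `X`. A morphism out of the free object on
Δ^N is controlled by the segments {a, ..., b}: every simplex is a restriction of the segment between
its end vertices (`res_intoSeg_segment`), and elements x_{ab} of X_{b-a}(v_a, v_b) assemble to a
morphism as soon as cutting x_{ab} at k gives the pair of x_{ak} and x_{kb}, and each x_{aa} lies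
over the unit (`ofSegments`).

Every segment other than {0, ..., N} omits 0 or N, hence lies in the horn and has a value under `φ`.
What is missing is one element y of X_N(φ0, φN) whose cut at each 0 < k < N is the pair of the
values of `φ` at {0, ..., k} and {k, ..., N}. The quasi-category condition extends the
transformation induced by `φ` to some `s` on the necklaces of Δ^N, and y is the value of `s` at the
top simplex, in the necklace with one bead. Naturality of `s` for the inclusion of the wedge of two
simplices computes the cut of y as the value of `s` at a pair of faces of the horn, where `s` agrees
with `φ` (`simpleComp_mu`, `comp_simpleComp_mu`). Cuts at the ends are forced by the counit
(`comp_mu_left`, `comp_mu_right`). The morphism so obtained restricts to `φ`: a simplex of the horn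
that does not run from 0 to N restricts a proper segment, and for one that does, naturality of `s`
on single beads applies (`exists_extension_of_nec`).

The failure of the converse. An underlying simplex only sees elements, that is, maps out of the
tensor unit, whereas necklace lifting tests all of the objects X_n(a, b). Take a frame as a thin
category, with meet as tensor product; all diagrams commute. A reflexive relation R with values in
the frame gives a templicial object with X_n(a, b) = R(a, b) for n > 0 (`FrameRel.nerve`);
reflexivity supplies the comultiplication, and no transitivity is imposed. If R(a, b) = ⊤ only when
a = b, then the edges of the underlying simplicial set are constant and every horn has a constant
filler. If moreover the join over c of R(a, c) ⊓ R(c, b) is ⊤ for some a, b with R(a, b) ≠ ⊤, then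
lifting fails already for Λ^2_1: a necklace with an inner joint has value ⊤ in the nerve, one
without has the initial object as value in the horn, so the horn maps to the nerve, but an extension
would force R(a, b) = ⊤. In `diamond`, ⊤ is a join of two proper subsets {i}, each reached through
its own intermediate vertex. -/

noncomputable section

namespace Templ

/-! ### Templicial morphisms out of a free templicial object. -/

section FreeMorphisms

open Simplicial VQuiv Functor.OplaxMonoidal

variable {V : Type w} [Category.{u} V] [MonoidalCategory V] [SymmetricCategory V]
  [MonoidalClosed V] [HasColimits V]

/-- Meant to be applied as a term: the objects of `free K` and those of `freeQ` agree only after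
unfolding, which unification sees and rewriting does not. -/
lemma comp_comp_eq_of_eq {C : Type w} [Category.{u} C] {A B D E : C} {f : A ⟶ B} {g : B ⟶ D}
    {h : A ⟶ D} (e : f ≫ g = h) (k : D ⟶ E) : f ≫ g ≫ k = h ≫ k := by
  rw [← e, Category.assoc]

namespace VQuiv

variable {S : Type u}

/-- The identification of objects of edges between equal vertices. -/
def castHom (Q : VQuiv V S) {a a' b b' : S} (h : a = a') (h' : b = b') : Q a b ⟶ Q a' b' :=
  eqToHom (by rw [h, h'])

lemma castHom_rfl (Q : VQuiv V S) {a b : S} (h : a = a) (h' : b = b) :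
    castHom Q h h' = 𝟙 (Q a b) := rfl

lemma castHom_trans (Q : VQuiv V S) {a a' a'' b b' b'' : S} (h : a = a') (h' : b = b')
    (k : a' = a'') (k' : b' = b'') :
    castHom Q h h' ≫ castHom Q k k' = castHom Q (h.trans k) (h'.trans k') := by
  subst h h' k k'
  exact Category.id_comp _

lemma castHom_naturality {Q P : VQuiv V S} (f : Q ⟶ P) {a a' b b' : S} (h : a = a')
    (h' : b = b') : castHom Q h h' ≫ f.app a' b' = f.app a b ≫ castHom P h h' := by
  subst h h'
  exact (Category.id_comp _).trans (Category.comp_id _).symm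

/-- The middle vertex moves as well, but it only indexes a summand of the coproduct and so leaves no
trace on the right. -/
lemma pairEl_castHom {Q P : VQuiv V S} {a a' b b' c c' : S} (x : 𝟙_ V ⟶ Q a c)
    (y : 𝟙_ V ⟶ P c b) (h : a = a') (h' : b = b') (k : c = c') :
    pairEl (x ≫ castHom Q h k) (y ≫ castHom P k h') =
      pairEl x y ≫ castHom (tensor Q P) h h' := by
  subst h h' k
  rw [castHom_rfl, castHom_rfl, castHom_rfl, Category.comp_id, Category.comp_id, Category.comp_id]

lemma unitInc_castHom {a a' b b' : S} (e : a = b) (h : a = a') (h' : b = b') :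
    unitInc e ≫ castHom (unit : VQuiv V S) h h' = unitInc (h.symm.trans (e.trans h')) := by
  subst h h'
  exact Category.comp_id _

end VQuiv

namespace TempObj

variable {K : SSet.{u}} {X : TempObj V}

/-- The image of a simplex under a templicial morphism. -/
def elMap (φ : free K ⟶ X) {n : FinInt} (σ : K _⦋n.len⦌) {a b : K _⦋0⦌} (ha : vtx K σ 0 = a)
    (hb : vtx K σ n.len = b) : 𝟙_ V ⟶ X.X.obj (op n) (vmap φ a) (vmap φ b) :=
  el σ ha hb ≫ (Hom.app φ (op n)).app a b

lemma elMap_congr (φ : free K ⟶ X) {n : FinInt} {σ τ : K _⦋n.len⦌} (h : σ = τ) {a b : K _⦋0⦌}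
    (ha : vtx K σ 0 = a) (hb : vtx K σ n.len = b) :
    elMap φ σ ha hb = elMap φ τ (h ▸ ha) (h ▸ hb) := by
  subst h
  rfl

/-- This and the next two lemmas are the axioms of a templicial morphism read on generators; they
match the hypotheses `ht`, `hδ` and `hη` of `freeHom`. -/
lemma elMap_map (φ : free K ⟶ X) {m n : FinInt} (g : m ⟶ n) (σ : K _⦋n.len⦌) {a b : K _⦋0⦌}
    (ha : vtx K σ 0 = a) (hb : vtx K σ n.len = b) (ha' : vtx K (res K (toΔ g) σ) 0 = a)
    (hb' : vtx K (res K (toΔ g) σ) m.len = b) :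
    elMap φ σ ha hb ≫ (X.X.map g.op).app _ _ = elMap φ (res K (toΔ g) σ) ha' hb' := by
  have h := congrArg (fun t => el σ ha hb ≫ t.app a b) (Hom.naturality φ g.op)
  refine (Category.assoc _ _ _).trans (h.symm.trans ?_)
  exact comp_comp_eq_of_eq (el_freeMap g σ ha hb) _

lemma elMap_δ (φ : free K ⟶ X) {m n : FinInt} (σ : K _⦋(m ⊗ n).len⦌) {a b c : K _⦋0⦌}
    (ha : vtx K σ 0 = a) (hb : vtx K σ (m ⊗ n).len = b) (ha' : vtx K (res K (frontΔ m n) σ) 0 = a)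
    (hc : vtx K (res K (frontΔ m n) σ) m.len = c) (hc' : vtx K (res K (backΔ m n) σ) 0 = c)
    (hb' : vtx K (res K (backΔ m n) σ) n.len = b) :
    elMap φ σ ha hb ≫ (δ X.X (op m) (op n)).app _ _ =
      pairEl (elMap φ (res K (frontΔ m n) σ) ha' hc) (elMap φ (res K (backΔ m n) σ) hc' hb') := by
  have h := congrArg (fun t => el σ ha hb ≫ t.app a b) (Hom.comult φ (op m) (op n))
  refine (Category.assoc _ _ _).trans (h.trans ?_)
  refine (comp_comp_eq_of_eq (el_freeComul σ ha hb) _).trans ?_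
  refine (pairEl_tensor _ _ (Hom.app φ (op m)) (Hom.app φ (op n))).trans ?_
  -- The comultiplication of `free K` lands in the summand of the vertex `m` of `σ`, and `c` is that
  -- vertex.
  obtain rfl : vtx K σ m.len = c := by rw [← hc, vtx_res, natΔ_frontΔ le_rfl]
  rfl

lemma elMap_η (φ : free K ⟶ X) (σ : K _⦋(𝟙_ FinInt).len⦌) {a b : K _⦋0⦌}
    (ha : vtx K σ 0 = a) (hb : vtx K σ (𝟙_ FinInt).len = b) :
    elMap φ σ ha hb ≫ (η X.X).app _ _ = unitInc (congrArg (vmap φ) (ha.symm.trans hb)) := by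
  have h := congrArg (fun t => el σ ha hb ≫ t.app a b) (Hom.counit φ)
  refine (Category.assoc _ _ _).trans (h.trans ?_)
  refine (comp_comp_eq_of_eq (el_freeCounit σ ha hb) _).trans ?_
  exact HomOver.unitInc_unit _ _

/-- The templicial morphism from a free templicial object given by the images of the simplices. -/
def freeHom (f : K _⦋0⦌ → X.S)
    (t : ∀ (n : FinInt) (σ : K _⦋n.len⦌) (a b : K _⦋0⦌) (_ : vtx K σ 0 = a)
      (_ : vtx K σ n.len = b), 𝟙_ V ⟶ X.X.obj (op n) (f a) (f b))
    (ht : ∀ {m n : FinInt} (g : m ⟶ n) (σ : K _⦋n.len⦌) (a b : K _⦋0⦌) (ha : vtx K σ 0 = a)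
      (hb : vtx K σ n.len = b) (ha' : vtx K (res K (toΔ g) σ) 0 = a)
      (hb' : vtx K (res K (toΔ g) σ) m.len = b),
      t n σ a b ha hb ≫ (X.X.map g.op).app _ _ = t m (res K (toΔ g) σ) a b ha' hb')
    (hδ : ∀ (m n : FinInt) (σ : K _⦋(m ⊗ n).len⦌) (a b c : K _⦋0⦌) (ha : vtx K σ 0 = a)
      (hb : vtx K σ (m ⊗ n).len = b) (ha' : vtx K (res K (frontΔ m n) σ) 0 = a)
      (hc : vtx K (res K (frontΔ m n) σ) m.len = c) (hc' : vtx K (res K (backΔ m n) σ) 0 = c)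
      (hb' : vtx K (res K (backΔ m n) σ) n.len = b),
      t (m ⊗ n) σ a b ha hb ≫ (δ X.X (op m) (op n)).app _ _ =
        pairEl (t m (res K (frontΔ m n) σ) a c ha' hc) (t n (res K (backΔ m n) σ) c b hc' hb'))
    (hη : ∀ (σ : K _⦋(𝟙_ FinInt).len⦌) (a b : K _⦋0⦌) (ha : vtx K σ 0 = a)
      (hb : vtx K σ (𝟙_ FinInt).len = b),
      t (𝟙_ FinInt) σ a b ha hb ≫ (η X.X).app _ _ = unitInc (congrArg f (ha.symm.trans hb))) :
    free K ⟶ X :=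
  show Hom (free K) X from
  { base := f
    app := fun n => ⟨fun a b => freeDesc fun σ ha hb => t n.unop σ a b ha hb⟩
    naturality := fun {m n} g => by
      ext a b
      refine free_ext fun σ ha hb => ?_
      have ha' : vtx K (res K (toΔ g.unop) σ) 0 = a := by
        rw [vtx_res, natΔ_toΔ, FinInt.nat_zero, ha]
      have hb' : vtx K (res K (toΔ g.unop) σ) n.unop.len = b := by
        rw [vtx_res, natΔ_toΔ, FinInt.nat_last g.unop rfl, hb]
      refine (comp_comp_eq_of_eq (el_freeMap g.unop σ ha hb) _).trans ?_
      refine ((el_freeDesc (fun σ ha hb => t n.unop σ a b ha hb) _ ha' hb').trans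
        (ht g.unop σ a b ha hb ha' hb').symm).trans ?_
      exact (comp_comp_eq_of_eq (el_freeDesc (fun σ ha hb => t m.unop σ a b ha hb) σ ha hb) _).symm
    comult := fun m n => by
      ext a b
      refine free_ext fun σ ha hb => ?_
      -- The same simplex, typed over `m.unop ⊗ n.unop`, which is `(m ⊗ n).unop` by definition.
      let σ' : K _⦋(m.unop ⊗ n.unop).len⦌ := σ
      refine (comp_comp_eq_of_eq
        (el_freeDesc (fun σ ha hb => t (m ⊗ n).unop σ a b ha hb) σ ha hb) _).trans ?_
      have hc : vtx K (res K (frontΔ m.unop n.unop) σ) m.unop.len = vtx K σ m.unop.len := by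
        rw [vtx_res, natΔ_frontΔ le_rfl]
      have hc' : vtx K (res K (backΔ m.unop n.unop) σ) 0 = vtx K σ m.unop.len := by
        rw [vtx_res, natΔ_backΔ (Nat.zero_le _), Nat.add_zero]
      refine (hδ m.unop n.unop σ a b _ ha hb (by rw [vtx_res, natΔ_frontΔ (Nat.zero_le _), ha])
        hc hc' (by rw [vtx_res, natΔ_backΔ le_rfl, ← tensor_len]; exact hb)).trans ?_
      refine Eq.trans ?_ ((comp_comp_eq_of_eq (el_freeComul σ ha hb) _).trans
        (pairEl_tensor _ _ _ _)).symm
      exact (congrArg₂ pairEl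
        (el_freeDesc (fun σ ha hb => t m.unop σ a (vtx K σ' m.unop.len) ha hb) _ _ hc)
        (el_freeDesc (fun σ ha hb => t n.unop σ (vtx K σ' m.unop.len) b ha hb) _ hc' _)).symm
    counit := by
      ext a b
      refine free_ext fun σ ha hb => ?_
      refine (comp_comp_eq_of_eq
        (el_freeDesc (fun σ ha hb => t (𝟙_ FinInt) σ a b ha hb) σ ha hb) _).trans ?_
      refine (hη σ a b ha hb).trans ?_
      exact ((comp_comp_eq_of_eq (el_freeCounit σ ha hb) _).trans
        (HomOver.unitInc_unit _ _)).symm }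

lemma elMap_freeHom {f : K _⦋0⦌ → X.S} {t} {ht} {hδ} {hη} {n : FinInt} (σ : K _⦋n.len⦌)
    {a b : K _⦋0⦌} (ha : vtx K σ 0 = a) (hb : vtx K σ n.len = b) :
    elMap (freeHom (X := X) f t ht hδ hη) σ ha hb = t n σ a b ha hb :=
  el_freeDesc (fun σ ha hb => t n σ a b ha hb) σ ha hb

/-- The maps of vertices are only pointwise equal, so the elements live in different objects until
transported; once the maps are identified, the transport is an identity. -/
lemma hom_ext_el {φ ψ : free K ⟶ X} (h0 : ∀ a : K _⦋0⦌, vmap φ a = vmap ψ a)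
    (h : ∀ (n : FinInt) (σ : K _⦋n.len⦌) (a b : K _⦋0⦌) (ha : vtx K σ 0 = a)
      (hb : vtx K σ n.len = b),
      elMap φ σ ha hb ≫ castHom _ (h0 a) (h0 b) = elMap ψ σ ha hb) : φ = ψ := by
  obtain ⟨f, α, p₁, p₂, p₃⟩ := φ
  obtain ⟨g, β, q₁, q₂, q₃⟩ := ψ
  obtain rfl : f = g := funext h0
  refine Hom.ext' fun n => ?_
  ext a b
  refine free_ext fun σ ha hb => ?_
  exact (Category.comp_id _).symm.trans (h n.unop σ a b ha hb)

end TempObj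

end FreeMorphisms

/-! ### Transposing a simplicial map to a templicial morphism. -/

section Transpose

open Simplicial VQuiv Functor.OplaxMonoidal

variable {V : Type w} [Category.{u} V] [MonoidalCategory V] [SymmetricCategory V]
  [MonoidalClosed V] [HasColimits V]

namespace TempObj

variable {K L : SSet.{u}} {X : TempObj V}

/-- Replaces morphism, simplex and end vertices all at once; replacing them one by one would break
the types of the others. -/
lemma elMap_castHom {φ ψ : free K ⟶ X} (h : φ = ψ) {n : FinInt} {σ τ : K _⦋n.len⦌} (h' : σ = τ)
    {a b a' b' : K _⦋0⦌} (ha : vtx K σ 0 = a) (hb : vtx K σ n.len = b) (ha' : vtx K τ 0 = a')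
    (hb' : vtx K τ n.len = b') {x y : X.S} (hx : vmap φ a = x) (hy : vmap φ b = y)
    (hx' : vmap ψ a' = x) (hy' : vmap ψ b' = y) :
    elMap φ σ ha hb ≫ castHom _ hx hy = elMap ψ τ ha' hb' ≫ castHom _ hx' hy' := by
  subst h h' ha hb ha' hb' hx hy
  rfl

lemma elMap_comp (f : K ⟶ L) (φ : free L ⟶ X) {n : FinInt} (σ : K _⦋n.len⦌) {a b : K _⦋0⦌}
    (ha : vtx K σ 0 = a) (hb : vtx K σ n.len = b) :
    elMap ((freeFunctor V).map f ≫ φ) σ ha hb = elMap φ (n := n) (f.app _ σ)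
      (a := f.app _ a) (b := f.app _ b) (by rw [← vtx_app, ha]) (by rw [← vtx_app, hb]) :=
  comp_comp_eq_of_eq (C := V) (el_freeOver f n σ ha hb) _

/-- The nondegenerate simplex of dimension `n` of the standard simplex. -/
def topSimplex (n : ℕ) : (Δ[n] : SSet.{u}) _⦋n⦌ := SSet.stdSimplex.objEquiv.symm (𝟙 _)

/-- Both sides correspond to `f` itself under the Yoneda description of the simplices of Δ^n. -/
lemma map_topSimplex {m n : ℕ} (f : ⦋m⦌ ⟶ ⦋n⦌) :
    (SSet.stdSimplex.{u}.map f).app _ (topSimplex m) = res Δ[n] f (topSimplex n) := by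
  refine SSet.stdSimplex.objEquiv.injective ?_
  exact (Category.id_comp f).trans (Category.comp_id f).symm

lemma res_topSimplex {m n : ℕ} (τ : (Δ[n] : SSet.{u}) _⦋m⦌) :
    res Δ[n] (SSet.stdSimplex.objEquiv τ) (topSimplex n) = τ := by
  refine SSet.stdSimplex.objEquiv.injective ?_
  exact Category.comp_id (SSet.stdSimplex.objEquiv τ : ⦋m⦌ ⟶ ⦋n⦌)

/-- A simplex of the underlying simplicial set, as a templicial morphism. -/
def simplexHom (α : K ⟶ X.underlying) {n : ℕ} (σ : K _⦋n⦌) : free (Δ[n] : SSet.{u}) ⟶ X :=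
  α.app (op ⦋n⦌) σ

/-- Naturality of `α`, since the underlying simplicial set restricts by precomposition. -/
lemma simplexHom_res (α : K ⟶ X.underlying) {m n : ℕ} (f : ⦋m⦌ ⟶ ⦋n⦌) (σ : K _⦋n⦌) :
    simplexHom α (res K f σ) = (freeFunctor V).map (SSet.stdSimplex.map f) ≫ simplexHom α σ :=
  NatTrans.naturality_apply α f.op σ

/-- The map of vertices of the transpose of a simplicial map. -/
def transposeBase (α : K ⟶ X.underlying) (a : K _⦋0⦌) : X.S :=
  vmap (simplexHom α a) (topSimplex 0)

lemma transposeBase_vtx (α : K ⟶ X.underlying) {n : ℕ} (σ : K _⦋n⦌) (i : ℕ) {a : K _⦋0⦌}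
    (ha : vtx K σ i = a) :
    vmap (simplexHom α σ) (vtx Δ[n] (topSimplex n) i) = transposeBase α a := by
  subst ha
  refine Eq.trans ?_ (congrArg (vmap · (topSimplex 0)) (simplexHom_res α (vertexΔ n i) σ)).symm
  exact congrArg (vmap (simplexHom α σ)) (map_topSimplex (vertexΔ n i)).symm

/-- A face may be taken inside Δ^n or before applying `α`. The compatibility of `transpose` with
restrictions and with the comultiplication reduces to this. -/
lemma elMap_simplexHom_res (α : K ⟶ X.underlying) {m : FinInt} {n : ℕ} (f : ⦋m.len⦌ ⟶ ⦋n⦌)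
    (σ : K _⦋n⦌) {a b : (Δ[n] : SSet.{u}) _⦋0⦌} (ha : vtx Δ[n] (res Δ[n] f (topSimplex n)) 0 = a)
    (hb : vtx Δ[n] (res Δ[n] f (topSimplex n)) m.len = b) {x y : X.S}
    (hx : vmap (simplexHom α σ) a = x) (hy : vmap (simplexHom α σ) b = y)
    (hx' : vmap (simplexHom α (res K f σ)) (vtx Δ[m.len] (topSimplex m.len) 0) = x)
    (hy' : vmap (simplexHom α (res K f σ)) (vtx Δ[m.len] (topSimplex m.len) m.len) = y) :
    elMap (n := m) (simplexHom α σ) (res Δ[n] f (topSimplex n)) ha hb ≫ castHom _ hx hy =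
      elMap (n := m) (simplexHom α (res K f σ)) (topSimplex m.len) rfl rfl ≫
        castHom _ hx' hy' := by
  have h := simplexHom_res α f σ
  -- The morphism occurs in the types of the elements, so it is generalized before the equation is
  -- substituted.
  have key : ∀ (ψ : free (Δ[m.len] : SSet.{u}) ⟶ X)
      (_ : ψ = (freeFunctor V).map (SSet.stdSimplex.map f) ≫ simplexHom α σ)
      (hx' : vmap ψ (vtx Δ[m.len] (topSimplex m.len) 0) = x)
      (hy' : vmap ψ (vtx Δ[m.len] (topSimplex m.len) m.len) = y),
      elMap (n := m) (simplexHom α σ) (res Δ[n] f (topSimplex n)) ha hb ≫ castHom _ hx hy =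
      elMap (n := m) ψ (topSimplex m.len) rfl rfl ≫ castHom _ hx' hy' := by
    rintro _ rfl hx' hy'
    refine Eq.trans ?_ (congrArg (· ≫ _) (elMap_comp _ _ _ _ _)).symm
    exact elMap_castHom rfl (map_topSimplex f).symm _ _ _ _ _ _ _ _
  exact key _ h hx' hy'

/-- The templicial morphism corresponding to a simplicial map to the underlying simplicial set. -/
def transpose (α : K ⟶ X.underlying) : free K ⟶ X :=
  freeHom (transposeBase α)
    (fun n σ _ _ ha hb => elMap (n := n) (simplexHom α σ) (topSimplex n.len) rfl rfl ≫
      castHom _ (transposeBase_vtx α σ 0 ha) (transposeBase_vtx α σ n.len hb))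
    (by
      intro m n g σ a b ha hb ha' hb'
      rw [Category.assoc, castHom_naturality, ← Category.assoc, elMap_map _ g _ rfl rfl
        (by rw [vtx_res, natΔ_toΔ, FinInt.nat_zero])
        (by rw [vtx_res, natΔ_toΔ, FinInt.nat_last g rfl])]
      exact elMap_simplexHom_res α (toΔ g) σ _ _ _ _ _ _)
    (by
      intro m n σ a b c ha hb ha' hc hc' hb'
      -- The front and back faces meet in the vertex `m`, the index of the summand hit by the
      -- comultiplication.
      have hv : vtx Δ[(m ⊗ n).len] (res Δ[(m ⊗ n).len] (frontΔ m n) (topSimplex (m ⊗ n).len)) m.len =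
          vtx Δ[(m ⊗ n).len] (res Δ[(m ⊗ n).len] (backΔ m n) (topSimplex (m ⊗ n).len)) 0 := by
        rw [vtx_res, vtx_res, natΔ_frontΔ le_rfl, natΔ_backΔ (Nat.zero_le _), Nat.add_zero]
      rw [Category.assoc, castHom_naturality, ← Category.assoc, elMap_δ (simplexHom α σ) _ rfl rfl
        (by rw [vtx_res, natΔ_frontΔ (Nat.zero_le _)]) rfl hv.symm
        (by rw [vtx_res, natΔ_backΔ le_rfl, ← tensor_len])]
      refine (pairEl_castHom _ _ _ _ ?_).symm.trans (congrArg₂ pairEl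
        (elMap_simplexHom_res α (frontΔ m n) σ _ _ _ _ _ _)
        (elMap_simplexHom_res α (backΔ m n) σ _ _ _ _ _ _))
      rw [vtx_res, natΔ_frontΔ le_rfl]
      exact transposeBase_vtx α σ m.len (by rw [← hc, vtx_res, natΔ_frontΔ le_rfl]))
    (by
      intro σ a b ha hb
      rw [Category.assoc, castHom_naturality, ← Category.assoc, elMap_η]
      exact unitInc_castHom _ _ _)

/-- The transpose remembers `α`: restricted along the classifying map of `σ` it gives back the
simplex `α σ`. This is the part of the adjunction that turns a templicial extension into a
simplicial one. -/
lemma map_comp_transpose (α : K ⟶ X.underlying) {n : ℕ} (σ : K _⦋n⦌) :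
    (freeFunctor V).map (SSet.yonedaEquiv.symm σ) ≫ transpose α = simplexHom α σ := by
  -- By Yoneda, the classifying map of `σ` restricts `σ` along the map corresponding to `τ`.
  have h0 : ∀ {m : ℕ} (τ : (Δ[n] : SSet.{u}) _⦋m⦌),
      (SSet.yonedaEquiv.symm σ).app _ τ = res K (SSet.stdSimplex.objEquiv τ) σ := fun _ => rfl
  have h1 : ∀ a : (Δ[n] : SSet.{u}) _⦋0⦌,
      vmap ((freeFunctor V).map (SSet.yonedaEquiv.symm σ) ≫ transpose α) a =
        vmap (simplexHom α σ) a := fun a => by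
    refine (congrArg (vmap · (topSimplex 0))
      (simplexHom_res α (SSet.stdSimplex.objEquiv a) σ)).trans ?_
    exact congrArg (vmap (simplexHom α σ)) ((map_topSimplex _).trans (res_topSimplex a))
  refine hom_ext_el h1 fun m τ a b ha hb => ?_
  refine (congrArg (· ≫ _) ((elMap_comp _ _ _ _ _).trans (elMap_freeHom _ _ _))).trans ?_
  refine (Category.assoc _ _ _).trans ((congrArg (elMap _ _ _ _ ≫ ·)
    (castHom_trans _ _ _ _ _)).trans ?_)
  refine (elMap_simplexHom_res α (SSet.stdSimplex.objEquiv τ) σ (a := a) (b := b)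
    (by rw [res_topSimplex, ha]) (by rw [res_topSimplex, hb]) rfl rfl _ _).symm.trans ?_
  rw [castHom_rfl, Category.comp_id]
  exact elMap_congr _ (res_topSimplex τ) _ _

end TempObj
end Transpose

/-! ### Restriction of a segment {i, ..., j} along a monotone function. -/

section Segments

open Functor.OplaxMonoidal

variable {D : Type w} [Category.{u} D] [MonoidalCategory D] (C : FinIntᵒᵖ ⥤ D) [C.OplaxMonoidal]

/-- The morphism of finite intervals from `n` to the segment from `f 0` to `f n` given by a monotone
function `f`. -/
def intoSeg {f : ℕ → ℕ} (hf : Monotone f) (n : FinInt) {i j : ℕ} (hi : i = f 0)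
    (hj : j = f n.len) : n ⟶ sg i j :=
  segHom (i := 0) (j := n.len) hf hi hj

lemma nat_intoSeg {f : ℕ → ℕ} (hf : Monotone f) {n : FinInt} {i j : ℕ} (hi : i = f 0)
    (hj : j = f n.len) {y : ℕ} (hy : y ≤ n.len) : FinInt.nat (intoSeg hf n hi hj) y = f y - i := by
  refine (nat_segHom hf hi hj hy).trans ?_
  rw [Nat.zero_add, hi]

/-- The action of `C` on `intoSeg`. -/
def Xinto {f : ℕ → ℕ} (hf : Monotone f) (n : FinInt) {i j : ℕ} (hi : i = f 0) (hj : j = f n.len) :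
    Xs C i j ⟶ C.obj (op n) :=
  C.map (intoSeg hf n hi hj).op

/-- The composite is specified by the values of `f'` up to `m.len` only, as beyond them the
extension to natural numbers is arbitrary. -/
lemma Xinto_comp_map {f f' : ℕ → ℕ} (hf : Monotone f) (hf' : Monotone f') {m n : FinInt}
    (g : m ⟶ n) {i j : ℕ} (hi : i = f 0) (hj : j = f n.len) (hi' : i = f' 0) (hj' : j = f' m.len)
    (h : ∀ y ≤ m.len, f' y = f (FinInt.nat g y)) :
    Xinto C hf n hi hj ≫ C.map g.op = Xinto C hf' m hi' hj' := by
  refine (C.map_comp _ _).symm.trans (congrArg C.map (Quiver.Hom.unop_inj ?_))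
  refine FinInt.hom_ext fun y hy => ?_
  refine (FinInt.nat_comp g (intoSeg hf n hi hj) y).trans ?_
  rw [nat_intoSeg hf hi hj (FinInt.nat_le g y), ← h y hy]
  exact (nat_intoSeg hf' hi' hj' hy).symm

/-- Splitting the source at `m` cuts the target segment at the image `k` of `m`: the map is a sum of
its two halves, and the comultiplication is natural. -/
lemma Xinto_comp_δ {f f' f'' : ℕ → ℕ} (hf : Monotone f) (hf' : Monotone f') (hf'' : Monotone f'')
    {m n : FinInt} {i k j : ℕ} (hi : i = f 0) (hj : j = f (m ⊗ n).len) (hi' : i = f' 0)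
    (hk : k = f' m.len) (hk' : k = f'' 0) (hj' : j = f'' n.len)
    (h' : ∀ y ≤ m.len, f' y = f y) (h'' : ∀ y ≤ n.len, f'' y = f (m.len + y))
    (hik : i ≤ k) (hkj : k ≤ j) :
    Xinto C hf (m ⊗ n) hi hj ≫ δ C (op m) (op n) =
      mu C hik hkj ≫ (Xinto C hf' m hi' hk ⊗ₘ Xinto C hf'' n hk' hj') := by
  have key : (intoSeg hf (m ⊗ n) hi hj).op =
      cutOp hik hkj ≫ ((intoSeg hf' m hi' hk).op ⊗ₘ (intoSeg hf'' n hk' hj').op) := by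
    refine Quiver.Hom.unop_inj ?_
    show intoSeg hf (m ⊗ n) hi hj = (intoSeg hf' m hi' hk ⊗ₘ intoSeg hf'' n hk' hj') ≫
        (FinInt.castIso (cut_len hik hkj)).hom
    refine FinInt.hom_ext fun y hy => ?_
    have hy' : y ≤ m.len + n.len := hy
    rw [nat_intoSeg _ _ _ hy, FinInt.nat_comp, FinInt.nat_castIso_hom (FinInt.nat_le _ _)]
    rcases le_total y m.len with hm | hm
    · rw [nat_tensorHom_left _ _ hm, nat_intoSeg _ _ _ hm, h' y hm]
    · have h1 := hf (show 0 ≤ y by omega)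
      have h2 := hf (show m.len ≤ y by omega)
      have h3 := h' m.len le_rfl
      rw [nat_tensorHom_right _ _ hm hy', nat_intoSeg _ _ _ (by omega), h'' _ (by omega),
        Nat.add_sub_cancel' hm, sg_len]
      omega
  rw [Xinto, key, Functor.map_comp, mu, Category.assoc, Category.assoc]
  exact congrArg (C.map (cutOp hik hkj) ≫ ·) (δ_natural C _ _).symm

lemma Xinto_comp_η {f : ℕ → ℕ} (hf : Monotone f) {i : ℕ} (hi : i = f 0)
    (hi' : i = f (𝟙_ FinInt).len) : Xinto C hf (𝟙_ FinInt) hi hi' ≫ η C = eps C i := by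
  refine congrArg (· ≫ η C) (congrArg C.map (Quiver.Hom.unop_inj ?_))
  refine FinInt.hom_ext fun y hy => ?_
  obtain rfl : y = 0 := Nat.le_zero.mp hy
  exact (FinInt.nat_zero _).trans (FinInt.nat_zero _).symm

end Segments

/-! ### Morphisms out of a free simplex from their values at the segments. -/

section OfSegments

open Simplicial VQuiv Functor.OplaxMonoidal

variable {V : Type w} [Category.{u} V] [MonoidalCategory V] [SymmetricCategory V]
  [MonoidalClosed V] [HasColimits V]

lemma natΔ_min {m n : ℕ} (f : ⦋m⦌ ⟶ ⦋n⦌) (i : ℕ) : natΔ f (min i m) = natΔ f i := by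
  simp [natΔ]

/-- The function on natural numbers underlying a simplex of the standard simplex. -/
def simplexFn {N m : ℕ} (τ : (Δ[N] : SSet.{u}) _⦋m⦌) : ℕ → ℕ :=
  natΔ (SSet.stdSimplex.objEquiv τ : ⦋m⦌ ⟶ ⦋N⦌)

/-- The position of a vertex of the standard simplex. -/
def vertexVal {N : ℕ} (a : (Δ[N] : SSet.{u}) _⦋0⦌) : ℕ := simplexFn a 0

lemma simplexFn_mono {N m : ℕ} (τ : (Δ[N] : SSet.{u}) _⦋m⦌) : Monotone (simplexFn τ) :=
  fun _ _ h => natΔ_mono _ h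

lemma simplexFn_le {N m : ℕ} (τ : (Δ[N] : SSet.{u}) _⦋m⦌) (i : ℕ) : simplexFn τ i ≤ N :=
  natΔ_le _ i

lemma simplexFn_res {N m n : ℕ} (f : ⦋m⦌ ⟶ ⦋n⦌) (τ : (Δ[N] : SSet.{u}) _⦋n⦌) (i : ℕ) :
    simplexFn (res Δ[N] f τ) i = simplexFn τ (natΔ f i) :=
  natΔ_comp f _ i

/-- No bound on `i` is needed, since both sides truncate it at `m`. -/
lemma vertexVal_vtx {N m : ℕ} (τ : (Δ[N] : SSet.{u}) _⦋m⦌) (i : ℕ) :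
    vertexVal (vtx Δ[N] τ i) = simplexFn τ i := by
  refine (simplexFn_res (vertexΔ m i) τ 0).trans ?_
  rw [natΔ_vertexΔ]
  exact natΔ_min _ i

lemma simplexFn_ext {N m : ℕ} {τ τ' : (Δ[N] : SSet.{u}) _⦋m⦌}
    (h : ∀ i ≤ m, simplexFn τ i = simplexFn τ' i) : τ = τ' :=
  SSet.stdSimplex.objEquiv.injective (homΔ_ext h)

lemma vertexVal_injective {N : ℕ} : Function.Injective (vertexVal (N := N)) := fun a b h =>
  simplexFn_ext fun i hi => by
    obtain rfl := Nat.le_zero.mp hi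
    exact h

namespace TempObj

variable {X : TempObj V} {N : ℕ} (v : ℕ → X.S)
  (x : ∀ i j, i ≤ j → j ≤ N → (𝟙_ V ⟶ (Xs X.X i j) (v i) (v j)))

/-- The templicial morphism from the free templicial object on a standard simplex given by its
values at the segments `{i, ..., j}`. -/
def ofSegments
    (hmu : ∀ i k j (h : i ≤ k) (h' : k ≤ j) (hj : j ≤ N),
      x i j (h.trans h') hj ≫ (mu X.X h h').app _ _ = pairEl (x i k h (h'.trans hj)) (x k j h' hj))
    (heps : ∀ i (hi : i ≤ N), x i i le_rfl hi ≫ (eps X.X i).app _ _ = unitInc rfl) :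
    free (Δ[N] : SSet.{u}) ⟶ X :=
  freeHom (fun a => v (vertexVal a))
    -- The value at `τ` is forced by naturality: restrict the element of the segment from the first
    -- to the last vertex of `τ`. The hypotheses `hmu` and `heps` are then what the comultiplication
    -- and the counit ask for.
    (fun n τ a b ha hb => x (vertexVal a) (vertexVal b)
      (by subst ha hb; rw [vertexVal_vtx, vertexVal_vtx]; exact simplexFn_mono τ (Nat.zero_le _))
      (simplexFn_le _ _) ≫ (Xinto X.X (simplexFn_mono τ) n (by rw [← ha, vertexVal_vtx])
        (by rw [← hb, vertexVal_vtx])).app _ _)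
    (by
      intro m n g τ a b ha hb ha' hb'
      rw [Category.assoc, ← comp_app, Xinto_comp_map]
      intro y _
      exact simplexFn_res _ _ _)
    (by
      intro m n τ a b c ha hb ha' hc hc' hb'
      have hik : vertexVal a ≤ vertexVal c := by
        subst ha' hc
        rw [vertexVal_vtx, vertexVal_vtx]
        exact simplexFn_mono _ (Nat.zero_le _)
      have hkj : vertexVal c ≤ vertexVal b := by
        subst hc' hb'
        rw [vertexVal_vtx, vertexVal_vtx]
        exact simplexFn_mono _ (Nat.zero_le _)
      rw [Category.assoc, ← comp_app, Xinto_comp_δ X.X (k := vertexVal c) (simplexFn_mono τ)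
        (simplexFn_mono (res Δ[N] (frontΔ m n) τ)) (simplexFn_mono (res Δ[N] (backΔ m n) τ))
        _ _ (by rw [← ha', vertexVal_vtx]) (by rw [← hc, vertexVal_vtx])
        (by rw [← hc', vertexVal_vtx]) (by rw [← hb', vertexVal_vtx]) _ _ hik hkj, comp_app,
        ← Category.assoc]
      · exact (congrArg (· ≫ _) (hmu _ _ _ hik hkj (simplexFn_le _ _))).trans
          (pairEl_tmap _ _ _ _)
      · intro y hy
        rw [simplexFn_res, natΔ_frontΔ hy]
      · intro y hy
        rw [simplexFn_res, natΔ_backΔ hy])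
    (by
      intro τ a b ha hb
      obtain rfl : a = b := ha.symm.trans hb
      rw [Category.assoc, ← comp_app, Xinto_comp_η]
      exact heps _ _)

variable {v x} {hmu : ∀ i k j (h : i ≤ k) (h' : k ≤ j) (hj : j ≤ N),
      x i j (h.trans h') hj ≫ (mu X.X h h').app _ _ = pairEl (x i k h (h'.trans hj)) (x k j h' hj)}
    {heps : ∀ i (hi : i ≤ N), x i i le_rfl hi ≫ (eps X.X i).app _ _ = unitInc rfl}

lemma elMap_ofSegments {n : FinInt} (τ : (Δ[N] : SSet.{u}) _⦋n.len⦌) {a b : (Δ[N] : SSet.{u}) _⦋0⦌}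
    (ha : vtx Δ[N] τ 0 = a) (hb : vtx Δ[N] τ n.len = b) (h) (h') (hi) (hj) :
    elMap (ofSegments v x hmu heps) τ ha hb = x (vertexVal a) (vertexVal b) h h' ≫
      (Xinto X.X (simplexFn_mono τ) n hi hj).app _ _ :=
  elMap_freeHom _ _ _

lemma comp_app_cancel {S : Type u} {Q P : VQuiv V S} (f : Q ⟶ P) [IsIso f] {a b : S}
    {y z : 𝟙_ V ⟶ Q a b} (h : y ≫ f.app a b = z ≫ f.app a b) : y = z := by
  have h1 : f.app a b ≫ (inv f).app a b = 𝟙 _ := by rw [← comp_app, IsIso.hom_inv_id, id_app]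
  rw [← Category.comp_id y, ← Category.comp_id z, ← h1, reassoc_of% h]

/-- The counit is invertible, so the identity may be checked after applying it to the first factor,
where it is left unitality. Together with the next lemma it leaves only cuts at interior vertices to
be verified. -/
lemma comp_mu_left {i j : ℕ} (h : i ≤ j) {a b : X.S} (x : 𝟙_ V ⟶ (Xs X.X i i) a a)
    (y : 𝟙_ V ⟶ (Xs X.X i j) a b) (hx : x ≫ (eps X.X i).app _ _ = unitInc rfl) :
    y ≫ (mu X.X le_rfl h).app _ _ = pairEl x y := by
  refine comp_app_cancel (eps X.X i ▷ Xs X.X i j) ?_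
  refine (Category.assoc _ _ _).trans ((congrArg (fun t => y ≫ VQuiv.Hom.app t a b)
    (mu_eps_left X.X h)).trans ((leftInv_el y).trans ?_))
  refine Eq.trans ?_ (pairEl_tmap _ _ _ _).symm
  rw [hx, id_app, Category.comp_id]

lemma comp_mu_right {i j : ℕ} (h : i ≤ j) {a b : X.S} (x : 𝟙_ V ⟶ (Xs X.X j j) b b)
    (y : 𝟙_ V ⟶ (Xs X.X i j) a b) (hx : x ≫ (eps X.X j).app _ _ = unitInc rfl) :
    y ≫ (mu X.X h le_rfl).app _ _ = pairEl y x := by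
  refine comp_app_cancel (Xs X.X i j ◁ eps X.X j) ?_
  refine (Category.assoc _ _ _).trans ((congrArg (fun t => y ≫ VQuiv.Hom.app t a b)
    (mu_eps_right X.X h)).trans ((rightInv_el y).trans ?_))
  refine Eq.trans ?_ (pairEl_tmap _ _ _ _).symm
  rw [hx, id_app, Category.comp_id]

end TempObj

end OfSegments

/-! ### Necklaces with one or two beads. -/

section SmallNecklaces

namespace Nec

/-- The necklace with a single bead. -/
def simple (m : ℕ) : Nec where
  p := m
  T := {0, m}
  zero_mem := by simp
  last_mem := by simp
  le := by simp

/-- The necklace with two beads. -/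
def double {k m : ℕ} (h : k ≤ m) : Nec where
  p := m
  T := {0, k, m}
  zero_mem := by simp
  last_mem := by simp
  le := by simp [h]

lemma joints_simple (m : ℕ) : (simple m).joints = [] := by
  refine List.eq_nil_iff_forall_not_mem.mpr fun t ht => ?_
  obtain ⟨h1, h2, h3⟩ := mem_joints.mp ht
  rcases Finset.mem_insert.mp h1 with h | h
  · exact h2 h
  · exact h3 (Finset.mem_singleton.mp h)

/-- Strictness matters: if `k` is an end vertex, the necklace has one bead and no inner joint. -/
lemma joints_double {k m : ℕ} (h0 : 0 < k) (h : k < m) : (double h.le).joints = [k] := by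
  have : ((double h.le).T.erase 0).erase (double h.le).p = {k} := by
    ext t
    simp only [double, Finset.mem_erase, Finset.mem_insert, Finset.mem_singleton]
    omega
  rw [joints, this, Finset.sort_singleton]

/-- The necklace map between single beads given by a morphism of finite intervals. -/
def simpleHom {m n : FinInt} (g : m ⟶ n) : simple m.len ⟶ simple n.len :=
  show Hom _ _ from
  { f := g
    subset := by
      intro t ht
      rcases Finset.mem_insert.mp ht with rfl | h
      · exact Finset.mem_image.mpr ⟨0, (simple m.len).zero_mem, FinInt.nat_zero _⟩
      · rw [Finset.mem_singleton.mp h]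
        exact Finset.mem_image.mpr ⟨m.len, (simple m.len).last_mem, FinInt.nat_last g rfl⟩ }

/-- The inclusion of a wedge of two simplices in a simplex. -/
def doubleHom {k m : ℕ} (h : k ≤ m) : double h ⟶ simple m :=
  show Hom _ _ from
  { f := 𝟙 (⟨m⟩ : FinInt)
    subset := by
      intro t ht
      refine Finset.mem_image.mpr ⟨t, ?_, FinInt.nat_id ((simple m).le t ht)⟩
      rcases Finset.mem_insert.mp ht with rfl | h'
      · exact (double h).zero_mem
      · rw [Finset.mem_singleton.mp h']
        exact (double h).last_mem }

lemma fn_doubleHom {k m : ℕ} (h : k ≤ m) {t : ℕ} (ht : t ≤ m) : fn (doubleHom h) t = t :=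
  FinInt.nat_id ht

end Nec

variable {D : Type w} [Category.{u} D] [MonoidalCategory D] (C : FinIntᵒᵖ ⥤ D)

/-- The tensor product over the empty list of joints. -/
def zNil {l : List ℕ} (h : l = []) (n : FinInt) : Z C 0 l n.len ≅ C.obj (op n) :=
  eqToIso (by subst h; rfl)

/-- The tensor product over a single joint. -/
def zSingle {l : List ℕ} {k : ℕ} (h : l = [k]) (m : ℕ) : Z C 0 l m ≅ Xs C 0 k ⊗ Xs C k m :=
  eqToIso (by subst h; rfl)

variable [C.OplaxMonoidal]

/-- The joints come from sorting a finite set and equal `[]` only propositionally; stated for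
arbitrary lists, the equations can be substituted and the maps unfold. -/
lemma zNil_aux {f : ℕ → ℕ} (hf : Monotone f) {m n : FinInt} (g : m ⟶ n) (hfg : f = FinInt.nat g)
    {l l' l'' : List ℕ} (hl : l = []) (hl'' : l'' = []) (hs : l''.Sublist l')
    (ho : Ok 0 l' n.len) (h0 : 0 = f 0) (hl' : l' = l.map f) (hn : n.len = f m.len) :
    (refineMap C hs ho ≫ Zmap C hf h0 hl' hn) ≫ (zNil C hl m).hom =
      (zNil C hl'' n).hom ≫ C.map g.op := by
  subst hl hl'' hfg
  obtain rfl : l' = [] := hl'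
  refine (Category.comp_id _).trans ((Category.id_comp _).trans (Eq.trans ?_
    (Category.id_comp _).symm))
  refine congrArg C.map (Quiver.Hom.unop_inj (FinInt.hom_ext fun x hx => ?_))
  refine (nat_segHom (i := 0) (j := m.len) hf h0 hn hx).trans ?_
  rw [Nat.zero_add, FinInt.nat_zero, Nat.sub_zero]
  rfl

lemma necMap_simpleHom [IsIso (Functor.OplaxMonoidal.η C)] {m n : FinInt} (g : m ⟶ n) :
    necMap C (Nec.simpleHom g) ≫ (zNil C (Nec.joints_simple m.len) m).hom =
      (zNil C (Nec.joints_simple n.len) n).hom ≫ C.map g.op :=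
  zNil_aux C (Nec.fn_mono (Nec.simpleHom g)) g rfl _ _ _ _ _ _ _

/-- Refining the empty list by a single joint is one cut followed by an identity. -/
lemma zSingle_aux {l l' : List ℕ} {k m : ℕ} (hl : l = []) (hl' : l' = [k]) (hs : l.Sublist l')
    (ho : Ok 0 l' m) (h : k ≤ m) :
    refineMap C hs ho ≫ (zSingle C hl' m).hom =
      (zNil C hl ⟨m⟩).hom ≫ mu C (Nat.zero_le k) h := by
  subst hl hl'
  refine (Category.comp_id _).trans (Eq.trans ?_ (Category.id_comp _).symm)
  exact (congrArg (_ ≫ ·) (MonoidalCategory.whiskerLeft_id _ _)).trans (Category.comp_id _)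

/-- The underlying map of intervals is an identity, so only the comultiplication survives. -/
lemma necMap_doubleHom [IsIso (Functor.OplaxMonoidal.η C)] {k m : ℕ} (h0 : 0 < k) (h : k < m) :
    necMap C (Nec.doubleHom h.le) ≫ (zSingle C (Nec.joints_double h0 h) m).hom =
      (zNil C (Nec.joints_simple m) ⟨m⟩).hom ≫ mu C (Nat.zero_le k) h.le := by
  have hj : (Nec.double h.le).joints = (Nec.double h.le).joints.map (Nec.fn (Nec.doubleHom h.le)) := by
    rw [Nec.joints_double h0 h, List.map_singleton, Nec.fn_doubleHom h.le h.le]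
  have hs : (Nec.simple m).joints.Sublist (Nec.double h.le).joints := by
    rw [Nec.joints_simple]
    exact List.nil_sublist _
  rw [necMap_eq C (Nec.doubleHom h.le) rfl (Nec.fn_mono _) hj hs (Nec.joints_ok _)
    (Nec.fn_zero _) (Nec.fn_last _)]
  refine Eq.trans (congrArg (· ≫ _) ?_) (zSingle_aux C (Nec.joints_simple m)
    (Nec.joints_double h0 h) hs (Nec.joints_ok (Nec.double h.le)) h.le)
  refine (congrArg (_ ≫ ·) (Zmap_id C (Nec.fn_mono (Nec.doubleHom h.le))
    (fun i hi => Nec.fn_doubleHom h.le hi) (Nec.joints_ok (Nec.double h.le)) _ _ _)).trans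
    (Category.comp_id _)

end SmallNecklaces

/-! ### Components of a transformation at one bead and at two beads. -/

section NecComponents

open VQuiv

variable {V : Type w} [Category.{u} V] [MonoidalCategory V] [SymmetricCategory V]
  [MonoidalClosed V] [HasColimits V]

lemma VQuiv.iso_hom_inv_app {S : Type u} {Q P : VQuiv V S} (e : Q ≅ P) (a b : S) :
    e.hom.app a b ≫ e.inv.app a b = 𝟙 _ := by
  rw [← comp_app, e.hom_inv_id, id_app]

lemma VQuiv.iso_inv_hom_app {S : Type u} {Q P : VQuiv V S} (e : Q ≅ P) (a b : S) :
    e.inv.app a b ≫ e.hom.app a b = 𝟙 _ := by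
  rw [← comp_app, e.inv_hom_id, id_app]

namespace TempObj

variable {W X Y : TempObj V}

/-- The component of a transformation at a single bead. -/
def simpleComp {a b : Y.S} {a' b' : X.S} (s : Y.nec a b ⟶ X.nec a' b') (n : FinInt) :
    (Y.X.obj (op n)) a b ⟶ (X.X.obj (op n)) a' b' :=
  (zNil Y.X (Nec.joints_simple n.len) n).inv.app a b ≫ s.app (op (Nec.simple n.len)) ≫
    (zNil X.X (Nec.joints_simple n.len) n).hom.app a' b'

/-- The component of a transformation at two beads. -/
def doubleComp {a b : Y.S} {a' b' : X.S} (s : Y.nec a b ⟶ X.nec a' b') {k m : ℕ} (h0 : 0 < k)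
    (h : k < m) :
    (tensor (Xs Y.X 0 k) (Xs Y.X k m)) a b ⟶ (tensor (Xs X.X 0 k) (Xs X.X k m)) a' b' :=
  (zSingle Y.X (Nec.joints_double h0 h) m).inv.app a b ≫ s.app (op (Nec.double h.le)) ≫
    (zSingle X.X (Nec.joints_double h0 h) m).hom.app a' b'

lemma comp_aux {A A' B B' E E' : V} {e : A' ⟶ A} {s : A ⟶ B} {c : B ⟶ B'} {d : B' ⟶ B} {t : B ⟶ E}
    {f : E ⟶ E'} (h : c ≫ d = 𝟙 _) : e ≫ (s ≫ t) ≫ f = (e ≫ s ≫ c) ≫ d ≫ t ≫ f := by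
  simp only [Category.assoc, reassoc_of% h]

/-- Transports a naturality square along the identifications of the necklace values with X_n or with
a tensor product of two factors. -/
lemma conj_aux {A A' B B' A₁ A₁' B₁ B₁' : V} {e : A ⟶ A'} {e' : A' ⟶ A} {s : A ⟶ B} {c : B ⟶ B'}
    {d : A₁ ⟶ A₁'} {d' : A₁' ⟶ A₁} {s₁ : A₁ ⟶ B₁} {c₁ : B₁ ⟶ B₁'} {u : A ⟶ A₁} {v : B ⟶ B₁}
    {x : A' ⟶ A₁'} {y : B' ⟶ B₁'} (he : e' ≫ e = 𝟙 _) (hd : d ≫ d' = 𝟙 _)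
    (hs : u ≫ s₁ = s ≫ v) (hu : u ≫ d = e ≫ x) (hv : v ≫ c₁ = c ≫ y) :
    (e' ≫ s ≫ c) ≫ y = x ≫ d' ≫ s₁ ≫ c₁ := by
  have h : e' ≫ u = x ≫ d' := by
    rw [← Category.comp_id u, ← hd, reassoc_of% hu, reassoc_of% he]
  rw [← reassoc_of% h, reassoc_of% hs, hv]
  simp

variable {a b : Y.S} {a' b' : X.S} (s : Y.nec a b ⟶ X.nec a' b')

lemma simpleComp_map {m n : FinInt} (g : m ⟶ n) :
    simpleComp s n ≫ (X.X.map g.op).app a' b' = (Y.X.map g.op).app a b ≫ simpleComp s m :=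
  conj_aux (iso_inv_hom_app _ a b) (iso_hom_inv_app _ a b) (s.naturality (Nec.simpleHom g).op)
    (congrArg (VQuiv.Hom.app · a b) (necMap_simpleHom Y.X g))
    (congrArg (VQuiv.Hom.app · a' b') (necMap_simpleHom X.X g))

/-- Naturality at the wedge inclusion `Nec.doubleHom`. This is how a mere transformation on
necklaces knows about comultiplications. -/
lemma simpleComp_mu {k m : ℕ} (h0 : 0 < k) (h : k < m) :
    simpleComp s ⟨m⟩ ≫ (mu X.X h0.le h.le).app a' b' =
      (mu Y.X h0.le h.le).app a b ≫ doubleComp s h0 h :=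
  conj_aux (iso_inv_hom_app _ a b) (iso_hom_inv_app _ a b) (s.naturality (Nec.doubleHom h.le).op)
    (congrArg (VQuiv.Hom.app · a b) (necMap_doubleHom Y.X h0 h))
    (congrArg (VQuiv.Hom.app · a' b') (necMap_doubleHom X.X h0 h))

lemma simpleComp_comp {a'' b'' : W.S} (t : X.nec a' b' ⟶ W.nec a'' b'') (n : FinInt) :
    simpleComp (s ≫ t) n = simpleComp s n ≫ simpleComp t n :=
  comp_aux (iso_hom_inv_app _ a' b')

lemma doubleComp_comp {a'' b'' : W.S} (t : X.nec a' b' ⟶ W.nec a'' b'') {k m : ℕ} (h0 : 0 < k)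
    (h : k < m) : doubleComp (s ≫ t) h0 h = doubleComp s h0 h ≫ doubleComp t h0 h :=
  comp_aux (iso_hom_inv_app _ a' b')

lemma Zover_nil (φ : Y ⟶ X) {l : List ℕ} (h : l = []) (n : FinInt) (a b : Y.S) :
    (zNil Y.X h n).inv.app a b ≫ (Zover φ 0 l n.len).app a b ≫
      (zNil X.X h n).hom.app (vmap φ a) (vmap φ b) = (Hom.app φ (op n)).app a b := by
  subst h
  exact (Category.id_comp _).trans (Category.comp_id _)

lemma Zover_single (φ : Y ⟶ X) {l : List ℕ} {k : ℕ} (h : l = [k]) (m : ℕ) (a b : Y.S) :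
    (zSingle Y.X h m).inv.app a b ≫ (Zover φ 0 l m).app a b ≫
      (zSingle X.X h m).hom.app (vmap φ a) (vmap φ b) =
        ((segOver φ 0 k).tensor (segOver φ k m)).app a b := by
  subst h
  exact (Category.id_comp _).trans (Category.comp_id _)

lemma simpleComp_necHom (φ : Y ⟶ X) (a b : Y.S) (n : FinInt) :
    simpleComp (necHom φ a b) n = (Hom.app φ (op n)).app a b :=
  Zover_nil φ _ n a b

lemma doubleComp_necHom (φ : Y ⟶ X) (a b : Y.S) {k m : ℕ} (h0 : 0 < k) (h : k < m) :
    doubleComp (necHom φ a b) h0 h = ((segOver φ 0 k).tensor (segOver φ k m)).app a b :=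
  Zover_single φ _ m a b

/-- Reads the extension property of `s` on one bead; the next lemma reads it on two. -/
lemma hom_app_of_necHom_eq {φ : Y ⟶ X} {f : Y ⟶ W} {a b : Y.S}
    {s : W.nec (vmap f a) (vmap f b) ⟶ X.nec (vmap φ a) (vmap φ b)}
    (hs : necHom φ a b = necHom f a b ≫ s) (n : FinInt) :
    (Hom.app φ (op n)).app a b = (Hom.app f (op n)).app a b ≫ simpleComp s n := by
  rw [← simpleComp_necHom, hs, simpleComp_comp, simpleComp_necHom]
  rfl

lemma segOver_tensor_app_of_necHom_eq {φ : Y ⟶ X} {f : Y ⟶ W} {a b : Y.S}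
    {s : W.nec (vmap f a) (vmap f b) ⟶ X.nec (vmap φ a) (vmap φ b)}
    (hs : necHom φ a b = necHom f a b ≫ s) {k m : ℕ} (h0 : 0 < k) (h : k < m) :
    ((segOver φ 0 k).tensor (segOver φ k m)).app a b =
      ((segOver f 0 k).tensor (segOver f k m)).app a b ≫ doubleComp s h0 h := by
  rw [← doubleComp_necHom, hs, doubleComp_comp, doubleComp_necHom]

end TempObj

end NecComponents

/-! ### Segments of the standard simplex and their values. -/

section SegmentElements

open Simplicial VQuiv Functor.OplaxMonoidal

variable {V : Type w} [Category.{u} V] [MonoidalCategory V] [SymmetricCategory V]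
  [MonoidalClosed V] [HasColimits V]

namespace TempObj

variable {K : SSet.{u}} {X : TempObj V}

lemma elMap_id {n : FinInt} (σ : K _⦋n.len⦌) {a b : K _⦋0⦌} (ha : vtx K σ 0 = a)
    (hb : vtx K σ n.len = b) : elMap (𝟙 (free K : TempObj V)) σ ha hb = el σ ha hb :=
  Category.comp_id _

/-- The face maps enter only through their values, because j - i and (k - i) + (j - k) are different
expressions and `frontΔ`, `backΔ` do not typecheck here without a cast. -/
lemma elMap_mu (φ : free K ⟶ X) {i k j : ℕ} (h : i ≤ k) (h' : k ≤ j) {σ : K _⦋(sg i j).len⦌}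
    {σ₁ : K _⦋(sg i k).len⦌} {σ₂ : K _⦋(sg k j).len⦌} {f : ⦋(sg i k).len⦌ ⟶ ⦋(sg i j).len⦌}
    {g : ⦋(sg k j).len⦌ ⟶ ⦋(sg i j).len⦌} (hf : ∀ y ≤ k - i, natΔ f y = y)
    (hg : ∀ y ≤ j - k, natΔ g y = k - i + y) (hσ₁ : σ₁ = res K f σ) (hσ₂ : σ₂ = res K g σ)
    {a b c : K _⦋0⦌} (ha : vtx K σ 0 = a) (hb : vtx K σ (sg i j).len = b) (ha' : vtx K σ₁ 0 = a)
    (hc : vtx K σ₁ (sg i k).len = c) (hc' : vtx K σ₂ 0 = c) (hb' : vtx K σ₂ (sg k j).len = b) :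
    elMap φ σ ha hb ≫ (mu X.X h h').app _ _ =
      pairEl (elMap φ σ₁ ha' hc) (elMap φ σ₂ hc' hb') := by
  have hl : (sg i j).len = (sg i k ⊗ sg k j).len := (cut_len h h').symm
  have e1 : res K (frontΔ (sg i k) (sg k j)) (res K (toΔ (FinInt.castIso (cut_len h h')).hom) σ) =
      σ₁ := by
    rw [hσ₁, res_res]
    refine congrArg (fun k => res K k σ) (homΔ_ext fun y hy => ?_)
    rw [natΔ_comp, natΔ_frontΔ hy, natΔ_toΔ, FinInt.nat_castIso_hom, hf y hy]
    rw [tensor_len]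
    omega
  have e2 : res K (backΔ (sg i k) (sg k j)) (res K (toΔ (FinInt.castIso (cut_len h h')).hom) σ) =
      σ₂ := by
    rw [hσ₂, res_res]
    refine congrArg (fun k => res K k σ) (homΔ_ext fun y hy => ?_)
    rw [natΔ_comp, natΔ_backΔ hy, natΔ_toΔ, FinInt.nat_castIso_hom, hg y hy, sg_len]
    rw [tensor_len]
    omega
  have h1 := elMap_map φ (FinInt.castIso (cut_len h h')).hom σ ha hb
    (by rw [vtx_res, natΔ_toΔ, FinInt.nat_zero, ha])
    (by rw [vtx_res, natΔ_toΔ, FinInt.nat_last _ rfl, hb])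
  subst e1 e2
  exact ((Category.assoc _ _ _).symm.trans (congrArg (· ≫ _) h1)).trans (elMap_δ φ _ _ _ _ _ _ _)

lemma elMap_eps (φ : free K ⟶ X) {k : ℕ} (σ : K _⦋(sg k k).len⦌) {a : K _⦋0⦌}
    (ha : vtx K σ 0 = a) (hb : vtx K σ (sg k k).len = a) :
    elMap φ σ ha hb ≫ (eps X.X k).app _ _ = unitInc rfl := by
  have h1 := elMap_map φ (FinInt.castIso (eps_len k)).hom σ ha hb
    (by rw [vtx_res, natΔ_toΔ, FinInt.nat_zero, ha])
    (by rw [vtx_res, natΔ_toΔ, FinInt.nat_last _ rfl, hb])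
  exact ((Category.assoc _ _ _).symm.trans (congrArg (· ≫ _) h1)).trans (elMap_η φ _ _ _)

end TempObj

/-- The face of the standard simplex on the vertices `i, ..., j`. -/
def segment (N i j : ℕ) : (Δ[N] : SSet.{u}) _⦋(sg i j).len⦌ :=
  SSet.stdSimplex.objEquiv.symm (mkΔ (fun y => min (i + y) N)
    (fun _ _ h _ => min_le_min_right _ (Nat.add_le_add_left h i)) (min_le_right _ _))

lemma simplexFn_segment {N i j y : ℕ} (hy : y ≤ (sg i j).len) :
    simplexFn (segment.{u} N i j) y = min (i + y) N :=
  natΔ_mkΔ (g := fun y => min (i + y) N) (hg := fun _ _ h _ =>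
    min_le_min_right _ (Nat.add_le_add_left h i)) (h1 := min_le_right _ _) hy

/-- The inclusion of an initial segment. -/
def segmentFront (i : ℕ) {k j : ℕ} (h' : k ≤ j) : ⦋(sg i k).len⦌ ⟶ ⦋(sg i j).len⦌ :=
  mkΔ _root_.id (fun _ _ h _ => h) (by simp only [sg_len, _root_.id]; omega)

/-- The inclusion of a final segment. -/
def segmentBack {i k j : ℕ} (h : i ≤ k) (h' : k ≤ j) : ⦋(sg k j).len⦌ ⟶ ⦋(sg i j).len⦌ :=
  mkΔ (fun y => k - i + y) (fun _ _ h _ => Nat.add_le_add_left h _) (by simp only [sg_len]; omega)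

lemma segment_front {N i k j : ℕ} (h' : k ≤ j) :
    segment.{u} N i k = res Δ[N] (segmentFront i h') (segment N i j) := by
  refine simplexFn_ext fun y hy => ?_
  have hy' : y ≤ (sg i j).len := hy.trans (Nat.sub_le_sub_right h' i)
  rw [simplexFn_res, segmentFront, natΔ_mkΔ hy, simplexFn_segment hy]
  exact (simplexFn_segment hy').symm

lemma segment_back {N i k j : ℕ} (h : i ≤ k) (h' : k ≤ j) :
    segment.{u} N k j = res Δ[N] (segmentBack h h') (segment N i j) := by
  refine simplexFn_ext fun y hy => ?_
  have hy' : k - i + y ≤ (sg i j).len := by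
    rw [sg_len] at hy ⊢
    omega
  rw [simplexFn_res, segmentBack, natΔ_mkΔ hy, simplexFn_segment hy, simplexFn_segment hy']
  congr 1
  omega

/-- The segments generate the standard simplex under maps that preserve endpoints. -/
lemma res_intoSeg_segment {N : ℕ} {n : FinInt} (τ : (Δ[N] : SSet.{u}) _⦋n.len⦌) {i j : ℕ}
    (hi : i = simplexFn τ 0) (hj : j = simplexFn τ n.len) :
    res Δ[N] (toΔ (intoSeg (simplexFn_mono τ) n hi hj)) (segment N i j) = τ := by
  refine simplexFn_ext fun y hy => ?_
  have h1 := simplexFn_mono τ hy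
  have h2 := simplexFn_mono τ (Nat.zero_le y)
  have h3 := simplexFn_le τ y
  rw [simplexFn_res, natΔ_toΔ, nat_intoSeg _ _ _ hy, simplexFn_segment (by rw [sg_len]; omega)]
  omega

end SegmentElements

/-! ### Filling inner horns in the underlying simplicial set. -/

section HornFilling

open Simplicial VQuiv

/-- A vertex of a horn. -/
def hornPt {n : ℕ} (i : Fin (n + 3)) (k : ℕ) : (Λ[n + 2, i] : SSet.{u}) _⦋0⦌ :=
  ⟨SSet.stdSimplex.objEquiv.symm (vertexΔ (n + 2) k), by rw [SSet.horn_obj_zero]; trivial⟩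

variable {n : ℕ} {i : Fin (n + 3)}

lemma vertexVal_hornPt {k : ℕ} (hk : k ≤ n + 2) : vertexVal (hornPt.{u} i k).1 = k :=
  (natΔ_vertexΔ (n + 2) k).trans (min_eq_left hk)

lemma hornPt_eq {k : ℕ} {a : (Λ[n + 2, i] : SSet.{u}) _⦋0⦌} (h : vertexVal a.1 = k) :
    hornPt i k = a := by
  refine Subtype.ext (vertexVal_injective ((vertexVal_hornPt ?_).trans h.symm))
  rw [← h]
  exact simplexFn_le _ _

lemma coe_stdSimplex_apply {N m : ℕ} (τ : (Δ[N] : SSet.{u}) _⦋m⦌) (y : Fin (m + 1)) :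
    ((τ y : Fin (N + 1)) : ℕ) = simplexFn τ y := by
  have : (⟨min (y : ℕ) m, by omega⟩ : Fin (m + 1)) = y := Fin.ext (by simp; omega)
  exact congrArg (fun z => ((τ z : Fin (N + 1)) : ℕ)) this.symm

/-- Such a simplex misses the first or the last vertex, and for an inner horn neither of these is
the vertex `i`. -/
lemma mem_horn_of_lt (h0 : 0 < i) (hi : i < Fin.last (n + 2)) {m : ℕ}
    {τ : (Δ[n + 2] : SSet.{u}) _⦋m⦌} (h : 0 < simplexFn τ 0 ∨ simplexFn τ m < n + 2) :
    τ ∈ (SSet.horn.{u} (n + 2) i).obj (op ⦋m⦌) := by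
  rw [SSet.mem_horn_iff_notMem_range]
  rcases h with h | h
  · refine ⟨0, h0.ne, ?_⟩
    rintro ⟨y, hy⟩
    have h1 := coe_stdSimplex_apply τ y
    have h2 := simplexFn_mono τ (Nat.zero_le (y : ℕ))
    rw [hy] at h1
    simp only [Fin.val_zero] at h1
    omega
  · refine ⟨Fin.last _, hi.ne', ?_⟩
    rintro ⟨y, hy⟩
    have h1 := coe_stdSimplex_apply τ y
    have h2 := simplexFn_mono τ (show (y : ℕ) ≤ m by omega)
    rw [hy] at h1
    simp only [Fin.val_last] at h1
    omega

/-- The face of a horn on the vertices `a, ..., b`. -/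
def hornSegment (h0 : 0 < i) (hi : i < Fin.last (n + 2)) {a b : ℕ} (h : a ≤ b) (hb : b ≤ n + 2)
    (hne : 0 < a ∨ b < n + 2) : (Λ[n + 2, i] : SSet.{u}) _⦋(sg a b).len⦌ :=
  ⟨segment (n + 2) a b, mem_horn_of_lt h0 hi (by
    rw [simplexFn_segment (Nat.zero_le _), simplexFn_segment le_rfl]
    rw [sg_len]
    omega)⟩

lemma vtx_segment {N a b k c : ℕ} (h : c ≤ (sg a b).len) (hk : a + c = k) (hb : k ≤ N) :
    vertexVal (vtx Δ[N] (segment.{u} N a b) c) = k := by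
  rw [vertexVal_vtx, simplexFn_segment h, hk, min_eq_left hb]

lemma vtx_hornSegment {h0 : 0 < i} {hi : i < Fin.last (n + 2)} {a b : ℕ} {h : a ≤ b}
    {hb : b ≤ n + 2} {hne : 0 < a ∨ b < n + 2} {k c : ℕ} (hc : c ≤ (sg a b).len) (hk : a + c = k) :
    vtx Λ[n + 2, i] (hornSegment.{u} h0 hi h hb hne) c = hornPt i k :=
  (hornPt_eq (vtx_segment hc hk (by rw [sg_len] at hc; omega))).symm

variable {V : Type w} [Category.{u} V] [MonoidalCategory V] [SymmetricCategory V]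
  [MonoidalClosed V] [HasColimits V] {X : TempObj V}

/-- Extension of a family indexed by the segments of `{0, ..., N}` other than the whole of it. -/
def segmentCases {N : ℕ} {v : ℕ → X.S} (x : ∀ a b, a ≤ b → b ≤ N → (0 < a ∨ b < N) →
      (𝟙_ V ⟶ (Xs X.X a b) (v a) (v b))) (y : 𝟙_ V ⟶ (Xs X.X 0 N) (v 0) (v N)) (a b : ℕ)
    (h : a ≤ b) (hb : b ≤ N) : 𝟙_ V ⟶ (Xs X.X a b) (v a) (v b) :=
  if hne : 0 < a ∨ b < N then x a b h hb hne
  else cast (by rw [show a = 0 by omega, show b = N by omega]) y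

lemma segmentCases_of_ne {N : ℕ} {v : ℕ → X.S} (x : ∀ a b, a ≤ b → b ≤ N → (0 < a ∨ b < N) →
      (𝟙_ V ⟶ (Xs X.X a b) (v a) (v b))) (y : 𝟙_ V ⟶ (Xs X.X 0 N) (v 0) (v N)) {a b : ℕ}
    (h : a ≤ b) (hb : b ≤ N) (hne : 0 < a ∨ b < N) : segmentCases x y a b h hb = x a b h hb hne :=
  dif_pos hne

lemma segmentCases_top {N : ℕ} {v : ℕ → X.S} (x : ∀ a b, a ≤ b → b ≤ N → (0 < a ∨ b < N) →
      (𝟙_ V ⟶ (Xs X.X a b) (v a) (v b))) (y : 𝟙_ V ⟶ (Xs X.X 0 N) (v 0) (v N)) :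
    segmentCases x y 0 N (Nat.zero_le _) le_rfl = y :=
  (dif_neg (by omega)).trans (cast_eq _ _)

/-- The end vertices of a given simplex are 0 and `N` only up to a proof, hence the transports on
both sides. -/
lemma segmentCases_top_castHom {N : ℕ} {v : ℕ → X.S} (x : ∀ a b, a ≤ b → b ≤ N →
      (0 < a ∨ b < N) → (𝟙_ V ⟶ (Xs X.X a b) (v a) (v b)))
    (y : 𝟙_ V ⟶ (Xs X.X 0 N) (v 0) (v N)) {a b : ℕ} (ha : a = 0) (hb' : b = N) (h : a ≤ b)
    (hb : b ≤ N) {f : ℕ → ℕ} (hf : Monotone f) (m : FinInt) (hi : a = f 0) (hj : b = f m.len)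
    (hi' : 0 = f 0) (hj' : N = f m.len) {p q : X.S} (hp : v a = p) (hq : v b = q) (hp' : v 0 = p)
    (hq' : v N = q) :
    (segmentCases x y a b h hb ≫ (Xinto X.X hf m hi hj).app _ _) ≫ castHom _ hp hq =
      (y ≫ (Xinto X.X hf m hi' hj').app _ _) ≫ castHom _ hp' hq' := by
  subst ha hb'
  rw [segmentCases_top]

namespace TempObj

/-- If the cut of `y` comes from a pair of elements of `Y`, then so does the cut of its image under
`s`: the two-bead component of `s` restricts to that of `φ` on such pairs. -/
lemma comp_simpleComp_mu {W Y : TempObj V} {φ : Y ⟶ X} {f : Y ⟶ W} {a b c : Y.S}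
    {s : W.nec (vmap f a) (vmap f b) ⟶ X.nec (vmap φ a) (vmap φ b)}
    (hs : necHom φ a b = necHom f a b ≫ s) {k m : ℕ} (h0 : 0 < k) (h : k < m)
    (x : 𝟙_ V ⟶ (Xs Y.X 0 k) a c) (x' : 𝟙_ V ⟶ (Xs Y.X k m) c b)
    (y : 𝟙_ V ⟶ (Xs W.X 0 m) (vmap f a) (vmap f b))
    (hy : y ≫ (mu W.X h0.le h.le).app _ _ =
      pairEl (x ≫ (segOver f 0 k).app a c) (x' ≫ (segOver f k m).app c b)) :
    (y ≫ simpleComp s ⟨m⟩) ≫ (mu X.X h0.le h.le).app _ _ =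
      pairEl (x ≫ (segOver φ 0 k).app a c) (x' ≫ (segOver φ k m).app c b) := by
  refine (Category.assoc _ _ _).trans ((congrArg (y ≫ ·) (simpleComp_mu s h0 h)).trans ?_)
  refine (Category.assoc _ _ _).symm.trans ((congrArg (· ≫ doubleComp s h0 h) hy).trans ?_)
  rw [← pairEl_tensor, ← pairEl_tensor, Category.assoc, segOver_tensor_app_of_necHom_eq hs h0 h]

lemma elMap_freeFunctor_map {K L : SSet.{u}} (ι : K ⟶ L) {n : FinInt} (σ : K _⦋n.len⦌)
    {a b : K _⦋0⦌} (ha : vtx K σ 0 = a) (hb : vtx K σ n.len = b) :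
    elMap ((freeFunctor V).map ι) σ ha hb =
      el (a := ι.app _ a) (b := ι.app _ b) (ι.app _ σ) (by rw [← vtx_app, ha])
        (by rw [← vtx_app, hb]) :=
  el_freeOver ι n σ ha hb

/-- Cut at an interior vertex, the top simplex becomes a pair of proper segments, which lie in the
horn. This provides the hypothesis of `comp_simpleComp_mu`. -/
lemma el_segment_mu (h0 : 0 < i) (hi' : i < Fin.last (n + 2)) {k : ℕ} (hk : 0 < k)
    (hk' : k < n + 2)
    (hv0 : vtx Δ[n + 2] (segment.{u} (n + 2) 0 (n + 2)) 0 = (hornPt.{u} i 0).1)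
    (hvN : vtx Δ[n + 2] (segment.{u} (n + 2) 0 (n + 2)) (sg 0 (n + 2)).len =
      (hornPt.{u} i (n + 2)).1) :
    el (V := V) (n := sg 0 (n + 2)) (segment (n + 2) 0 (n + 2)) hv0 hvN ≫
        (mu (free Δ[n + 2] : TempObj V).X hk.le hk'.le).app _ _ =
      pairEl
        (elMap (n := sg 0 k) (freeHornInclusion V n i)
          (hornSegment h0 hi' hk.le hk'.le (.inr hk')) (vtx_hornSegment (Nat.zero_le _) rfl)
          (vtx_hornSegment le_rfl (Nat.zero_add k)))
        (elMap (n := sg k (n + 2)) (freeHornInclusion V n i)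
          (hornSegment h0 hi' hk'.le le_rfl (.inl hk)) (vtx_hornSegment (Nat.zero_le _) rfl)
          (vtx_hornSegment le_rfl (by rw [sg_len]; omega))) := by
  have h := elMap_mu (𝟙 (free (Δ[n + 2] : SSet.{u}) : TempObj V)) hk.le hk'.le
    (f := segmentFront 0 hk'.le) (g := segmentBack hk.le hk'.le) (fun y hy => natΔ_mkΔ hy)
    (fun y hy => natΔ_mkΔ hy) (segment_front hk'.le) (segment_back hk.le hk'.le) hv0 hvN
    (c := (hornPt.{u} i k).1)
    (congrArg Subtype.val (vtx_hornSegment (h0 := h0) (hi := hi') (h := hk.le) (hb := hk'.le)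
      (hne := .inr hk') (Nat.zero_le _) rfl))
    (congrArg Subtype.val (vtx_hornSegment (h0 := h0) (hi := hi') (h := hk.le) (hb := hk'.le)
      (hne := .inr hk') le_rfl (Nat.zero_add k)))
    (congrArg Subtype.val (vtx_hornSegment (h0 := h0) (hi := hi') (h := hk'.le) (hb := le_rfl)
      (hne := .inl hk) (Nat.zero_le _) rfl))
    (congrArg Subtype.val (vtx_hornSegment (h0 := h0) (hi := hi') (h := hk'.le) (hb := le_rfl)
      (hne := .inl hk) le_rfl (by rw [sg_len]; omega)))
  rw [elMap_id] at h
  refine h.trans (congrArg₂ pairEl ?_ ?_)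
  · exact (elMap_id _ _ _).trans (elMap_freeFunctor_map (V := V) Λ[n + 2, i].ι (n := sg 0 k)
      (a := hornPt i 0) (b := hornPt i k)
      (hornSegment h0 hi' hk.le hk'.le (.inr hk')) _ _).symm
  · exact (elMap_id _ _ _).trans (elMap_freeFunctor_map (V := V) Λ[n + 2, i].ι (n := sg k (n + 2))
      (a := hornPt i k) (b := hornPt i (n + 2))
      (hornSegment h0 hi' hk'.le le_rfl (.inl hk)) _ _).symm

/-- Filling horns: the value at the nondegenerate simplex of the horn extension of a transformation
of functors on necklaces completes the values on the faces of the horn. -/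
theorem exists_extension_of_nec (h0 : 0 < i) (hi' : i < Fin.last (n + 2)) (φ : freeHorn V n i ⟶ X)
    (s : (freeSimplex V n).nec (vmap (freeHornInclusion V n i) (hornPt i 0))
      (vmap (freeHornInclusion V n i) (hornPt i (n + 2))) ⟶
        X.nec (vmap φ (hornPt i 0)) (vmap φ (hornPt i (n + 2))))
    (hs : necHom φ (hornPt i 0) (hornPt i (n + 2)) =
      necHom (freeHornInclusion V n i) (hornPt i 0) (hornPt i (n + 2)) ≫ s) :
    ∃ ψ : freeSimplex V n ⟶ X, freeHornInclusion V n i ≫ ψ = φ := by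
  let x : ∀ a b, a ≤ b → b ≤ n + 2 → (0 < a ∨ b < n + 2) →
      (𝟙_ V ⟶ (Xs X.X a b) (vmap φ (hornPt i a)) (vmap φ (hornPt i b))) := fun a b h hb hne =>
    elMap (n := sg a b) (K := Λ[n + 2, i]) φ (hornSegment h0 hi' h hb hne)
      (vtx_hornSegment (Nat.zero_le _) rfl) (vtx_hornSegment le_rfl (by rw [sg_len]; omega))
  have hv0 : vtx Δ[n + 2] (segment.{u} (n + 2) 0 (n + 2)) 0 = (hornPt.{u} i 0).1 :=
    vertexVal_injective ((vtx_segment (Nat.zero_le _) rfl (Nat.zero_le _)).trans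
      (vertexVal_hornPt (Nat.zero_le _)).symm)
  have hvN : vtx Δ[n + 2] (segment.{u} (n + 2) 0 (n + 2)) (sg 0 (n + 2)).len =
      (hornPt.{u} i (n + 2)).1 :=
    vertexVal_injective ((vtx_segment le_rfl (Nat.zero_add _) le_rfl).trans
      (vertexVal_hornPt le_rfl).symm)
  -- The missing value: the one-bead component of `s` applied to the top simplex.
  let y : 𝟙_ V ⟶ (Xs X.X 0 (n + 2)) (vmap φ (hornPt i 0)) (vmap φ (hornPt i (n + 2))) :=
    el (n := sg 0 (n + 2)) (segment (n + 2) 0 (n + 2)) hv0 hvN ≫ simpleComp s (sg 0 (n + 2))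
  have hε : ∀ a (ha : a ≤ n + 2), segmentCases x y a a le_rfl ha ≫ (eps X.X a).app _ _ =
      unitInc rfl := fun a ha => by
    rw [segmentCases_of_ne x y le_rfl ha (by omega)]
    exact elMap_eps φ _ _ _
  have hμ : ∀ a k b (h : a ≤ k) (h' : k ≤ b) (hb : b ≤ n + 2),
      segmentCases x y a b (h.trans h') hb ≫ (mu X.X h h').app _ _ =
        pairEl (segmentCases x y a k h (h'.trans hb)) (segmentCases x y k b h' hb) := by
    intro a k b h h' hb
    -- Cuts at an end of the segment are settled by the counit, even for the top segment.
    rcases h.eq_or_lt with rfl | hak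
    · exact comp_mu_left h' _ _ (hε a _)
    rcases h'.eq_or_lt with rfl | hkb
    · exact comp_mu_right h _ _ (hε k _)
    rw [segmentCases_of_ne x y h (h'.trans hb) (by omega),
      segmentCases_of_ne x y h' hb (by omega)]
    by_cases hne : 0 < a ∨ b < n + 2
    · rw [segmentCases_of_ne x y (h.trans h') hb hne]
      exact elMap_mu φ h h' (f := segmentFront a h') (g := segmentBack h h')
        (fun y hy => natΔ_mkΔ hy) (fun y hy => natΔ_mkΔ hy)
        (Subtype.ext (segment_front h')) (Subtype.ext (segment_back h h')) _ _ _ _ _ _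
    · obtain rfl : a = 0 := by omega
      obtain rfl : b = n + 2 := by omega
      rw [segmentCases_top]
      exact comp_simpleComp_mu hs hak hkb (el _ _ _) (el _ _ _) _
        (el_segment_mu h0 hi' hak hkb hv0 hvN)
  refine ⟨ofSegments (fun k => vmap φ (hornPt i k)) (segmentCases x y) hμ hε, ?_⟩
  have hbase : ∀ a : (Λ[n + 2, i] : SSet.{u}) _⦋0⦌, vmap φ (hornPt i (vertexVal a.1)) = vmap φ a :=
    fun a => congrArg (vmap φ) (hornPt_eq rfl)
  refine hom_ext_el (K := Λ[n + 2, i]) hbase fun m τ a b ha hb => ?_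
  have hi : vertexVal a.1 = simplexFn τ.1 0 := by
    rw [← ha]
    exact vertexVal_vtx τ.1 0
  have hj : vertexVal b.1 = simplexFn τ.1 m.len := by
    rw [← hb]
    exact vertexVal_vtx τ.1 m.len
  have hab : vertexVal a.1 ≤ vertexVal b.1 := by
    rw [hi, hj]
    exact simplexFn_mono _ (Nat.zero_le _)
  have hbN : vertexVal b.1 ≤ n + 2 := simplexFn_le _ _
  refine (congrArg (· ≫ _) ((elMap_comp Λ[n + 2, i].ι _ τ ha hb).trans
    (elMap_ofSegments τ.1 _ _ hab hbN hi hj))).trans ?_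
  -- If `τ` does not run from 0 to `n + 2`, its enclosing segment lies in the horn and naturality of
  -- `φ` suffices.
  by_cases hne : 0 < vertexVal a.1 ∨ vertexVal b.1 < n + 2
  · have e : res Λ[n + 2, i] (toΔ (intoSeg (simplexFn_mono τ.1) m hi hj))
        (hornSegment h0 hi' hab hbN hne) = τ := Subtype.ext (res_intoSeg_segment τ.1 hi hj)
    rw [segmentCases_of_ne x y hab hbN hne]
    refine (congrArg (· ≫ _) (elMap_map φ (intoSeg (simplexFn_mono τ.1) m hi hj) _ _ _
      (by rw [e, ha]; exact (hornPt_eq rfl).symm) (by rw [e, hb]; exact (hornPt_eq rfl).symm))).trans ?_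
    exact (elMap_castHom rfl e _ _ ha hb _ _ rfl rfl).trans (Category.comp_id _)
  · have h0' : vertexVal a.1 = 0 := by omega
    have hN' : vertexVal b.1 = n + 2 := by omega
    obtain rfl : hornPt i 0 = a := hornPt_eq h0'
    obtain rfl : hornPt i (n + 2) = b := hornPt_eq hN'
    refine (segmentCases_top_castHom x y h0' hN' hab hbN (simplexFn_mono τ.1) m hi hj
      (h0'.symm.trans hi) (hN'.symm.trans hj) _ _ rfl rfl).trans ?_
    refine (Category.comp_id _).trans ((Category.assoc _ _ _).trans ?_)
    -- Now the enclosing segment is the top simplex. Naturality of `s` on single beads replaces the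
    -- restriction of `y` by `s` at `τ`, which is `φ` at `τ` because `τ` is in the horn.
    refine (congrArg (_ ≫ ·) (simpleComp_map s _)).trans ((Category.assoc _ _ _).symm.trans ?_)
    have h3 := hom_app_of_necHom_eq hs m
    refine Eq.trans ?_ (congrArg (_ ≫ ·) h3).symm
    refine Eq.trans (congrArg (· ≫ _) ?_) (Category.assoc _ _ _)
    refine (el_freeMap _ _ _ _).trans (Eq.trans ?_ (el_freeOver Λ[n + 2, i].ι m τ ha hb).symm)
    exact el_congr (res_intoSeg_segment τ.1 (h0'.symm.trans hi) (hN'.symm.trans hj)) _ _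

/-- Lets the lifting condition be used at `hornPt`, which equals `hornVertex` only propositionally.
-/
lemma exists_extension_of_liftsInnerHorns {F : Necᵒᵖ ⥤ V} (hF : LiftsInnerHorns F) (h0 : 0 < i)
    (hi : i < Fin.last (n + 2)) {a b : (freeHorn V n i).S} (ha : a = hornVertex V n i 0)
    (hb : b = hornVertex V n i (Fin.last (n + 2))) (s₀ : (freeHorn V n i).nec a b ⟶ F) :
    ∃ s, s₀ = necHom (freeHornInclusion V n i) a b ≫ s := by
  subst ha hb
  exact hF h0 hi s₀

theorem IsQuasicategory.quasicategory_underlying (hX : X.IsQuasicategory) :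
    SSet.Quasicategory X.underlying where
  hornFilling' n i α h0 hi := by
    have e0 : hornPt i 0 = hornVertex V n i 0 := hornPt_eq rfl
    have eN : hornPt i (n + 2) = hornVertex V n i (Fin.last (n + 2)) := hornPt_eq rfl
    obtain ⟨s, hs⟩ := exists_extension_of_liftsInnerHorns (hX _ _) h0 hi e0 eN
      (necHom (transpose α) (hornPt i 0) (hornPt i (n + 2)))
    obtain ⟨ψ, hψ⟩ := exists_extension_of_nec h0 hi (transpose α) s hs
    -- By definition `ψ` is a simplex of the underlying simplicial set, and this simplex is the
    -- filler.
    refine ⟨SSet.yonedaEquiv.symm (ψ : X.underlying.obj (op ⦋n + 2⦌)), ?_⟩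
    ext m τ
    induction m using Opposite.rec with | op m => ?_
    induction m using SimplexCategory.rec with | _ m => ?_
    refine (map_comp_transpose α τ).symm.trans ?_
    have e : SSet.yonedaEquiv.symm τ ≫ Λ[n + 2, i].ι =
        SSet.stdSimplex.map (SSet.stdSimplex.objEquiv τ.1) := by
      ext
      rfl
    rw [← hψ]
    refine (Category.assoc _ _ _).symm.trans (congrArg (· ≫ ψ) ?_)
    exact ((freeFunctor V).map_comp _ _).symm.trans (congrArg (freeFunctor V).map e)

end TempObj

end HornFilling

/-! ### A frame as a bicomplete symmetric monoidal closed category. -/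

section ThinCategory

/-- The thin category of a frame. -/
structure FrameCat (L : Type) : Type (u + 1) where
  /-- The underlying element of the frame. -/
  val : L

namespace FrameCat

variable {L : Type} [Order.Frame L]

instance : Category.{u} (FrameCat.{u} L) where
  Hom A B := ULift.{u} (PLift (A.val ≤ B.val))
  id A := ⟨⟨le_rfl⟩⟩
  comp f g := ⟨⟨f.down.down.trans g.down.down⟩⟩

/-- The morphism given by an inequality. -/
def homOfLE {A B : FrameCat.{u} L} (h : A.val ≤ B.val) : A ⟶ B := ⟨⟨h⟩⟩

lemma le_of_hom {A B : FrameCat.{u} L} (f : A ⟶ B) : A.val ≤ B.val := f.down.down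

/-- Every coherence and naturality condition in the counterexample holds by this. -/
instance (A B : FrameCat.{u} L) : Subsingleton (A ⟶ B) :=
  inferInstanceAs (Subsingleton (ULift (PLift _)))

/-- The isomorphism given by an equality of elements. -/
def isoOfEq {A B : FrameCat.{u} L} (h : A.val = B.val) : A ≅ B where
  hom := homOfLE h.le
  inv := homOfLE h.ge
  hom_inv_id := Subsingleton.elim _ _
  inv_hom_id := Subsingleton.elim _ _

/-- The cartesian monoidal structure, given by meets. -/
instance : MonoidalCategory (FrameCat.{u} L) where
  tensorObj A B := ⟨A.val ⊓ B.val⟩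
  tensorUnit := ⟨⊤⟩
  tensorHom f g := homOfLE (inf_le_inf (le_of_hom f) (le_of_hom g))
  whiskerLeft _ _ _ f := homOfLE (inf_le_inf_left _ (le_of_hom f))
  whiskerRight f _ := homOfLE (inf_le_inf_right _ (le_of_hom f))
  associator _ _ _ := isoOfEq (inf_assoc _ _ _)
  leftUnitor _ := isoOfEq (top_inf_eq _)
  rightUnitor _ := isoOfEq (inf_top_eq _)
  tensorHom_def _ _ := Subsingleton.elim _ _
  id_tensorHom_id _ _ := Subsingleton.elim _ _
  tensorHom_comp_tensorHom _ _ _ _ := Subsingleton.elim _ _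
  whiskerLeft_id _ _ := Subsingleton.elim _ _
  id_whiskerRight _ _ := Subsingleton.elim _ _
  associator_naturality _ _ _ := Subsingleton.elim _ _
  leftUnitor_naturality _ := Subsingleton.elim _ _
  rightUnitor_naturality _ := Subsingleton.elim _ _
  pentagon _ _ _ _ := Subsingleton.elim _ _
  triangle _ _ := Subsingleton.elim _ _

instance : SymmetricCategory (FrameCat.{u} L) where
  braiding _ _ := isoOfEq (inf_comm _ _)
  braiding_naturality_right _ _ _ _ := Subsingleton.elim _ _
  braiding_naturality_left _ _ := Subsingleton.elim _ _
  hexagon_forward _ _ _ := Subsingleton.elim _ _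
  hexagon_reverse _ _ _ := Subsingleton.elim _ _
  symmetry _ _ := Subsingleton.elim _ _

/-- The internal hom is given by the Heyting implication. -/
instance : MonoidalClosed (FrameCat.{u} L) where
  closed A :=
    { rightAdj :=
        { obj := fun B => ⟨A.val ⇨ B.val⟩
          map := fun f => homOfLE (himp_le_himp_left (le_of_hom f))
          map_id := fun _ => Subsingleton.elim _ _
          map_comp := fun _ _ => Subsingleton.elim _ _ }
      adj :=
        { unit :=
            { app := fun _ => homOfLE (le_himp_iff.mpr (inf_comm _ _).le)
              naturality := fun _ _ _ => Subsingleton.elim _ _ }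
          counit :=
            { app := fun _ => homOfLE inf_himp_le
              naturality := fun _ _ _ => Subsingleton.elim _ _ }
          left_triangle_components := fun _ => Subsingleton.elim _ _
          right_triangle_components := fun _ => Subsingleton.elim _ _ } }

instance : HasLimits (FrameCat.{u} L) where
  has_limits_of_shape _ _ :=
    { has_limit := fun F =>
        ⟨⟨{ cone :=
              { pt := ⟨⨅ j, (F.obj j).val⟩
                π :=
                  { app := fun j => homOfLE (iInf_le _ j)
                    naturality := fun _ _ _ => Subsingleton.elim _ _ } }
            isLimit :=
              { lift := fun s => homOfLE (le_iInf fun j => le_of_hom (s.π.app j))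
                fac := fun _ _ => Subsingleton.elim _ _
                uniq := fun _ _ _ => Subsingleton.elim _ _ } }⟩⟩ }

instance : HasColimits (FrameCat.{u} L) where
  has_colimits_of_shape _ _ :=
    { has_colimit := fun F =>
        ⟨⟨{ cocone :=
              { pt := ⟨⨆ j, (F.obj j).val⟩
                ι :=
                  { app := fun j => homOfLE (le_iSup (fun j => (F.obj j).val) j)
                    naturality := fun _ _ _ => Subsingleton.elim _ _ } }
            isColimit :=
              { desc := fun s => homOfLE (iSup_le fun j => le_of_hom (s.ι.app j))
                fac := fun _ _ => Subsingleton.elim _ _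
                uniq := fun _ _ _ => Subsingleton.elim _ _ } }⟩⟩ }

end FrameCat

end ThinCategory

/-! ### The nerve of a reflexive relation with values in a frame. -/

section Relations

open Simplicial VQuiv FrameCat

variable {L : Type} [Order.Frame L] {S : Type u}

instance (Q P : VQuiv (FrameCat.{u} L) S) : Subsingleton (Q ⟶ P) :=
  ⟨fun _ _ => VQuiv.hom_ext fun _ _ => Subsingleton.elim _ _⟩

instance {T : Type u} (f : S → T) (Q : VQuiv (FrameCat.{u} L) S) (P : VQuiv (FrameCat.{u} L) T) :
    Subsingleton (HomOver f Q P) :=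
  ⟨fun _ _ => HomOver.ext' fun _ _ => Subsingleton.elim _ _⟩

/-- A reflexive relation on `S` with values in the frame `L`. -/
structure FrameRel (L : Type) [Order.Frame L] (S : Type u) where
  /-- The truth value of the relation. -/
  rel : S → S → L
  refl (a : S) : rel a a = ⊤

namespace FrameRel

variable (R : FrameRel L S)

/-- The truth value of "`a` and `b` are related, and equal if `n = 0`". -/
def simplices (n : ℕ) (a b : S) : L := ⨆ _ : n = 0 → a = b, R.rel a b

lemma rel_le_simplices {n : ℕ} {a b : S} (h : n = 0 → a = b) : R.rel a b ≤ R.simplices n a b :=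
  le_iSup (fun _ : n = 0 → a = b => R.rel a b) h

lemma simplices_le_rel {n : ℕ} {a b : S} : R.simplices n a b ≤ R.rel a b := iSup_le fun _ => le_rfl

lemma simplices_self (n : ℕ) (a : S) : R.simplices n a a = ⊤ :=
  top_le_iff.mp ((R.refl a).ge.trans (R.rel_le_simplices fun _ => rfl))

/-- The quiver of `n`-simplices of a relation. -/
def quiver (n : ℕ) : VQuiv (FrameCat.{u} L) S := ⟨fun a b => ⟨R.simplices n a b⟩⟩

/-- Simplices restrict along endpoint-preserving maps. -/
def quiverMap {m n : FinInt} (f : m ⟶ n) : R.quiver n.len ⟶ R.quiver m.len :=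
  -- A map out of [0] that preserves both endpoints has target [0], so the equality constraint is
  -- inherited.
  ⟨fun _ _ => homOfLE (iSup_le fun h => R.rel_le_simplices fun hm => h (by
    rw [← FinInt.nat_last f rfl, hm, FinInt.nat_zero]))⟩

lemma simplices_inf_le_tensor (m n : ℕ) (a b c : S) :
    R.simplices m a c ⊓ R.simplices n c b ≤ ((tensor (R.quiver m) (R.quiver n)).obj a b).val :=
  le_of_hom (inc (R.quiver m) (R.quiver n) a b c)

/-- The comultiplication. -/
def quiverComul (m n : ℕ) : R.quiver (m + n) ⟶ tensor (R.quiver m) (R.quiver n) :=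
  ⟨fun a b => homOfLE (iSup_le fun h => by
    -- Reflexivity allows the middle vertex to be an endpoint. The factor between `a` and `b` is put
    -- where the length is nonzero: the second one if `n ≠ 0`, else the first, whose equality
    -- constraint is then that of the source.
    by_cases hn : n = 0
    · refine le_trans (le_inf (R.rel_le_simplices fun hm => h (by rw [hm, hn])) ?_)
        (R.simplices_inf_le_tensor m n a b b)
      rw [R.simplices_self]
      exact le_top
    · refine le_trans (le_inf ?_ (R.rel_le_simplices fun h' => absurd h' hn))
        (R.simplices_inf_le_tensor m n a b a)
      rw [R.simplices_self]
      exact le_top)⟩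

/-- The counit. -/
def quiverCounit : R.quiver 0 ⟶ (VQuiv.unit : VQuiv (FrameCat.{u} L) S) :=
  ⟨fun _ _ => homOfLE (iSup_le fun h => le_top.trans (le_of_hom (unitInc (h rfl))))⟩

/-- The inverse of the counit. -/
def quiverUnit : (VQuiv.unit : VQuiv (FrameCat.{u} L) S) ⟶ R.quiver 0 :=
  ⟨fun a _ => HomOver.unitDesc fun h => homOfLE (by
    subst h
    exact (R.simplices_self 0 a).ge)⟩

/-- The templicial object of a reflexive relation: the nerve of a relation with values in a
frame, in which an `n`-simplex from `a` to `b` with `n > 0` is a witness that `a` and `b` are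
related. -/
def nerve : TempObj (FrameCat.{u} L) where
  S := S
  X :=
    { obj := fun n => R.quiver n.unop.len
      map := fun f => R.quiverMap f.unop
      map_id := fun _ => Subsingleton.elim _ _
      map_comp := fun _ _ => Subsingleton.elim _ _ }
  oplax :=
    { η := R.quiverCounit
      δ := fun m n => R.quiverComul m.unop.len n.unop.len
      δ_natural_left := fun _ _ => Subsingleton.elim _ _
      δ_natural_right := fun _ _ => Subsingleton.elim _ _
      oplax_associativity := fun _ _ _ => Subsingleton.elim _ _
      oplax_left_unitality := fun _ => Subsingleton.elim _ _
      oplax_right_unitality := fun _ => Subsingleton.elim _ _ }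
  unital := ⟨R.quiverUnit, Subsingleton.elim _ _, Subsingleton.elim _ _⟩

variable {R} {Y : TempObj (FrameCat.{u} L)}

open TempObj

lemma hom_ext_vmap {φ ψ : Y ⟶ R.nerve} (h : ∀ a, vmap φ a = vmap ψ a) : φ = ψ := by
  obtain ⟨f, φ, _, _, _⟩ := φ
  obtain ⟨g, ψ, _, _, _⟩ := ψ
  obtain rfl : f = g := funext h
  exact Hom.ext' fun n => Subsingleton.elim (α := HomOver f (Y.X.obj n) (R.nerve.X.obj n)) _ _

variable (R Y) in
/-- The constant templicial morphism. -/
def constHom (s : S) : Y ⟶ R.nerve :=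
  show Hom Y R.nerve from
  { base := fun _ => s
    app := fun _ => ⟨fun _ _ => homOfLE (le_top.trans (R.simplices_self _ s).ge)⟩
    naturality := fun _ => Subsingleton.elim (α := HomOver _ _ (R.quiver _)) _ _
    comult := fun m n => Subsingleton.elim
      (α := HomOver _ _ (tensor (R.quiver m.unop.len) (R.quiver n.unop.len))) _ _
    counit := Subsingleton.elim (α := HomOver _ _ (VQuiv.unit : VQuiv (FrameCat.{u} L) S)) _ _ }

/-- The tensor unit is ⊤, so elements only detect truth value ⊤. -/
lemma top_le_rel {n : ℕ} {a b : S} (f : 𝟙_ (FrameCat.{u} L) ⟶ R.quiver n a b) :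
    ⊤ ≤ R.rel a b :=
  (le_of_hom f).trans R.simplices_le_rel

lemma vmap_eq_of_edge (hR : ∀ a b, ⊤ ≤ R.rel a b → a = b) {K : SSet.{u}} (φ : free K ⟶ R.nerve)
    (σ : K _⦋1⦌) : vmap φ (vtx K σ 0) = vmap φ (vtx K σ 1) :=
  hR _ _ (top_le_rel (elMap (n := ⟨1⟩) φ σ rfl rfl))

lemma edge_mono {k l : ℕ} (h : k ≤ l) (i j : ℕ) (hij : i ≤ j) (_ : j ≤ 1) :
    (if i = 0 then k else l) ≤ if j = 0 then k else l := by
  grind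

/-- The edge of a simplex between two of its vertices. -/
def edge {N k l : ℕ} (h : k ≤ l) (hl : l ≤ N) : (Δ[N] : SSet.{u}) _⦋1⦌ :=
  SSet.stdSimplex.objEquiv.symm (mkΔ (fun y => if y = 0 then k else l)
    (edge_mono h) (by simpa using hl))

lemma simplexFn_edge {N k l : ℕ} (h : k ≤ l) (hl : l ≤ N) {y : ℕ} (hy : y ≤ 1) :
    simplexFn (edge.{u} h hl) y = if y = 0 then k else l :=
  natΔ_mkΔ (g := fun y => if y = 0 then k else l) (hg := edge_mono h) (h1 := by simpa using hl) hy

variable {n : ℕ} {i : Fin (n + 3)}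

/-- The edge from `k` to `l` lies in the horn, since it misses the first or the last vertex. -/
lemma vmap_hornPt_eq (hR : ∀ a b, ⊤ ≤ R.rel a b → a = b) (h0 : 0 < i) (hi : i < Fin.last (n + 2))
    (φ : free (Λ[n + 2, i] : SSet.{u}) ⟶ R.nerve) {k l : ℕ} (h : k ≤ l) (hl : l ≤ n + 2)
    (hne : 0 < k ∨ l < n + 2) : vmap φ (hornPt i k) = vmap φ (hornPt i l) := by
  have h1 : simplexFn (edge.{u} h hl) 0 = k := simplexFn_edge h hl (Nat.zero_le _)
  have h2 : simplexFn (edge.{u} h hl) 1 = l := simplexFn_edge h hl le_rfl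
  have hm := mem_horn_of_lt h0 hi (τ := edge.{u} h hl) (by rwa [h1, h2])
  let σ : (Λ[n + 2, i] : SSet.{u}) _⦋1⦌ := ⟨edge h hl, hm⟩
  refine (congrArg (vmap φ) (hornPt_eq (a := vtx Λ[n + 2, i] σ 0) ?_)).trans
    ((vmap_eq_of_edge hR φ σ).trans
      (congrArg (vmap φ) (hornPt_eq (a := vtx Λ[n + 2, i] σ 1) ?_)).symm)
  · exact (vertexVal_vtx (edge.{u} h hl) 0).trans h1
  · exact (vertexVal_vtx (edge.{u} h hl) 1).trans h2

lemma vmap_horn_eq (hR : ∀ a b, ⊤ ≤ R.rel a b → a = b) (h0 : 0 < i) (hi : i < Fin.last (n + 2))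
    (φ : free (Λ[n + 2, i] : SSet.{u}) ⟶ R.nerve) (a : (Λ[n + 2, i] : SSet.{u}) _⦋0⦌) :
    vmap φ a = vmap φ (hornPt i 0) := by
  rw [← hornPt_eq (a := a) rfl]
  have hk : vertexVal a.1 ≤ n + 2 := simplexFn_le _ _
  generalize vertexVal a.1 = k at hk
  rcases hk.lt_or_eq with hk | rfl
  · exact (vmap_hornPt_eq hR h0 hi φ (Nat.zero_le k) hk.le (.inr hk)).symm
  -- The edge from 0 to the last vertex may be absent from the horn, hence the detour through vertex
  -- 1.
  · exact ((vmap_hornPt_eq hR h0 hi φ (Nat.zero_le 1) (by omega) (.inr (by omega))).trans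
      (vmap_hornPt_eq hR h0 hi φ (by omega) le_rfl (.inl Nat.one_pos))).symm

/-- If only equal vertices are related with truth value `⊤`, then the underlying simplicial set of
the nerve is a quasi-category (it is discrete). -/
theorem quasicategory_underlying_nerve (hR : ∀ a b, ⊤ ≤ R.rel a b → a = b) :
    SSet.Quasicategory R.nerve.underlying where
  hornFilling' n i α h0 hi := by
    -- The horn is constant on vertices, and morphisms to the nerve are determined by vertices, so a
    -- constant simplex fills it.
    let ψ := R.constHom (freeSimplex (FrameCat.{u} L) n) (vmap (transpose α) (hornPt i 0))
    refine ⟨SSet.yonedaEquiv.symm (ψ : R.nerve.underlying.obj (op ⦋n + 2⦌)), ?_⟩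
    ext m τ
    induction m using Opposite.rec with | op m => ?_
    induction m using SimplexCategory.rec with | _ m => ?_
    refine (map_comp_transpose α τ).symm.trans (hom_ext_vmap fun a => ?_)
    exact vmap_horn_eq hR h0 hi (transpose α) _

/-- A simplex of this horn omits 0 or 2. Hence a single bead from 0 to 2 has the initial object as
value. -/
lemma not_endpoints_of_horn {m : ℕ} (τ : (Λ[2, 1] : SSet.{u}) _⦋m⦌) :
    ¬ (simplexFn τ.1 0 = 0 ∧ simplexFn τ.1 m = 2) := by
  rintro ⟨h0, h2⟩
  obtain ⟨j, hj, h⟩ := (SSet.mem_horn_iff_notMem_range _ _).mp τ.2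
  fin_cases j
  · exact h ⟨0, Fin.ext ((coe_stdSimplex_apply τ.1 0).trans h0)⟩
  · exact hj rfl
  · exact h ⟨Fin.last m, Fin.ext ((coe_stdSimplex_apply τ.1 (Fin.last m)).trans h2)⟩

/-- Stay at `c` through all beads but the last, which has positive length and can carry the relation
from `c` to `b`. -/
lemma le_Z_nerve {e : L} {c b : S} (hcb : e ≤ R.rel c b) {l : List ℕ} {j p : ℕ} (hj : j < p)
    (hl : ∀ t ∈ l, t < p) : e ≤ ((Z R.nerve.X j l p).obj c b).val := by
  induction l generalizing j with
  | nil => exact hcb.trans (R.rel_le_simplices fun h => by rw [sg_len] at h; omega)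
  | cons k l ih =>
    refine le_trans (le_inf (le_top.trans (R.simplices_self (sg j k).len c).ge)
      (ih (hl k List.mem_cons_self) fun t ht => hl t (List.mem_cons_of_mem _ ht))) ?_
    exact le_of_hom (inc (Xs R.nerve.X j k) (Z R.nerve.X k l p) c b c)

/-- The first bead carries the relation from `a` to `c`, and the rest of the necklace that from `c`
to `b`; an inner joint keeps the two apart. -/
lemma le_Z_nerve_cons {e : L} {a c b : S} (hac : e ≤ R.rel a c) (hcb : e ≤ R.rel c b) {l : List ℕ}
    {k p : ℕ} (hk : k ≠ 0) (hl : ∀ t ∈ k :: l, t < p) :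
    e ≤ ((Z R.nerve.X 0 (k :: l) p).obj a b).val := by
  refine le_trans (le_inf (hac.trans (R.rel_le_simplices (n := (sg 0 k).len) fun h => absurd h hk))
    (le_Z_nerve hcb (hl k List.mem_cons_self) fun t ht => hl t (List.mem_cons_of_mem _ ht))) ?_
  exact le_of_hom (inc (Xs R.nerve.X 0 k) (Z R.nerve.X k l p) a b c)

/-- If `a` and `b` are jointly joined by paths of length two with truth value `⊤`, but are not
related with truth value `⊤`, then the nerve is not a quasi-category. -/
theorem not_isQuasicategory_nerve {a b : S} (hab : ¬ ⊤ ≤ R.rel a b)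
    (h : ⨆ c, R.rel a c ⊓ R.rel c b = ⊤) : ¬ R.nerve.IsQuasicategory := by
  intro hq
  -- Without inner joints the left side is a coproduct over no simplices; with one, the right side
  -- is ⊤ by the hypothesis on the join.
  have key : ∀ (l : List ℕ) (p : ℕ), (∀ t ∈ l, t ≠ 0 ∧ t < p) →
      ((Z (freeHorn (FrameCat.{u} L) 0 1).X 0 l p).obj (hornVertex _ 0 1 0)
        (hornVertex _ 0 1 2)).val ≤ ((Z R.nerve.X 0 l p).obj a b).val := by
    rintro (_ | ⟨k, l⟩) p hl
    · refine le_of_hom (freeDesc (K := Λ[2, 1]) (n := sg 0 p) fun σ ha hb =>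
        absurd ?_ (not_endpoints_of_horn σ))
      refine ⟨?_, ?_⟩
      · exact (vertexVal_vtx σ.1 0).symm.trans (congrArg (fun x => vertexVal x.1) ha)
      · exact (vertexVal_vtx σ.1 _).symm.trans (congrArg (fun x => vertexVal x.1) hb)
    · refine le_top.trans (h.ge.trans (iSup_le fun c => ?_))
      exact le_Z_nerve_cons inf_le_left inf_le_right (hl k List.mem_cons_self).1
        fun t ht => (hl t ht).2
  let s₀ : (freeHorn (FrameCat.{u} L) 0 1).nec (hornVertex _ 0 1 0) (hornVertex _ 0 1 2) ⟶
      R.nerve.nec a b :=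
    { app := fun N => homOfLE (key N.unop.joints N.unop.p fun t ht => by
        obtain ⟨h1, h2, h3⟩ := Nec.mem_joints.mp ht
        exact ⟨h2, lt_of_le_of_ne (N.unop.le t h1) h3⟩)
      naturality := fun _ _ _ => Subsingleton.elim _ _ }
  -- The mere existence of `s` is contradictory: its one-bead component sends the top simplex of Δ^2
  -- to an element of R(a, b).
  obtain ⟨s, -⟩ := hq a b (n := 0) (i := 1) (by decide) (by decide) s₀
  refine hab (top_le_rel (n := 2) (el (K := Δ[2]) (n := ⟨2⟩) (topSimplex 2) ?_ ?_ ≫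
    simpleComp s ⟨2⟩))
  · exact vertexVal_injective (vertexVal_vtx _ _)
  · exact vertexVal_injective (vertexVal_vtx _ _)

end FrameRel

end Relations

/-! ### A relation with values in the subsets of a two-element set. -/

section Counterexample

/-- Two vertices and two intermediate vertices. -/
inductive Diamond : Type u
  | src
  | tgt
  | mid (i : Bool)

open Diamond in
/-- The source and the target are related to the intermediate vertex `i` with truth value `{i}`. -/
def diamondRel : Diamond.{u} → Diamond.{u} → Set Bool
  | src, src => ⊤
  | tgt, tgt => ⊤
  | src, mid i => {i}
  | mid i, tgt => {i}
  | mid i, mid j => {_k | i = j}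
  | _, _ => ⊥

/-- The reflexive relation `diamondRel`. -/
def diamond : FrameRel (Set Bool) Diamond.{u} where
  rel := diamondRel
  refl a := by cases a <;> simp [diamondRel]

/-- Off the diagonal the truth values are singletons or empty, so testing membership of both
booleans is enough. -/
lemma eq_of_top_le_diamond (a b : Diamond.{u}) (h : ⊤ ≤ diamond.rel a b) : a = b := by
  have h' : ∀ k, k ∈ diamondRel a b := fun k => h (Set.mem_univ k)
  have ht := h' true
  have hf := h' false
  cases a <;> cases b <;> simp_all [diamondRel]

/-- The point `k` of the truth value is witnessed by the path through `.mid k`; no single path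
covers both points. -/
lemma iSup_diamond : ⨆ c, diamond.{u}.rel .src c ⊓ diamond.rel c .tgt = ⊤ := by
  refine top_le_iff.mp fun k _ => ?_
  exact (le_iSup (fun c => diamond.{u}.rel .src c ⊓ diamond.rel c .tgt) (.mid k)) ⟨rfl, rfl⟩

lemma not_top_le_diamond : ¬ ⊤ ≤ diamond.{u}.rel .src .tgt := fun h =>
  nomatch eq_of_top_le_diamond _ _ h

end Counterexample

end Templ

end

theorem mainTheorem10 :
    (∀ (V : Type w) [Category.{u} V] [MonoidalCategory V] [SymmetricCategory V] [MonoidalClosed V]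
      [HasLimits V] [HasColimits V] (X : Templ.TempObj V),
      X.IsQuasicategory → SSet.Quasicategory X.underlying) ∧
    ∃ (V : Type (u + 1)) (_ : Category.{u} V) (_ : MonoidalCategory V) (_ : SymmetricCategory V)
      (_ : MonoidalClosed V) (_ : HasLimits V) (_ : HasColimits V) (X : Templ.TempObj V),
      SSet.Quasicategory X.underlying ∧ ¬ X.IsQuasicategory :=
  ⟨fun _ _ _ _ _ _ _ _ hX => hX.quasicategory_underlying,
    Templ.FrameCat.{u} (Set Bool), inferInstance, inferInstance, inferInstance, inferInstance,
    inferInstance, inferInstance, Templ.diamond.nerve,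
    Templ.FrameRel.quasicategory_underlying_nerve Templ.eq_of_top_le_diamond,
    Templ.FrameRel.not_isQuasicategory_nerve Templ.not_top_le_diamond Templ.iSup_diamond⟩
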